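/- **Setting.** Let $\mathbb K$ be a field of characteristic $0$, $A$ an associative unital $\mathbb K$-algebra, $G$ a finite group acting on $A$ by $\mathbb K$-algebra automorphisms, and $W\in A$ a central, $G$-invariant element. The crossed product $A\rtimes G=\bigoplus_{g\in G}A\otimes g$ has multiplication $(a\otimes g)(b\otimes h)=a\,g(b)\otimes gh$; we identify $a\in A$ with $a\otimes 1$. Then $W$ is central in $A\rtimes G$. **Periodic cohomology.** A mixed complex is a $\mathbb Z$-graded vector space $\mathcal C=\bigoplus_n\mathcal C_n$ with operators $b,B$ of degrees $1,-1$ such that $b^2=B^2=bB+Bb=0$. Let $t$ be a variable of degree $2$ and $\mathcal C((t))^n=\{\sum_{i\ge i_0}c_it^i : i_0\in\mathbb Z,\ c_i\in\mathcal C_{n-2i}\}$. The periodic cohomology of $\mathcal C$ is the $\mathbb Z$-graded $\mathbb K[t^{\pm1}]$-module $H^*(\mathcal C((t)),b+tB)$. **Hochschild mixed complexes.** Let $C$ be an associative unital $\mathbb K$-algebra and $V\in C$ central. Put $\mathcal B_{-n}(C)=C\otimes C^{\otimes n}\otimes C$ for $n\ge0$ (tensor products over $\mathbb K$), with the operators $$\delta_{\rm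 bar}(a_0[a_1|\dots|a_n]a_{n+1})=\sum_{i=0}^{n}(-1)^i\,a_0\otimes\dots\otimes a_ia_{i+1}\otimes\dots\otimes a_{n+1}\quad(n\ge1),\qquad \delta_{\rm bar}=0\ \text{on}\ \mathcal B_0(C),$$ $$\delta_{\rm curv}(a_0[a_1|\dots|a_n]a_{n+1})=\sum_{i=0}^{n}(-1)^i\,a_0\otimes\dots\otimes a_i\otimes V\otimes a_{i+1}\otimes\dots\otimes a_{n+1}.$$ Let $M$ be a $C$-bimodule on which left and right multiplication by $V$ agree. The cochain mixed complex is $\mathcal B^n(C,M)=\mathrm{Hom}_{C\otimes C^{\rm op}}(\mathcal B_{-n}(C),M)$, $n\ge 0$, with $b=\delta_{\rm bar}^\vee$ and $B=\delta_{\rm curv}^\vee$, where $\delta^\vee(D)=(-1)^{|D|}D\circ\delta$. The chain mixed complex is $\mathcal B_{-n}(C,M)=M\otimes_{C\otimes C^{\rm op}}\mathcal B_{-n}(C)$, the quotient of $M\otimes\mathcal B_{-n}(C)$ by the relations $a_0ma_1\otimes\underline a=m\otimes a_1\underline a\,a_0$, placed in degree $-n$, with $b=1\otimes\delta_{\rm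 bar}$ and $B=1\otimes\delta_{\rm curv}$. Their periodic cohomologies are denoted ${}^t\mathsf{HH}^*(C,V;M)$ and ${}^t\mathsf{HH}_*(C,V;M)$; when $M=C$ we write ${}^t\mathsf{HH}^*(C,V)$ and ${}^t\mathsf{HH}_*(C,V)$. **Products.** Write $\Delta(a_0[a_1|\dots|a_n]a_{n+1})=\sum_{i=0}^n (a_0[a_1|\dots|a_i]1)\otimes(1[a_{i+1}|\dots|a_n]a_{n+1})=\underline a_{(1)}\otimes\underline a_{(2)}$ (summation understood). Suppose that $M$ is a $\mathbb K$-algebra whose bimodule structure comes from an algebra map $C\to M$. Then $$\langle\underline a,D_1\cup D_2\rangle=(-1)^{|D_1||\underline a_{(2)}|}\langle\underline a_{(1)},D_1\rangle\langle\underline a_{(2)},D_2\rangle,\qquad (m\otimes\underline a)\cap D=(-1)^{|D||\underline a_{(2)}|}\,m\langle\underline a_{(1)},D\rangle\otimes\underline a_{(2)}$$ define morphisms of mixed complexes $\mathcal B^*(C,M)\otimes\mathcal B^*(C,M)\to\mathcal B^*(C,M)$ and $\mathcal B_*(C,M)\otimes\mathcal B^*(C,M)\to\mathcal B_*(C,M)$.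 By extending them $t$-linearly to Laurent series one obtains the cup product on ${}^t\mathsf{HH}^*(C,V;M)$ and the cap product ${}^t\mathsf{HH}_*(C,V;M)\otimes{}^t\mathsf{HH}^*(C,V;M)\to{}^t\mathsf{HH}_*(C,V;M)$. Below this is used for $(C,V,M)=(A\rtimes G,W,A\rtimes G)$ and for $(C,V,M)=(A,W,A\rtimes G)$. **Group action.** The group $G$ acts on $A\rtimes G$ by $h(a\otimes g)=h(a)\otimes hgh^{-1}$, on $\mathcal B_*(A)$ diagonally, and hence on $\mathcal B^*(A,A\rtimes G)$ by $h(D)=h\circ D\circ h^{-1}$ and on $\mathcal B_*(A,A\rtimes G)$ by $h(m\otimes\underline a)=h(m)\otimes h(\underline a)$. These actions commute with the differentials and with the cup and cap products, so $G$ acts on ${}^t\mathsf{HH}^*(A,W;A\rtimes G)$ and ${}^t\mathsf{HH}_*(A,W;A\rtimes G)$. The cup product restricts to the invariants ${}^t\mathsf{HH}^*(A,W;A\rtimes G)^G$, and the cap product descends to a product of the coinvariants ${}^t\mathsf{HH}_*(A,W;A\rtimes G)_G$ with these invariants, with values in the coinvariants. **Proposition.** There are isomorphisms of $\mathbb Z$-graded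 $\mathbb K[t^{\pm1}]$-modules $$\Phi:\ {}^t\mathsf{HH}^*(A\rtimes G,W)\ \xrightarrow{\ \sim\ }\ {}^t\mathsf{HH}^*(A,W;A\rtimes G)^G,\qquad \Psi:\ {}^t\mathsf{HH}_*(A\rtimes G,W)\ \xrightarrow{\ \sim\ }\ {}^t\mathsf{HH}_*(A,W;A\rtimes G)_G$$ which are compatible with the cup and cap products: $$\Phi(x\cup y)=\Phi(x)\cup\Phi(y),\qquad \Psi(\omega\cap x)=\Psi(\omega)\cap\Phi(x)$$ for all $x,y\in{}^t\mathsf{HH}^*(A\rtimes G,W)$ and $\omega\in{}^t\mathsf{HH}_*(A\rtimes G,W)$. -/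

import Mathlib

open scoped TensorProduct DirectSum

namespace CurvedHochschild

noncomputable section

universe u v v₁ v₂ v₃ w

/-! ## Mixed complexes and their periodic cohomology -/

/-- A mixed complex over `K`: a `ℤ`-graded vector space `C = ⨁ₙ gr n` with operators `b` of degree
`1` and `B` of degree `-1` such that `b² = 0`, `B² = 0` and `bB + Bb = 0`. -/
structure MixedComplex (K : Type u) (C : Type v) [Field K] [AddCommGroup C] [Module K C] where
  gr : ℤ → Submodule K C
  isInternal : DirectSum.IsInternal gr
  b : C →ₗ[K] C
  B : C →ₗ[K] C
  b_mem : ∀ {n : ℤ} {c : C}, c ∈ gr n → b c ∈ gr (n + 1)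
  B_mem : ∀ {n : ℤ} {c : C}, c ∈ gr n → B c ∈ gr (n - 1)
  b_b : ∀ c : C, b (b c) = 0
  B_B : ∀ c : C, B (B c) = 0
  b_B : ∀ c : C, b (B c) + B (b c) = 0

namespace MixedComplex

variable {K : Type u} {C : Type v} [Field K] [AddCommGroup C] [Module K C]
variable (X : MixedComplex K C)

/-- The degree `n` part of `C((t))`, where `t` has degree `2`: series `∑ᵢ cᵢ tⁱ`, recorded as
`i ↦ cᵢ`, with `cᵢ = 0` for `i ≪ 0` and `cᵢ` of degree `n - 2i`. -/
def laurent (n : ℤ) : Submodule K (ℤ → C) where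
  carrier := {c | (∃ i₀ : ℤ, ∀ i < i₀, c i = 0) ∧ ∀ i, c i ∈ X.gr (n - 2 * i)}
  add_mem' := by
    rintro c d ⟨⟨i, hi⟩, hc⟩ ⟨⟨j, hj⟩, hd⟩
    refine ⟨⟨min i j, fun k hk => ?_⟩, fun k => add_mem (hc k) (hd k)⟩
    simp [hi k (lt_of_lt_of_le hk (min_le_left _ _)), hj k (lt_of_lt_of_le hk (min_le_right _ _))]
  zero_mem' := ⟨⟨0, fun _ _ => rfl⟩, fun _ => zero_mem _⟩
  smul_mem' := by
    rintro a c ⟨⟨i, hi⟩, hc⟩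
    exact ⟨⟨i, fun k hk => by simp [hi k hk]⟩, fun k => Submodule.smul_mem _ _ (hc k)⟩

/-- The differential `b + tB` on series. -/
def perDiff : (ℤ → C) →ₗ[K] (ℤ → C) where
  toFun c := fun i => X.b (c i) + X.B (c (i - 1))
  map_add' c d := by ext i; simp only [Pi.add_apply, map_add]; abel
  map_smul' a c := by ext i; simp

theorem perDiff_apply (c : ℤ → C) (i : ℤ) : X.perDiff c i = X.b (c i) + X.B (c (i - 1)) := rfl

theorem perDiff_perDiff (c : ℤ → C) : X.perDiff (X.perDiff c) = 0 := by
  ext i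
  have h := X.b_B (c (i - 1))
  simp only [perDiff_apply, map_add, X.b_b, X.B_B, Pi.zero_apply, zero_add, add_zero, h]

theorem perDiff_mem {n : ℤ} {c : ℤ → C} (hc : c ∈ X.laurent n) :
    X.perDiff c ∈ X.laurent (n + 1) := by
  obtain ⟨⟨i₀, h0⟩, hg⟩ := hc
  refine ⟨⟨i₀, fun i hi => ?_⟩, fun i => add_mem ?_ ?_⟩
  · rw [perDiff_apply, h0 i hi, h0 (i - 1) (by omega)]; simp
  · have := X.b_mem (hg i)
    rwa [show n - 2 * i + 1 = n + 1 - 2 * i by ring] at this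
  · have := X.B_mem (hg (i - 1))
    rwa [show n - 2 * (i - 1) - 1 = n + 1 - 2 * i by ring] at this

/-- The degree `n` cocycles of `(C((t)), b + tB)`. -/
def cocycles (n : ℤ) : Submodule K (ℤ → C) := X.laurent n ⊓ LinearMap.ker X.perDiff

/-- The degree `n` coboundaries of `(C((t)), b + tB)`. -/
def coboundaries (n : ℤ) : Submodule K (ℤ → C) := (X.laurent (n - 1)).map X.perDiff

theorem coboundaries_le_cocycles (n : ℤ) : X.coboundaries n ≤ X.cocycles n := by
  rintro _ ⟨c, hc, rfl⟩
  refine ⟨?_, X.perDiff_perDiff c⟩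
  have := X.perDiff_mem hc
  rwa [sub_add_cancel] at this

/-- The degree `n` periodic cohomology `Hⁿ(C((t)), b + tB)`. -/
abbrev H (n : ℤ) : Type v := ↥(X.cocycles n) ⧸ (X.coboundaries n).submoduleOf (X.cocycles n)

/-- The class of a cocycle. -/
def toH (n : ℤ) : ↥(X.cocycles n) →ₗ[K] X.H n := Submodule.mkQ _

theorem toH_surjective (n : ℤ) : Function.Surjective (X.toH n) := Submodule.mkQ_surjective _

theorem toH_eq_zero {n : ℤ} (z : X.cocycles n) :
    X.toH n z = 0 ↔ ∃ c ∈ X.laurent (n - 1), X.perDiff c = z.1 := by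
  unfold toH
  rw [Submodule.mkQ_apply, Submodule.Quotient.mk_eq_zero]
  exact Iff.rfl

/-- Multiplication of series by `tᵏ`. -/
def shift (k : ℤ) : (ℤ → C) →ₗ[K] (ℤ → C) where
  toFun c := fun i => c (i - k)
  map_add' _ _ := rfl
  map_smul' _ _ := rfl

theorem shift_mem (k : ℤ) {n : ℤ} {c : ℤ → C} (hc : c ∈ X.laurent n) :
    shift (K := K) k c ∈ X.laurent (n + 2 * k) := by
  obtain ⟨⟨i₀, h0⟩, hg⟩ := hc
  refine ⟨⟨i₀ + k, fun i hi => h0 _ (by omega)⟩, fun i => ?_⟩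
  have := hg (i - k)
  rwa [show n - 2 * (i - k) = n + 2 * k - 2 * i by ring] at this

theorem perDiff_shift (k : ℤ) (c : ℤ → C) :
    X.perDiff (shift (K := K) k c) = shift (K := K) k (X.perDiff c) := by
  ext i
  simp only [perDiff_apply, shift, LinearMap.coe_mk, AddHom.coe_mk]
  rw [show i - 1 - k = i - k - 1 by ring]

end MixedComplex

/-- A linear map of degree `d` (even) on series which commutes with `b + tB` acts on periodic
cohomology. -/
def perMap {K : Type u} {C : Type v} {C' : Type w} [Field K] [AddCommGroup C] [Module K C]
    [AddCommGroup C'] [Module K C'] (X : MixedComplex K C) (Y : MixedComplex K C')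
    (f : (ℤ → C) →ₗ[K] (ℤ → C')) (d : ℤ)
    (hmem : ∀ n : ℤ, ∀ c ∈ X.laurent n, f c ∈ Y.laurent (n + d))
    (hcomm : ∀ c, Y.perDiff (f c) = f (X.perDiff c)) (n m : ℤ) (hm : m = n + d) :
    X.H n →ₗ[K] Y.H m :=
  Submodule.mapQ _ _
    (f.restrict (p := X.cocycles n) (q := Y.cocycles m) fun c hc =>
      ⟨hm ▸ hmem n c hc.1, by
        have h : X.perDiff c = 0 := hc.2
        simp [LinearMap.mem_ker, hcomm, h]⟩)
    (by
      rintro ⟨_, _⟩ ⟨c, hc, rfl⟩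
      refine ⟨f c, ?_, hcomm c⟩
      have := hmem _ c hc
      rwa [show n - 1 + d = m - 1 by omega] at this)

namespace MixedComplex

variable {K : Type u} {C : Type v} [Field K] [AddCommGroup C] [Module K C]
variable (X : MixedComplex K C)

/-- Multiplication by `tᵏ` on periodic cohomology; together these maps, for `k : ℤ`, are the graded
`K[t, t⁻¹]`-module structure. -/
def tPow (k n : ℤ) : X.H n →ₗ[K] X.H (n + 2 * k) :=
  perMap X X (shift k) (2 * k) (fun _ _ hc => X.shift_mem k hc) (X.perDiff_shift k) n _ rfl

theorem tPow_toH (k n : ℤ) (z : X.cocycles n) :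
    ∃ h, X.tPow k n (X.toH n z) = X.toH (n + 2 * k) ⟨fun i => z.1 (i - k), h⟩ := ⟨_, rfl⟩

/-- An action of a group `G` on a mixed complex: by degree preserving linear maps commuting with
both differentials. -/
structure Action (X : MixedComplex K C) (G : Type w) [Group G] where
  ρ : Representation K G C
  gr_mem : ∀ (g : G) {n : ℤ} {c : C}, c ∈ X.gr n → ρ g c ∈ X.gr n
  comm_b : ∀ (g : G) (c : C), X.b (ρ g c) = ρ g (X.b c)
  comm_B : ∀ (g : G) (c : C), X.B (ρ g c) = ρ g (X.B c)

variable {X} {G : Type w} [Group G]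

/-- The induced action on periodic cohomology, coefficientwise on series. -/
def Action.onH (α : X.Action G) (n : ℤ) : Representation K G (X.H n) where
  toFun g := perMap X X ((α.ρ g).compLeft ℤ) 0
    (fun n c hc => by
      obtain ⟨⟨i₀, h0⟩, hg⟩ := hc
      refine ⟨⟨i₀, fun i hi => by simp [h0 i hi]⟩, fun i => ?_⟩
      rw [add_zero]
      exact α.gr_mem g (hg i))
    (fun c => by ext i; simp [perDiff_apply, α.comm_b, α.comm_B]) n n (add_zero n).symm
  map_one' := by
    refine LinearMap.ext fun x => ?_
    obtain ⟨z, rfl⟩ := X.toH_surjective n x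
    refine congrArg (X.toH n) (Subtype.ext (funext fun i => ?_))
    simp [LinearMap.compLeft]
  map_mul' g h := by
    refine LinearMap.ext fun x => ?_
    obtain ⟨z, rfl⟩ := X.toH_surjective n x
    refine congrArg (X.toH n) (Subtype.ext (funext fun i => ?_))
    simp [LinearMap.compLeft]
    rfl

theorem Action.onH_toH (α : X.Action G) (n : ℤ) (g : G) (z : X.cocycles n) :
    ∃ h, α.onH n g (X.toH n z) = X.toH n ⟨fun i => α.ρ g (z.1 i), h⟩ := ⟨_, rfl⟩

theorem onH_tPow (α : X.Action G) (k n : ℤ) (g : G) (x : X.H n) :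
    α.onH (n + 2 * k) g (X.tPow k n x) = X.tPow k n (α.onH n g x) := by
  obtain ⟨z, rfl⟩ := X.toH_surjective n x
  rfl

end MixedComplex

/-! ## Products on periodic cohomology -/

section Conv

variable {K : Type u} {C₁ : Type v₁} {C₂ : Type v₂} {C₃ : Type v₃} [Field K]
  [AddCommGroup C₁] [Module K C₁] [AddCommGroup C₂] [Module K C₂] [AddCommGroup C₃] [Module K C₃]

/-- The product of series `∑ cᵢ tⁱ` and `∑ dᵢ tⁱ` (bounded below) along a bilinear map `β`. -/
def conv (β : C₁ →ₗ[K] C₂ →ₗ[K] C₃) (c : ℤ → C₁) (d : ℤ → C₂) : ℤ → C₃ :=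
  fun i => ∑ᶠ j : ℤ, β (c j) (d (i - j))

theorem conv_support (β : C₁ →ₗ[K] C₂ →ₗ[K] C₃) {c : ℤ → C₁} {d : ℤ → C₂}
    (hc : ∃ i₀ : ℤ, ∀ i < i₀, c i = 0) (hd : ∃ i₀ : ℤ, ∀ i < i₀, d i = 0) (i : ℤ) :
    (Function.support fun j => β (c j) (d (i - j))).Finite := by
  obtain ⟨j₀, hj⟩ := hc
  obtain ⟨k₀, hk⟩ := hd
  refine (Set.finite_Icc j₀ (i - k₀)).subset fun j hj' => ?_
  by_contra hne
  apply hj'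
  simp only [Set.mem_Icc, not_and_or, not_le] at hne
  rcases hne with h | h
  · simp [hj j h]
  · simp [hk (i - j) (by omega)]

theorem conv_combine (β β₁ β₂ : C₁ →ₗ[K] C₂ →ₗ[K] C₃) {c c₁ c₂ : ℤ → C₁} {d d₁ d₂ : ℤ → C₂}
    (a : K)
    (hc₁ : ∃ i₀ : ℤ, ∀ i < i₀, c₁ i = 0) (hd₁ : ∃ i₀ : ℤ, ∀ i < i₀, d₁ i = 0)
    (hc₂ : ∃ i₀ : ℤ, ∀ i < i₀, c₂ i = 0) (hd₂ : ∃ i₀ : ℤ, ∀ i < i₀, d₂ i = 0)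
    (i : ℤ) (h : ∀ j, β (c j) (d (i - j)) = β₁ (c₁ j) (d₁ (i - j)) + a • β₂ (c₂ j) (d₂ (i - j))) :
    conv β c d i = conv β₁ c₁ d₁ i + a • conv β₂ c₂ d₂ i := by
  unfold conv
  rw [finsum_congr h, finsum_add_distrib (conv_support β₁ hc₁ hd₁ i)
    ((conv_support β₂ hc₂ hd₂ i).subset fun j hj hj' => hj (by
      simp only at hj' ⊢; rw [hj', smul_zero])), smul_finsum' a (conv_support β₂ hc₂ hd₂ i)]

theorem bnd_map (f : C₁ →ₗ[K] C₂) {c : ℤ → C₁} (hc : ∃ i₀ : ℤ, ∀ i < i₀, c i = 0) :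
    ∃ i₀ : ℤ, ∀ i < i₀, f (c i) = 0 := by
  obtain ⟨i₀, h⟩ := hc
  exact ⟨i₀, fun i hi => by simp [h i hi]⟩

theorem bnd_shift {c : ℤ → C₁} (hc : ∃ i₀ : ℤ, ∀ i < i₀, c i = 0) :
    ∃ i₀ : ℤ, ∀ i < i₀, c (i - 1) = 0 := by
  obtain ⟨i₀, h⟩ := hc
  exact ⟨i₀, fun i hi => h _ (by omega)⟩

theorem conv_map (β : C₁ →ₗ[K] C₂ →ₗ[K] C₃) {C₄ : Type w} [AddCommGroup C₄] [Module K C₄]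
    (f : C₃ →ₗ[K] C₄) {c : ℤ → C₁} {d : ℤ → C₂}
    (hc : ∃ i₀ : ℤ, ∀ i < i₀, c i = 0) (hd : ∃ i₀ : ℤ, ∀ i < i₀, d i = 0) (i : ℤ) :
    f (conv β c d i) = conv (β.compr₂ f) c d i :=
  f.toAddMonoidHom.map_finsum (conv_support β hc hd i)

theorem conv_shift_left (β : C₁ →ₗ[K] C₂ →ₗ[K] C₃) (c : ℤ → C₁) (d : ℤ → C₂) (k i : ℤ) :
    conv β (fun j => c (j - k)) d i = conv β c d (i - k) := by
  unfold conv
  rw [← finsum_comp_equiv (Equiv.subRight k) (f := fun j => β (c j) (d (i - k - j)))]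
  refine finsum_congr fun j => ?_
  simp only [Equiv.subRight_apply]
  rw [show i - k - (j - k) = i - j by ring]

theorem conv_shift_right (β : C₁ →ₗ[K] C₂ →ₗ[K] C₃) (c : ℤ → C₁) (d : ℤ → C₂) (k i : ℤ) :
    conv β c (fun j => d (j - k)) i = conv β c d (i - k) := by
  refine finsum_congr fun j => ?_
  rw [show i - k - j = i - j - k by ring]

end Conv

section Pairing

variable {K : Type u} {C₁ : Type v₁} {C₂ : Type v₂} {C₃ : Type v₃} [Field K]
  [AddCommGroup C₁] [Module K C₁] [AddCommGroup C₂] [Module K C₂] [AddCommGroup C₃] [Module K C₃]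

/-- A morphism of mixed complexes `X ⊗ Y → Z`, given as a bilinear map which preserves degrees and
satisfies the Leibniz rule (with Koszul sign) for both differentials. -/
structure MixedPairing (X : MixedComplex K C₁) (Y : MixedComplex K C₂) (Z : MixedComplex K C₃) where
  μ : C₁ →ₗ[K] C₂ →ₗ[K] C₃
  mem : ∀ {p q : ℤ} {c : C₁} {d : C₂}, c ∈ X.gr p → d ∈ Y.gr q → μ c d ∈ Z.gr (p + q)
  leibniz_b : ∀ {p : ℤ} {c : C₁} (d : C₂), c ∈ X.gr p →
    Z.b (μ c d) = μ (X.b c) d + (p.negOnePow : K) • μ c (Y.b d)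
  leibniz_B : ∀ {p : ℤ} {c : C₁} (d : C₂), c ∈ X.gr p →
    Z.B (μ c d) = μ (X.B c) d + (p.negOnePow : K) • μ c (Y.B d)

namespace MixedPairing

variable {X : MixedComplex K C₁} {Y : MixedComplex K C₂} {Z : MixedComplex K C₃}
variable (P : MixedPairing X Y Z)

theorem conv_mem {p q : ℤ} {c : ℤ → C₁} {d : ℤ → C₂} (hc : c ∈ X.laurent p)
    (hd : d ∈ Y.laurent q) : conv P.μ c d ∈ Z.laurent (p + q) := by
  obtain ⟨⟨i₀, hi⟩, hc'⟩ := hc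
  obtain ⟨⟨j₀, hj⟩, hd'⟩ := hd
  refine ⟨⟨i₀ + j₀, fun i h => ?_⟩, fun i => ?_⟩
  · refine (finsum_congr fun j => ?_).trans finsum_zero
    by_cases hlt : j < i₀
    · simp [hi j hlt]
    · simp [hj (i - j) (by omega)]
  · refine finsum_induction (· ∈ Z.gr (p + q - 2 * i)) (zero_mem _) (fun _ _ => add_mem) fun j => ?_
    have := P.mem (hc' j) (hd' (i - j))
    rwa [show p - 2 * j + (q - 2 * (i - j)) = p + q - 2 * i by ring] at this

theorem perDiff_conv {p q : ℤ} {c : ℤ → C₁} {d : ℤ → C₂} (hc : c ∈ X.laurent p)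
    (hd : d ∈ Y.laurent q) : Z.perDiff (conv P.μ c d) =
      conv P.μ (X.perDiff c) d + (p.negOnePow : K) • conv P.μ c (Y.perDiff d) := by
  have bc := hc.1
  have bd := hd.1
  have hsgn : ∀ j : ℤ, (p - 2 * j).negOnePow = p.negOnePow := fun j => by
    rw [Int.negOnePow_sub, Int.negOnePow_even (2 * j) ⟨j, by ring⟩, mul_one]
  ext i
  have e1 : Z.b (conv P.μ c d i) = conv P.μ (fun j => X.b (c j)) d i +
      (p.negOnePow : K) • conv P.μ c (fun j => Y.b (d j)) i := by
    rw [conv_map P.μ Z.b bc bd]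
    refine conv_combine _ _ _ _ (bnd_map _ bc) bd bc (bnd_map _ bd) i fun j => ?_
    rw [LinearMap.compr₂_apply, P.leibniz_b _ (hc.2 j), hsgn]
  have e2 : Z.B (conv P.μ c d (i - 1)) = conv P.μ (fun j => X.B (c (j - 1))) d i +
      (p.negOnePow : K) • conv P.μ c (fun j => Y.B (d (j - 1))) i := by
    rw [conv_map P.μ Z.B bc bd, conv_shift_left P.μ (fun j => X.B (c j)) d 1 i,
      conv_shift_right P.μ c (fun j => Y.B (d j)) 1 i]
    refine conv_combine _ _ _ _ (bnd_map _ bc) bd bc (bnd_map _ bd) _ fun j => ?_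
    rw [LinearMap.compr₂_apply, P.leibniz_B _ (hc.2 j), hsgn]
  have e3 : conv P.μ (X.perDiff c) d i = conv P.μ (fun j => X.b (c j)) d i +
      (1 : K) • conv P.μ (fun j => X.B (c (j - 1))) d i :=
    conv_combine _ _ _ _ (bnd_map _ bc) bd (bnd_shift (bnd_map _ bc)) bd i fun j => by
      simp [MixedComplex.perDiff_apply]
  have e4 : conv P.μ c (Y.perDiff d) i = conv P.μ c (fun j => Y.b (d j)) i +
      (1 : K) • conv P.μ c (fun j => Y.B (d (j - 1))) i :=
    conv_combine _ _ _ _ bc (bnd_map _ bd) bc (bnd_shift (bnd_map _ bd)) i fun j => by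
      simp [MixedComplex.perDiff_apply]
  rw [MixedComplex.perDiff_apply, Pi.add_apply, Pi.smul_apply, e1, e2, e3, e4]
  module

theorem conv_mem_cocycles {p q : ℤ} {c : ℤ → C₁} {d : ℤ → C₂} (hc : c ∈ X.cocycles p)
    (hd : d ∈ Y.cocycles q) : conv P.μ c d ∈ Z.cocycles (p + q) := by
  refine ⟨P.conv_mem hc.1 hd.1, ?_⟩
  have h1 : X.perDiff c = 0 := hc.2
  have h2 : Y.perDiff d = 0 := hd.2
  change Z.perDiff (conv P.μ c d) = 0
  rw [P.perDiff_conv hc.1 hd.1, h1, h2]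
  ext i
  simp [conv]

/-- The product of series on cocycles. -/
def onCocycles (p q : ℤ) : ↥(X.cocycles p) →ₗ[K] ↥(Y.cocycles q) →ₗ[K] ↥(Z.cocycles (p + q)) :=
  LinearMap.mk₂ K (fun c d => ⟨conv P.μ c.1 d.1, P.conv_mem_cocycles c.2 d.2⟩)
    (fun c c' d => Subtype.ext <| funext fun i => by
      have := conv_combine P.μ P.μ P.μ (c := (c + c').1) (c₁ := c.1) (c₂ := c'.1) (d := d.1)
        1 c.2.1.1 d.2.1.1 c'.2.1.1 d.2.1.1 i (fun j => by simp)
      simpa using this)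
    (fun a c d => Subtype.ext <| funext fun i => by
      have := conv_combine P.μ P.μ P.μ (c := (a • c).1) (c₁ := 0) (c₂ := c.1) (d := d.1)
        a ⟨0, fun _ _ => rfl⟩ d.2.1.1 c.2.1.1 d.2.1.1 i (fun j => by simp)
      simpa [conv] using this)
    (fun c d d' => Subtype.ext <| funext fun i => by
      have := conv_combine P.μ P.μ P.μ (c := c.1) (d := (d + d').1) (d₁ := d.1) (d₂ := d'.1)
        1 c.2.1.1 d.2.1.1 c.2.1.1 d'.2.1.1 i (fun j => by simp)
      simpa using this)
    (fun a c d => Subtype.ext <| funext fun i => by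
      have := conv_combine P.μ P.μ P.μ (c := c.1) (d := (a • d).1) (d₁ := 0) (d₂ := d.1)
        a c.2.1.1 ⟨0, fun _ _ => rfl⟩ c.2.1.1 d.2.1.1 i (fun j => by simp)
      simpa [conv] using this)

/-- The product induced on periodic cohomology. -/
def onH (p q : ℤ) : X.H p →ₗ[K] Y.H q →ₗ[K] Z.H (p + q) :=
  Submodule.liftQ _
    (LinearMap.flip (Submodule.liftQ _
      (LinearMap.flip ((P.onCocycles p q).compr₂ (Z.toH (p + q))))
      (by
        rintro ⟨_, hd⟩ ⟨d, hd', rfl⟩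
        refine LinearMap.ext fun c => (Z.toH_eq_zero _).2
          ⟨(p.negOnePow : K) • conv P.μ c.1 d, ?_, ?_⟩
        · have := P.conv_mem c.2.1 hd'
          rw [show p + (q - 1) = p + q - 1 by ring] at this
          exact Submodule.smul_mem _ _ this
        · have h1 : X.perDiff c.1 = 0 := c.2.2
          rw [map_smul, P.perDiff_conv c.2.1 hd', h1]
          have h2 : conv P.μ (0 : ℤ → C₁) d = 0 := by ext i; simp [conv]
          rw [h2, zero_add, smul_smul, ← Int.cast_mul, Int.units_coe_mul_self, Int.cast_one,
            one_smul]
          rfl)))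
    (by
      rintro ⟨_, hc⟩ ⟨c, hc', rfl⟩
      refine LinearMap.ext fun y => ?_
      obtain ⟨d, rfl⟩ := Y.toH_surjective q y
      refine (Z.toH_eq_zero _).2 ⟨conv P.μ c d.1, ?_, ?_⟩
      · have := P.conv_mem hc' d.2.1
        rwa [show p - 1 + q = p + q - 1 by ring] at this
      · have h1 : Y.perDiff d.1 = 0 := d.2.2
        rw [P.perDiff_conv hc' d.2.1, h1]
        have h2 : conv P.μ c (0 : ℤ → C₂) = 0 := by ext i; simp [conv]
        rw [h2, smul_zero, add_zero]
        rfl)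

theorem onH_toH (p q : ℤ) (c : X.cocycles p) (d : Y.cocycles q) :
    P.onH p q (X.toH p c) (Y.toH q d) = Z.toH (p + q) (P.onCocycles p q c d) := rfl

variable {G : Type w} [Group G] {α : X.Action G} {β : Y.Action G} {γ : Z.Action G}

theorem onH_equivariant (h : ∀ (g : G) (c : C₁) (d : C₂), P.μ (α.ρ g c) (β.ρ g d) = γ.ρ g (P.μ c d))
    (p q : ℤ) (g : G) (x : X.H p) (y : Y.H q) :
    P.onH p q (α.onH p g x) (β.onH q g y) = γ.onH (p + q) g (P.onH p q x y) := by
  obtain ⟨c, rfl⟩ := X.toH_surjective p x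
  obtain ⟨d, rfl⟩ := Y.toH_surjective q y
  refine congrArg (Z.toH (p + q)) (Subtype.ext (funext fun i => ?_))
  change conv P.μ (fun j => α.ρ g (c.1 j)) (fun j => β.ρ g (d.1 j)) i =
    γ.ρ g (conv P.μ c.1 d.1 i)
  rw [conv_map P.μ (γ.ρ g) c.2.1.1 d.2.1.1]
  exact finsum_congr fun j => h g _ _

/-- The product on `G`-invariants induced by an equivariant product. -/
def onInvariants
    (h : ∀ (g : G) (c : C₁) (d : C₂), P.μ (α.ρ g c) (β.ρ g d) = γ.ρ g (P.μ c d)) (p q : ℤ) :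
    (α.onH p).invariants →ₗ[K] (β.onH q).invariants →ₗ[K] (γ.onH (p + q)).invariants :=
  LinearMap.mk₂ K
    (fun x y => ⟨P.onH p q x.1 y.1, fun g => by
      rw [← P.onH_equivariant h p q g, x.2 g, y.2 g]⟩)
    (fun _ _ _ => Subtype.ext (by simp)) (fun _ _ _ => Subtype.ext (by simp))
    (fun _ _ _ => Subtype.ext (by simp)) (fun _ _ _ => Subtype.ext (by simp))

/-- The product of a `G`-coinvariant and a `G`-invariant induced by an equivariant product. -/
def onCoinvariants
    (h : ∀ (g : G) (c : C₁) (d : C₂), P.μ (α.ρ g c) (β.ρ g d) = γ.ρ g (P.μ c d)) (p q : ℤ) :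
    (α.onH p).Coinvariants →ₗ[K] (β.onH q).invariants →ₗ[K] (γ.onH (p + q)).Coinvariants :=
  Representation.Coinvariants.lift (α.onH p)
    (((P.onH p q).compr₂ (Representation.Coinvariants.mk (γ.onH (p + q)))).compl₂
      (β.onH q).invariants.subtype)
    (fun g => by
      refine LinearMap.ext fun x => LinearMap.ext fun y => ?_
      have h1 := P.onH_equivariant h p q g x y.1
      rw [y.2 g] at h1
      simp only [LinearMap.comp_apply, LinearMap.compl₂_apply, LinearMap.compr₂_apply,
        Submodule.subtype_apply, h1, Representation.Coinvariants.mk_self_apply])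

theorem onInvariants_coe
    (h : ∀ (g : G) (c : C₁) (d : C₂), P.μ (α.ρ g c) (β.ρ g d) = γ.ρ g (P.μ c d)) (p q : ℤ)
    (x : (α.onH p).invariants) (y : (β.onH q).invariants) :
    (P.onInvariants h p q x y : Z.H (p + q)) = P.onH p q x y := rfl

theorem onCoinvariants_mk
    (h : ∀ (g : G) (c : C₁) (d : C₂), P.μ (α.ρ g c) (β.ρ g d) = γ.ρ g (P.μ c d)) (p q : ℤ)
    (x : X.H p) (y : (β.onH q).invariants) :
    P.onCoinvariants h p q (Representation.Coinvariants.mk _ x) y =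
      Representation.Coinvariants.mk _ (P.onH p q x y) := rfl

end MixedPairing

end Pairing

namespace MixedComplex.Action

variable {K : Type u} {C : Type v} [Field K] [AddCommGroup C] [Module K C]
variable {X : MixedComplex K C} {G : Type w} [Group G] (α : X.Action G)

/-- Multiplication by `tᵏ` on the invariants of periodic cohomology. -/
def tPowInv (k n : ℤ) : (α.onH n).invariants →ₗ[K] (α.onH (n + 2 * k)).invariants :=
  (X.tPow k n).restrict fun x hx g => by rw [onH_tPow, hx g]

/-- Multiplication by `tᵏ` on the coinvariants of periodic cohomology. -/
def tPowCoinv (k n : ℤ) : (α.onH n).Coinvariants →ₗ[K] (α.onH (n + 2 * k)).Coinvariants :=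
  Representation.Coinvariants.lift _ (Representation.Coinvariants.mk _ ∘ₗ X.tPow k n) fun g => by
    refine LinearMap.ext fun x => ?_
    simp only [LinearMap.comp_apply, ← onH_tPow, Representation.Coinvariants.mk_self_apply]

end MixedComplex.Action

/-! ## The bar resolution -/

section Bar

variable (K : Type u) {A : Type v} [Field K] [Ring A] [Algebra K A]

variable (A) in
/-- `A ⊗ ⋯ ⊗ A` (`m` factors over `K`). The degree `-n` term `A ⊗ A^{⊗ n} ⊗ A` of the bar resolution
is `T K A (n + 2)`, with `a₀[a₁|…|aₙ]aₙ₊₁ = tprod K ![a₀, …, aₙ₊₁]`. -/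
abbrev T (m : ℕ) : Type (max u v) := ⨂[K] (_ : Fin m), A

/-- The pure tensor `a₀ ⊗ ⋯ ⊗ aₘ₋₁` made from the first `m` terms of a sequence (a device that
avoids casts between `Fin` types in proofs). -/
def tp (m : ℕ) (a : ℕ → A) : T K A m := PiTensorProduct.tprod K fun i : Fin m => a i

variable {K}

theorem tp_congr {m : ℕ} {a a' : ℕ → A} (h : ∀ i < m, a i = a' i) : tp K m a = tp K m a' :=
  congrArg (PiTensorProduct.tprod K) (funext fun i : Fin m => h i.1 i.2)

theorem exists_seq {m : ℕ} (x : Fin m → A) : ∃ a : ℕ → A, x = fun i : Fin m => a i :=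
  ⟨fun i => if h : i < m then x ⟨i, h⟩ else 0, funext fun i => by simp⟩

theorem T_ext {m : ℕ} {N : Type*} [AddCommGroup N] [Module K N] {f g : T K A m →ₗ[K] N}
    (h : ∀ a : ℕ → A, f (tp K m a) = g (tp K m a)) : f = g := by
  refine PiTensorProduct.ext (MultilinearMap.ext fun x => ?_)
  obtain ⟨a, rfl⟩ := exists_seq x
  exact h a

variable (K)

/-- A multilinear map to a tensor power obtained from a map `F` of tuples such that changing one
entry of `x` changes one entry of `F x`, linearly. -/
def tprodOf {n m : ℕ} (F : (Fin n → A) → (Fin m → A))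
    (hF : ∀ (a : Fin n → A) (k : Fin n), ∃ (j : Fin m) (l : A →ₗ[K] A),
      ∀ x, F (Function.update a k x) = Function.update (F a) j (l x)) :
    MultilinearMap K (fun _ : Fin n => A) (T K A m) where
  toFun x := PiTensorProduct.tprod K (F x)
  map_update_add' {inst} a k x y := by
    obtain rfl : inst = instDecidableEqFin n := Subsingleton.elim _ _
    obtain ⟨j, l, h⟩ := hF a k
    simp [h]
  map_update_smul' {inst} a k c x := by
    obtain rfl : inst = instDecidableEqFin n := Subsingleton.elim _ _
    obtain ⟨j, l, h⟩ := hF a k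
    simp [h]

/-- `a₀ ⊗ ⋯ ⊗ aₘ₊₁ ↦ a₀ ⊗ ⋯ ⊗ aᵢaᵢ₊₁ ⊗ ⋯ ⊗ aₘ₊₁`. -/
def face (m : ℕ) (i : Fin (m + 1)) : T K A (m + 2) →ₗ[K] T K A (m + 1) :=
  PiTensorProduct.lift (tprodOf K (fun x => Fin.contractNth i.castSucc (· * ·) x) (by
    intro a k
    rcases lt_trichotomy (k : ℕ) i with h | h | h
    · refine ⟨⟨k, by omega⟩, LinearMap.id, fun x => funext fun j => ?_⟩
      simp only [Fin.contractNth, Function.update_apply, Fin.ext_iff, Fin.val_castSucc,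
        Fin.val_succ, LinearMap.id_apply]
      split_ifs <;> first | rfl | omega
    · refine ⟨i, LinearMap.mulRight K (a i.succ), fun x => funext fun j => ?_⟩
      simp only [Fin.contractNth, Function.update_apply, Fin.ext_iff, Fin.val_castSucc,
        Fin.val_succ, LinearMap.mulRight_apply]
      split_ifs <;> first | rfl | omega | skip
      rename_i h1 _ _
      rw [show j = i from Fin.ext h1]
    · by_cases h' : (k : ℕ) = i + 1
      · refine ⟨i, LinearMap.mulLeft K (a i.castSucc), fun x => funext fun j => ?_⟩
        simp only [Fin.contractNth, Function.update_apply, Fin.ext_iff, Fin.val_castSucc,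
          Fin.val_succ, LinearMap.mulLeft_apply]
        split_ifs <;> first | rfl | omega | skip
        rename_i h1 _ _
        rw [show j = i from Fin.ext h1]
      · refine ⟨⟨k - 1, by omega⟩, LinearMap.id, fun x => funext fun j => ?_⟩
        simp only [Fin.contractNth, Function.update_apply, Fin.ext_iff, Fin.val_castSucc,
          Fin.val_succ, LinearMap.id_apply]
        split_ifs <;> first | rfl | omega))

/-- `a₀ ⊗ ⋯ ⊗ aₘ ↦ a₀ ⊗ ⋯ ⊗ aᵢ ⊗ W ⊗ aᵢ₊₁ ⊗ ⋯ ⊗ aₘ`. -/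
def insertW (W : A) (m : ℕ) (i : Fin m) : T K A (m + 1) →ₗ[K] T K A (m + 2) :=
  PiTensorProduct.lift (tprodOf K (fun x => Fin.insertNth (α := fun _ => A) i.succ.castSucc W x) (by
    intro a k
    exact ⟨i.succ.castSucc.succAbove k, LinearMap.id, fun x =>
      (Fin.insertNth_update (α := fun _ => A) _ W k x a).symm ▸ rfl⟩))

/-- The bar differential
`a₀ ⊗ ⋯ ⊗ aₘ₊₁ ↦ ∑_{0 ≤ i ≤ m} (-1)ⁱ a₀ ⊗ ⋯ ⊗ aᵢaᵢ₊₁ ⊗ ⋯ ⊗ aₘ₊₁`. On the degree `-n` term of the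
bar resolution, `n ≥ 1`, this is used with `m = n`. -/
def δbar (m : ℕ) : T K A (m + 2) →ₗ[K] T K A (m + 1) :=
  ∑ i : Fin (m + 1), (-1 : K) ^ (i : ℕ) • face K m i

/-- The curvature differential
`a₀ ⊗ ⋯ ⊗ aₘ ↦ ∑_{0 ≤ i < m} (-1)ⁱ a₀ ⊗ ⋯ ⊗ aᵢ ⊗ W ⊗ aᵢ₊₁ ⊗ ⋯ ⊗ aₘ`. On the degree `-n` term of the
bar resolution this is used with `m = n + 1`. -/
def δcurv (W : A) (m : ℕ) : T K A (m + 1) →ₗ[K] T K A (m + 2) :=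
  ∑ i : Fin m, (-1 : K) ^ (i : ℕ) • insertW K W m i

/-- Left multiplication on the first factor. -/
def lmul (m : ℕ) (b : A) : T K A (m + 1) →ₗ[K] T K A (m + 1) :=
  PiTensorProduct.map fun i => if i = 0 then LinearMap.mulLeft K b else LinearMap.id

/-- Right multiplication on the last factor. -/
def rmul (m : ℕ) (b : A) : T K A (m + 1) →ₗ[K] T K A (m + 1) :=
  PiTensorProduct.map fun i => if i = Fin.last m then LinearMap.mulRight K b else LinearMap.id

/-- The component `B₋₍ₚ₊q₎ → B₋ₚ ⊗ B₋q` of the coproduct of the bar resolution: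
`a₀[a₁|…|aₙ]aₙ₊₁ ↦ a₀[a₁|…|aₚ]1 ⊗ 1[aₚ₊₁|…|aₙ]aₙ₊₁`, where `n = p + q`. -/
def Δbar (p q n : ℕ) (h : p + q = n) : T K A (n + 2) →ₗ[K] T K A (p + 2) ⊗[K] T K A (q + 2) :=
  PiTensorProduct.lift
    { toFun := fun a =>
        PiTensorProduct.tprod K (fun i : Fin (p + 2) =>
          if (i : ℕ) ≤ p then a (Fin.castLE (by omega) i) else 1) ⊗ₜ[K]
        PiTensorProduct.tprod K (fun j : Fin (q + 2) =>
          if (j : ℕ) = 0 then 1 else a ⟨p + j, by omega⟩)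
      map_update_add' := by
        intro inst a k x y
        obtain rfl : inst = instDecidableEqFin _ := Subsingleton.elim _ _
        by_cases hk : (k : ℕ) ≤ p
        · have e1 : ∀ z, (fun i : Fin (p + 2) => if (i : ℕ) ≤ p then
              Function.update a k z (Fin.castLE (by omega) i) else 1) = Function.update
              (fun i : Fin (p + 2) => if (i : ℕ) ≤ p then a (Fin.castLE (by omega) i) else 1)
              ⟨k, by omega⟩ z := fun z => funext fun i => by
            simp only [Function.update_apply, Fin.ext_iff, Fin.val_castLE]
            split_ifs <;> first | rfl | omega
          have e2 : ∀ z, (fun j : Fin (q + 2) => if (j : ℕ) = 0 then 1 else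
              Function.update a k z ⟨p + j, by omega⟩) = (fun j : Fin (q + 2) =>
              if (j : ℕ) = 0 then 1 else a ⟨p + j, by omega⟩) := fun z => funext fun i => by
            simp only [Function.update_apply, Fin.ext_iff]
            split_ifs <;> first | rfl | omega
          simp only [e1, e2, MultilinearMap.map_update_add, TensorProduct.add_tmul]
        · have e1 : ∀ z, (fun i : Fin (p + 2) => if (i : ℕ) ≤ p then
              Function.update a k z (Fin.castLE (by omega) i) else 1) =
              (fun i : Fin (p + 2) => if (i : ℕ) ≤ p then a (Fin.castLE (by omega) i) else 1) :=
              fun z => funext fun i => by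
            simp only [Function.update_apply, Fin.ext_iff, Fin.val_castLE]
            split_ifs <;> first | rfl | omega
          have e2 : ∀ z, (fun j : Fin (q + 2) => if (j : ℕ) = 0 then 1 else
              Function.update a k z ⟨p + j, by omega⟩) = Function.update (fun j : Fin (q + 2) =>
              if (j : ℕ) = 0 then 1 else a ⟨p + j, by omega⟩) ⟨k - p, by omega⟩ z :=
              fun z => funext fun i => by
            simp only [Function.update_apply, Fin.ext_iff]
            split_ifs <;> first | rfl | omega
          simp only [e1, e2, MultilinearMap.map_update_add, TensorProduct.tmul_add]
      map_update_smul' := by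
        intro inst a k c x
        obtain rfl : inst = instDecidableEqFin _ := Subsingleton.elim _ _
        by_cases hk : (k : ℕ) ≤ p
        · have e1 : ∀ z, (fun i : Fin (p + 2) => if (i : ℕ) ≤ p then
              Function.update a k z (Fin.castLE (by omega) i) else 1) = Function.update
              (fun i : Fin (p + 2) => if (i : ℕ) ≤ p then a (Fin.castLE (by omega) i) else 1)
              ⟨k, by omega⟩ z := fun z => funext fun i => by
            simp only [Function.update_apply, Fin.ext_iff, Fin.val_castLE]
            split_ifs <;> first | rfl | omega
          have e2 : ∀ z, (fun j : Fin (q + 2) => if (j : ℕ) = 0 then 1 else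
              Function.update a k z ⟨p + j, by omega⟩) = (fun j : Fin (q + 2) =>
              if (j : ℕ) = 0 then 1 else a ⟨p + j, by omega⟩) := fun z => funext fun i => by
            simp only [Function.update_apply, Fin.ext_iff]
            split_ifs <;> first | rfl | omega
          simp only [e1, e2, MultilinearMap.map_update_smul, TensorProduct.smul_tmul']
        · have e1 : ∀ z, (fun i : Fin (p + 2) => if (i : ℕ) ≤ p then
              Function.update a k z (Fin.castLE (by omega) i) else 1) =
              (fun i : Fin (p + 2) => if (i : ℕ) ≤ p then a (Fin.castLE (by omega) i) else 1) :=
              fun z => funext fun i => by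
            simp only [Function.update_apply, Fin.ext_iff, Fin.val_castLE]
            split_ifs <;> first | rfl | omega
          have e2 : ∀ z, (fun j : Fin (q + 2) => if (j : ℕ) = 0 then 1 else
              Function.update a k z ⟨p + j, by omega⟩) = Function.update (fun j : Fin (q + 2) =>
              if (j : ℕ) = 0 then 1 else a ⟨p + j, by omega⟩) ⟨k - p, by omega⟩ z :=
              fun z => funext fun i => by
            simp only [Function.update_apply, Fin.ext_iff]
            split_ifs <;> first | rfl | omega
          simp only [e1, e2, MultilinearMap.map_update_smul, TensorProduct.tmul_smul] }

/-! ### Formulas on sequences -/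

variable {K}

/-- Multiply the neighbours `aᵢ`, `aᵢ₊₁`. -/
def faceSeq (i : ℕ) (a : ℕ → A) : ℕ → A :=
  fun j => if j < i then a j else if j = i then a j * a (j + 1) else a (j + 1)

/-- Insert `W` after `aᵢ`. -/
def insSeq (W : A) (i : ℕ) (a : ℕ → A) : ℕ → A :=
  fun j => if j ≤ i then a j else if j = i + 1 then W else a (j - 1)

/-- `a₀, …, aₚ, 1, …`. -/
def leftSeq (p : ℕ) (a : ℕ → A) : ℕ → A := fun j => if j ≤ p then a j else 1

/-- `1, aₚ₊₁, aₚ₊₂, …`. -/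
def rightSeq (p : ℕ) (a : ℕ → A) : ℕ → A := fun j => if j = 0 then 1 else a (p + j)

/-- Multiply `a₀` by `b` on the left. -/
def lmulSeq (b : A) (a : ℕ → A) : ℕ → A := fun j => if j = 0 then b * a j else a j

/-- Multiply `aₘ` by `b` on the right. -/
def rmulSeq (m : ℕ) (b : A) (a : ℕ → A) : ℕ → A := fun j => if j = m then a j * b else a j

theorem face_tp (m : ℕ) (i : Fin (m + 1)) (a : ℕ → A) :
    face K m i (tp K (m + 2) a) = tp K (m + 1) (faceSeq i a) := by
  refine (PiTensorProduct.lift.tprod _).trans ?_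
  refine congrArg (PiTensorProduct.tprod K) (funext fun j => ?_)
  simp only [Fin.contractNth, faceSeq, Fin.val_castSucc, Fin.val_succ]

theorem insertW_tp (W : A) (m : ℕ) (i : Fin m) (a : ℕ → A) :
    insertW K W m i (tp K (m + 1) a) = tp K (m + 2) (insSeq W i a) := by
  refine (PiTensorProduct.lift.tprod _).trans ?_
  refine congrArg (PiTensorProduct.tprod K) ?_
  refine (Fin.insertNth_eq_iff (α := fun _ => A)).2 ⟨?_, ?_⟩
  · simp [insSeq]
  · funext j
    simp only [Fin.removeNth, insSeq, Fin.succAbove, Fin.lt_def, Fin.val_castSucc, Fin.val_succ]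
    split_ifs with h1 h2 h3 h4 h5 <;>
      simp only [Fin.val_castSucc, Fin.val_succ] at * <;> first | rfl | omega

theorem δbar_tp (m : ℕ) (a : ℕ → A) : δbar K m (tp K (m + 2) a) =
    ∑ i ∈ Finset.range (m + 1), (-1 : K) ^ i • tp K (m + 1) (faceSeq i a) := by
  rw [Finset.sum_range, δbar, LinearMap.sum_apply]
  exact Finset.sum_congr rfl fun i _ => by rw [LinearMap.smul_apply, face_tp]

theorem δcurv_tp (W : A) (m : ℕ) (a : ℕ → A) : δcurv K W m (tp K (m + 1) a) =
    ∑ i ∈ Finset.range m, (-1 : K) ^ i • tp K (m + 2) (insSeq W i a) := by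
  rw [Finset.sum_range, δcurv, LinearMap.sum_apply]
  exact Finset.sum_congr rfl fun i _ => by rw [LinearMap.smul_apply, insertW_tp]

theorem lmul_tp (m : ℕ) (b : A) (a : ℕ → A) :
    lmul K m b (tp K (m + 1) a) = tp K (m + 1) (lmulSeq b a) := by
  unfold lmul tp
  rw [PiTensorProduct.map_tprod]
  refine congrArg (PiTensorProduct.tprod K) (funext fun j => ?_)
  simp only [lmulSeq, Fin.ext_iff, Fin.val_zero]
  split_ifs <;> rfl

theorem rmul_tp (m : ℕ) (b : A) (a : ℕ → A) :
    rmul K m b (tp K (m + 1) a) = tp K (m + 1) (rmulSeq m b a) := by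
  unfold rmul tp
  rw [PiTensorProduct.map_tprod]
  refine congrArg (PiTensorProduct.tprod K) (funext fun j => ?_)
  simp only [rmulSeq, Fin.ext_iff, Fin.val_last]
  split_ifs <;> rfl

theorem Δbar_tp (p q n : ℕ) (h : p + q = n) (a : ℕ → A) : Δbar K p q n h (tp K (n + 2) a) =
    tp K (p + 2) (leftSeq p a) ⊗ₜ[K] tp K (q + 2) (rightSeq p a) :=
  PiTensorProduct.lift.tprod _

/-! ### Identities of the bar resolution -/

/-- `a₁ ⊗ ⋯ ⊗ aₘ ↦ b ⊗ a₁ ⊗ ⋯ ⊗ aₘ`. -/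
def consT (b : A) (m : ℕ) : T K A m →ₗ[K] T K A (m + 1) :=
  PiTensorProduct.lift
    (MultilinearMap.curryLeft (PiTensorProduct.tprod K (s := fun _ : Fin (m + 1) => A)) b)

/-- Prepend a term to a sequence. -/
def consSeq (b : A) (a : ℕ → A) : ℕ → A := fun j => if j = 0 then b else a (j - 1)

theorem consT_tp (b : A) (m : ℕ) (a : ℕ → A) :
    consT (K := K) b m (tp K m a) = tp K (m + 1) (consSeq b a) := by
  refine (PiTensorProduct.lift.tprod _).trans ?_
  refine congrArg (PiTensorProduct.tprod K) (funext fun j => ?_)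
  refine Fin.cases ?_ (fun j => ?_) j <;> simp [consSeq]

theorem T_ext_cons {m : ℕ} {N : Type*} [AddCommGroup N] [Module K N]
    {f g : T K A (m + 1) →ₗ[K] N} (h : ∀ (b : A) (t : T K A m), f (consT b m t) = g (consT b m t)) :
    f = g := by
  refine T_ext fun a => ?_
  have := h (a 0) (tp K m fun j => a (j + 1))
  rw [consT_tp] at this
  have e : consSeq (a 0) (fun j => a (j + 1)) = a := funext fun j => by
    cases j <;> simp [consSeq]
  rwa [e] at this

theorem lin_ext {m : ℕ} {N : Type*} [AddCommGroup N] [Module K N] {f g : T K A m →ₗ[K] N}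
    (h : ∀ a : ℕ → A, f (tp K m a) = g (tp K m a)) (t : T K A m) : f t = g t := by
  rw [T_ext h]

theorem lmul_consT (b c : A) (m : ℕ) (t : T K A m) :
    lmul K m b (consT c m t) = consT (b * c) m t := by
  refine lin_ext (f := lmul K m b ∘ₗ consT c m) (g := consT (b * c) m) (fun a => ?_) t
  rw [LinearMap.comp_apply, consT_tp, lmul_tp, consT_tp]
  refine tp_congr fun i _ => ?_
  simp only [lmulSeq, consSeq]; split_ifs <;> rfl

theorem lmul_lmul (b c : A) (m : ℕ) (t : T K A (m + 1)) :
    lmul K m b (lmul K m c t) = lmul K m (b * c) t := by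
  refine lin_ext (f := lmul K m b ∘ₗ lmul K m c) (g := lmul K m (b * c)) (fun a => ?_) t
  rw [LinearMap.comp_apply, lmul_tp, lmul_tp, lmul_tp]
  refine tp_congr fun i _ => ?_
  simp only [lmulSeq]; split_ifs <;> simp [mul_assoc]

theorem rmul_consT (b c : A) (m : ℕ) (t : T K A (m + 1)) :
    rmul K (m + 1) b (consT c (m + 1) t) = consT c (m + 1) (rmul K m b t) := by
  refine lin_ext (f := rmul K (m + 1) b ∘ₗ consT c (m + 1)) (g := consT c (m + 1) ∘ₗ rmul K m b)
    (fun a => ?_) t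
  rw [LinearMap.comp_apply, LinearMap.comp_apply, consT_tp, rmul_tp, rmul_tp, consT_tp]
  refine tp_congr fun i _ => ?_
  rcases i with _ | i <;> simp [rmulSeq, consSeq]

theorem lmul_rmul (b c : A) (m : ℕ) (t : T K A (m + 1)) :
    lmul K m b (rmul K m c t) = rmul K m c (lmul K m b t) := by
  refine lin_ext (f := lmul K m b ∘ₗ rmul K m c) (g := rmul K m c ∘ₗ lmul K m b) (fun a => ?_) t
  rw [LinearMap.comp_apply, LinearMap.comp_apply, rmul_tp, lmul_tp, lmul_tp, rmul_tp]
  refine tp_congr fun i _ => ?_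
  simp only [rmulSeq, lmulSeq]; split_ifs <;> simp [mul_assoc]

theorem δbar_zero_consT (b : A) (t : T K A 1) : δbar K 0 (consT b 1 t) = lmul K 0 b t := by
  refine lin_ext (f := δbar K 0 ∘ₗ consT b 1) (g := lmul K 0 b) (fun a => ?_) t
  rw [LinearMap.comp_apply, consT_tp, δbar_tp, lmul_tp]
  simp only [zero_add, Finset.sum_range_one, pow_zero, one_smul]
  refine tp_congr fun i hi => ?_
  obtain rfl : i = 0 := by omega
  simp [faceSeq, consSeq, lmulSeq]

theorem δbar_consT (m : ℕ) (b : A) (t : T K A (m + 2)) : δbar K (m + 1) (consT b (m + 2) t) =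
    lmul K (m + 1) b t - consT b (m + 1) (δbar K m t) := by
  refine lin_ext (f := δbar K (m + 1) ∘ₗ consT b (m + 2))
    (g := lmul K (m + 1) b - consT b (m + 1) ∘ₗ δbar K m) (fun a => ?_) t
  rw [LinearMap.comp_apply, LinearMap.sub_apply, LinearMap.comp_apply, consT_tp, δbar_tp, δbar_tp,
    lmul_tp, Finset.sum_range_succ', map_sum, sub_eq_add_neg, ← Finset.sum_neg_distrib]
  refine (add_comm _ _).trans (congrArg₂ _ ?_ ?_)
  · rw [pow_zero, one_smul]
    refine tp_congr fun i _ => ?_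
    rcases i with _ | i <;> simp [faceSeq, consSeq, lmulSeq]
  · refine Finset.sum_congr rfl fun i _ => ?_
    rw [map_smul, consT_tp, pow_succ, mul_neg_one, neg_smul]
    congr 2
    refine tp_congr fun j _ => ?_
    rcases j with _ | j <;> simp [faceSeq, consSeq]

theorem δcurv_zero (W : A) : δcurv K W 0 = 0 := by
  simp [δcurv]

theorem δcurv_consT (W : A) (m : ℕ) (b : A) (t : T K A (m + 1)) :
    δcurv K W (m + 1) (consT b (m + 1) t) =
      consT b (m + 2) (consT W (m + 1) t) - consT b (m + 2) (δcurv K W m t) := by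
  refine lin_ext (f := δcurv K W (m + 1) ∘ₗ consT b (m + 1))
    (g := consT b (m + 2) ∘ₗ consT W (m + 1) - consT b (m + 2) ∘ₗ δcurv K W m) (fun a => ?_) t
  rw [LinearMap.comp_apply, LinearMap.sub_apply, LinearMap.comp_apply, LinearMap.comp_apply,
    consT_tp, δcurv_tp, δcurv_tp, consT_tp, consT_tp, Finset.sum_range_succ', map_sum,
    sub_eq_add_neg, ← Finset.sum_neg_distrib]
  refine (add_comm _ _).trans (congrArg₂ _ ?_ ?_)
  · rw [pow_zero, one_smul]
    refine tp_congr fun i _ => ?_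
    rcases i with _ | _ | i <;> simp [insSeq, consSeq]
  · refine Finset.sum_congr rfl fun i _ => ?_
    rw [map_smul, consT_tp, pow_succ, mul_neg_one, neg_smul]
    congr 2
    refine tp_congr fun j _ => ?_
    rcases j with _ | j
    · simp [insSeq, consSeq]
    · rcases j with _ | j <;> simp [insSeq, consSeq]

theorem δbar_lmul (m : ℕ) (b : A) (t : T K A (m + 2)) :
    δbar K m (lmul K (m + 1) b t) = lmul K m b (δbar K m t) := by
  refine LinearMap.congr_fun (f := δbar K m ∘ₗ lmul K (m + 1) b) (g := lmul K m b ∘ₗ δbar K m)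
    (T_ext_cons fun c t => ?_) t
  rw [LinearMap.comp_apply, LinearMap.comp_apply, lmul_consT]
  cases m with
  | zero => rw [δbar_zero_consT, δbar_zero_consT, lmul_lmul]
  | succ m => rw [δbar_consT, δbar_consT, map_sub, lmul_lmul, lmul_consT]

theorem δbar_rmul (m : ℕ) (b : A) (t : T K A (m + 2)) :
    δbar K m (rmul K (m + 1) b t) = rmul K m b (δbar K m t) := by
  induction m with
  | zero =>
    refine LinearMap.congr_fun (f := δbar K 0 ∘ₗ rmul K 1 b) (g := rmul K 0 b ∘ₗ δbar K 0)
      (T_ext_cons fun c t => ?_) t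
    rw [LinearMap.comp_apply, LinearMap.comp_apply, rmul_consT, δbar_zero_consT, δbar_zero_consT,
      lmul_rmul]
  | succ m ih =>
    refine LinearMap.congr_fun (f := δbar K (m + 1) ∘ₗ rmul K (m + 2) b)
      (g := rmul K (m + 1) b ∘ₗ δbar K (m + 1)) (T_ext_cons fun c t => ?_) t
    rw [LinearMap.comp_apply, LinearMap.comp_apply, rmul_consT, δbar_consT, δbar_consT, map_sub,
      rmul_consT, lmul_rmul, ih]

theorem δcurv_lmul (W : A) (m : ℕ) (b : A) (t : T K A (m + 1)) :
    δcurv K W m (lmul K m b t) = lmul K (m + 1) b (δcurv K W m t) := by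
  cases m with
  | zero => simp [δcurv_zero]
  | succ m =>
    refine LinearMap.congr_fun (f := δcurv K W (m + 1) ∘ₗ lmul K (m + 1) b)
      (g := lmul K (m + 2) b ∘ₗ δcurv K W (m + 1)) (T_ext_cons fun c t => ?_) t
    rw [LinearMap.comp_apply, LinearMap.comp_apply, lmul_consT, δcurv_consT, δcurv_consT, map_sub,
      lmul_consT, lmul_consT]

theorem δcurv_rmul (W : A) (m : ℕ) (b : A) (t : T K A (m + 1)) :
    δcurv K W m (rmul K m b t) = rmul K (m + 1) b (δcurv K W m t) := by
  induction m with
  | zero => simp [δcurv_zero]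
  | succ m ih =>
    refine LinearMap.congr_fun (f := δcurv K W (m + 1) ∘ₗ rmul K (m + 1) b)
      (g := rmul K (m + 2) b ∘ₗ δcurv K W (m + 1)) (T_ext_cons fun c t => ?_) t
    rw [LinearMap.comp_apply, LinearMap.comp_apply, rmul_consT, δcurv_consT, δcurv_consT, map_sub,
      rmul_consT, rmul_consT, rmul_consT, ih]

theorem δbar_δbar (m : ℕ) (t : T K A (m + 3)) : δbar K m (δbar K (m + 1) t) = 0 := by
  induction m with
  | zero =>
    refine LinearMap.congr_fun (f := δbar K 0 ∘ₗ δbar K 1) (g := 0) (T_ext_cons fun c t => ?_) t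
    rw [LinearMap.comp_apply, δbar_consT, map_sub, δbar_lmul, δbar_zero_consT, sub_self]
    rfl
  | succ m ih =>
    refine LinearMap.congr_fun (f := δbar K (m + 1) ∘ₗ δbar K (m + 2)) (g := 0)
      (T_ext_cons fun c t => ?_) t
    rw [LinearMap.comp_apply, δbar_consT, map_sub, δbar_lmul, δbar_consT, ih, map_zero, sub_zero,
      sub_self]
    rfl

theorem δcurv_δcurv (W : A) (m : ℕ) (t : T K A (m + 1)) :
    δcurv K W (m + 1) (δcurv K W m t) = 0 := by
  induction m with
  | zero => simp [δcurv_zero]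
  | succ m ih =>
    refine LinearMap.congr_fun (f := δcurv K W (m + 2) ∘ₗ δcurv K W (m + 1)) (g := 0)
      (T_ext_cons fun c t => ?_) t
    rw [LinearMap.comp_apply, δcurv_consT, map_sub, δcurv_consT, δcurv_consT, δcurv_consT, ih,
      map_sub]
    simp

/-- `δ_bar δ_curv + δ_curv δ_bar = l_W - r_W` for central `W`. -/
theorem δbar_δcurv (W : A) (hW : ∀ a : A, a * W = W * a) (m : ℕ) (t : T K A (m + 2)) :
    δbar K (m + 1) (δcurv K W (m + 1) t) + δcurv K W m (δbar K m t) =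
      lmul K (m + 1) W t - rmul K (m + 1) W t := by
  induction m with
  | zero =>
    refine LinearMap.congr_fun (f := δbar K 1 ∘ₗ δcurv K W 1 + δcurv K W 0 ∘ₗ δbar K 0)
      (g := lmul K 1 W - rmul K 1 W) (T_ext_cons fun c t => ?_) t
    have e : lmul K 0 W t = rmul K 0 W t := by
      refine lin_ext (fun a => ?_) t
      rw [lmul_tp, rmul_tp]
      refine tp_congr fun i hi => ?_
      simp only [lmulSeq, rmulSeq, hW]
    simp only [LinearMap.add_apply, LinearMap.comp_apply, LinearMap.sub_apply, δcurv_consT,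
      δbar_consT, δcurv_zero, LinearMap.zero_apply, map_zero, sub_zero, add_zero,
      lmul_consT, rmul_consT, hW]
    rw [show δbar K 0 (consT W (0 + 1) t) = lmul K 0 W t from δbar_zero_consT W t, e]
  | succ m ih =>
    refine LinearMap.congr_fun
      (f := δbar K (m + 2) ∘ₗ δcurv K W (m + 2) + δcurv K W (m + 1) ∘ₗ δbar K (m + 1))
      (g := lmul K (m + 2) W - rmul K (m + 2) W) (T_ext_cons fun c t => ?_) t
    have e := congrArg (consT c (m + 2)) (ih t)
    rw [map_add, map_sub] at e
    simp only [LinearMap.add_apply, LinearMap.comp_apply, LinearMap.sub_apply, δcurv_consT,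
      δbar_consT, lmul_consT, rmul_consT, hW, map_sub, δcurv_lmul] at *
    rw [eq_sub_iff_add_eq] at e
    rw [← e]
    abel

end Bar

/-! ## Hochschild mixed complexes -/

section Graded

variable {K : Type u} [Field K] {X : ℕ → Type v} [∀ n, AddCommGroup (X n)] [∀ n, Module K (X n)]

/-- The part of degree `k` of `⨁ₙ X n` when `X n` is placed in degree `f n`. -/
def grBy (K : Type u) [Field K] (X : ℕ → Type v) [∀ n, AddCommGroup (X n)] [∀ n, Module K (X n)]
    (f : ℕ → ℤ) (k : ℤ) : Submodule K (⨁ n, X n) where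
  carrier := {c | ∀ n, f n ≠ k → c n = 0}
  add_mem' hc hd n hn := by rw [DirectSum.add_apply, hc n hn, hd n hn, add_zero]
  zero_mem' _ _ := rfl
  smul_mem' a c hc n hn := by rw [DirectSum.smul_apply, hc n hn, smul_zero]

theorem lof_mem_grBy (f : ℕ → ℤ) (n : ℕ) (x : X n) :
    DirectSum.lof K ℕ X n x ∈ grBy K X f (f n) := fun m hm =>
  DirectSum.of_eq_of_ne _ _ _ (fun h => hm (by rw [h]))

theorem lof_mem_grBy' (f : ℕ → ℤ) (n : ℕ) (x : X n) {k : ℤ} (h : f n = k) :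
    DirectSum.lof K ℕ X n x ∈ grBy K X f k := h ▸ lof_mem_grBy f n x

theorem grBy_cases {f : ℕ → ℤ} (hf : Function.Injective f) {k : ℤ} {c : ⨁ n, X n}
    (hc : c ∈ grBy K X f k) : c = 0 ∨ ∃ n x, f n = k ∧ c = DirectSum.lof K ℕ X n x := by
  by_cases h : ∃ n, f n = k
  · obtain ⟨n, rfl⟩ := h
    refine Or.inr ⟨n, c n, rfl, DFinsupp.ext fun m => ?_⟩
    by_cases hm : m = n
    · subst hm
      exact (DirectSum.of_eq_same _ _).symm
    · refine (hc m fun h => hm (hf h)).trans (DirectSum.of_eq_of_ne _ _ _ hm).symm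
  · exact Or.inl (DFinsupp.ext fun m => hc m fun hm => h ⟨m, hm⟩)

theorem grBy_isInternal (f : ℕ → ℤ) :
    DirectSum.IsInternal (grBy K X f) := by
  have key : ∀ (y : ⨁ k, grBy K X f k) (n : ℕ),
      (DirectSum.coeAddMonoidHom (grBy K X f) y) n = ((y (f n) : grBy K X f (f n)) : ⨁ n, X n) n := by
    intro y n
    induction y using DirectSum.induction_on with
    | zero => rfl
    | of k x =>
      rw [DirectSum.coeAddMonoidHom_of]
      by_cases h : f n = k
      · subst h
        rw [DirectSum.of_eq_same]
      · rw [DirectSum.of_eq_of_ne _ _ _ h, x.2 n h]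
        rfl
    | add x y hx hy => rw [map_add, DirectSum.add_apply, hx, hy]; rfl
  constructor
  · rw [injective_iff_map_eq_zero]
    intro y hy
    refine DFinsupp.ext fun k => Subtype.ext (DFinsupp.ext fun n => ?_)
    by_cases h : f n = k
    · subst h
      exact (key y n).symm.trans (by rw [hy]; rfl)
    · exact (y k).2 n h
  · intro c
    induction c using DirectSum.induction_on with
    | zero => exact ⟨0, map_zero _⟩
    | of n x =>
      exact ⟨DirectSum.of (fun k => grBy K X f k) (f n) ⟨_, lof_mem_grBy (K := K) f n x⟩,
        DirectSum.coeAddMonoidHom_of _ _ _⟩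
    | add x y hx hy =>
      obtain ⟨x', rfl⟩ := hx
      obtain ⟨y', rfl⟩ := hy
      exact ⟨x' + y', map_add _ _ _⟩

end Graded

section Cochains

variable {K : Type u} {A : Type v} {R : Type w} [Field K] [Ring A] [Algebra K A] [Ring R]
  [Algebra K R] (ι : A →ₐ[K] R)

/-- The `n`-cochains `Hom_{A ⊗ Aᵒᵖ}(B₋ₙ(A), M)`: bimodule maps from `A ⊗ A^{⊗ n} ⊗ A` to `M`. Here
`M` is a `K`-algebra `R`, regarded as an `A`-bimodule through an algebra map `ι : A → R`. -/
def cochainSubmodule (n : ℕ) : Submodule K (T K A (n + 2) →ₗ[K] R) where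
  carrier := {D | ∀ (a : A) (x : T K A (n + 2)),
    D (lmul K (n + 1) a x) = ι a * D x ∧ D (rmul K (n + 1) a x) = D x * ι a}
  add_mem' hD hE a x := by simp [hD a x, hE a x, mul_add, add_mul]
  zero_mem' _ _ := by simp
  smul_mem' c D hD a x := by simp [hD a x]

/-- The space of `n`-cochains. -/
def Cochain (n : ℕ) : Type (max u v w) := ↥(cochainSubmodule ι n)

instance (n : ℕ) : AddCommGroup (Cochain ι n) := inferInstanceAs (AddCommGroup (cochainSubmodule ι n))

instance (n : ℕ) : Module K (Cochain ι n) := inferInstanceAs (Module K (cochainSubmodule ι n))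

/-- The dual `(-1)ⁿ D ∘ δ_bar` of the bar differential. -/
def cobar (n : ℕ) : Cochain ι n →ₗ[K] Cochain ι (n + 1) where
  toFun D := ⟨(-1 : K) ^ n • D.1 ∘ₗ δbar K (n + 1), fun a x => by
    simp only [LinearMap.smul_apply, LinearMap.comp_apply, δbar_lmul, δbar_rmul, (D.2 a _).1,
      (D.2 a _).2, mul_smul_comm, smul_mul_assoc, and_self]⟩
  map_add' D E := Subtype.ext (LinearMap.ext fun x => smul_add (_ : K) (D.1 _) (E.1 _))
  map_smul' c D := Subtype.ext (LinearMap.ext fun x => smul_comm (_ : K) c (D.1 _))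

/-- The dual `(-1)ⁿ⁺¹ D ∘ δ_curv` of the curvature differential. -/
def cocurv (W : A) (n : ℕ) : Cochain ι (n + 1) →ₗ[K] Cochain ι n where
  toFun D := ⟨(-1 : K) ^ (n + 1) • D.1 ∘ₗ δcurv K W (n + 1), fun a x => by
    simp only [LinearMap.smul_apply, LinearMap.comp_apply, δcurv_lmul, δcurv_rmul, (D.2 a _).1,
      (D.2 a _).2, mul_smul_comm, smul_mul_assoc, and_self]⟩
  map_add' D E := Subtype.ext (LinearMap.ext fun x => smul_add (_ : K) (D.1 _) (E.1 _))
  map_smul' c D := Subtype.ext (LinearMap.ext fun x => smul_comm (_ : K) c (D.1 _))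

/-- All cochains, `⨁ₙ Bⁿ(A, M)`. -/
abbrev Cochains : Type (max u v w) := ⨁ n, Cochain ι n

/-- The `n`-cochain `D` as an element of `⨁ₙ Bⁿ(A, M)`. -/
abbrev inC (n : ℕ) : Cochain ι n →ₗ[K] Cochains ι := DirectSum.lof K ℕ (fun n => Cochain ι n) n

/-- `∂_Hoch` on all cochains. -/
def dHoch : Cochains ι →ₗ[K] Cochains ι :=
  DirectSum.toModule K ℕ _ fun n => inC ι (n + 1) ∘ₗ cobar ι n

/-- `∂_curv` on all cochains (zero on `0`-cochains). -/
def dCurv (W : A) : Cochains ι →ₗ[K] Cochains ι :=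
  DirectSum.toModule K ℕ _ fun
    | 0 => 0
    | n + 1 => inC ι n ∘ₗ cocurv ι W n

variable {ι}

theorem dHoch_in (n : ℕ) (D : Cochain ι n) : dHoch ι (inC ι n D) = inC ι (n + 1) (cobar ι n D) :=
  DirectSum.toModule_lof _ _ _

theorem dCurv_in_zero (W : A) (D : Cochain ι 0) : dCurv ι W (inC ι 0 D) = 0 :=
  DirectSum.toModule_lof _ _ _

theorem dCurv_in_succ (W : A) (n : ℕ) (D : Cochain ι (n + 1)) :
    dCurv ι W (inC ι (n + 1) D) = inC ι n (cocurv ι W n D) :=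
  DirectSum.toModule_lof _ _ _

/-- Evaluation of the `n`-th component of a cochain. -/
def cev (n : ℕ) (a : ℕ → A) : Cochains ι →ₗ[K] R :=
  LinearMap.applyₗ (tp K (n + 2) a) ∘ₗ (cochainSubmodule ι n).subtype ∘ₗ
    DirectSum.component K ℕ (fun n => Cochain ι n) n

theorem cev_apply (n : ℕ) (a : ℕ → A) (c : Cochains ι) : cev n a c = (c n).1 (tp K (n + 2) a) := rfl

theorem cev_in_same (n : ℕ) (a : ℕ → A) (D : Cochain ι n) :
    cev n a (inC ι n D) = D.1 (tp K (n + 2) a) := by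
  rw [cev_apply]
  exact congrArg (fun E : Cochain ι n => E.1 (tp K (n + 2) a)) (DirectSum.of_eq_same _ _)

theorem cev_in_ne {n m : ℕ} (h : n ≠ m) (a : ℕ → A) (D : Cochain ι m) :
    cev n a (inC ι m D) = 0 := by
  rw [cev_apply]
  exact congrArg (fun E : Cochain ι n => E.1 (tp K (n + 2) a)) (DirectSum.of_eq_of_ne _ _ _ h)

theorem cochains_ext {c d : Cochains ι} (h : ∀ n a, cev n a c = cev n a d) : c = d :=
  DFinsupp.ext fun n => Subtype.ext (T_ext fun a => h n a)

theorem cev_congr (n : ℕ) {a a' : ℕ → A} (h : ∀ i < n + 2, a i = a' i) (c : Cochains ι) :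
    cev n a c = cev n a' c := by
  rw [cev_apply, cev_apply, tp_congr h]

theorem cev_lmul (n : ℕ) (b : A) (a : ℕ → A) (c : Cochains ι) :
    cev n (lmulSeq b a) c = ι b * cev n a c := by
  rw [cev_apply, ← lmul_tp, ((c n).2 b _).1, cev_apply]

theorem cev_rmul (n : ℕ) (b : A) (a : ℕ → A) (c : Cochains ι) :
    cev n (rmulSeq (n + 1) b a) c = cev n a c * ι b := by
  rw [cev_apply, ← rmul_tp, ((c n).2 b _).2, cev_apply]

theorem cobar_tp (n : ℕ) (D : Cochain ι n) (a : ℕ → A) : (cobar ι n D).1 (tp K (n + 3) a) =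
    (-1 : K) ^ n • ∑ i ∈ Finset.range (n + 2), (-1 : K) ^ i • D.1 (tp K (n + 2) (faceSeq i a)) := by
  change (-1 : K) ^ n • D.1 (δbar K (n + 1) (tp K (n + 1 + 2) a)) = _
  rw [δbar_tp, map_sum]
  simp only [map_smul]

theorem cocurv_tp (W : A) (n : ℕ) (D : Cochain ι (n + 1)) (a : ℕ → A) :
    (cocurv ι W n D).1 (tp K (n + 2) a) = (-1 : K) ^ (n + 1) •
      ∑ i ∈ Finset.range (n + 1), (-1 : K) ^ i • D.1 (tp K (n + 3) (insSeq W i a)) := by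
  change (-1 : K) ^ (n + 1) • D.1 (δcurv K W (n + 1) (tp K (n + 1 + 1) a)) = _
  rw [δcurv_tp, map_sum]
  simp only [map_smul]

theorem cev_dHoch_zero (a : ℕ → A) (c : Cochains ι) : cev 0 a (dHoch ι c) = 0 := by
  refine LinearMap.congr_fun (f := cev 0 a ∘ₗ dHoch ι) (g := 0)
    (DirectSum.linearMap_ext K fun n => LinearMap.ext fun D => ?_) c
  simp only [LinearMap.comp_apply]
  rw [dHoch_in, cev_in_ne (by omega)]
  rfl

theorem cev_dHoch_succ (n : ℕ) (a : ℕ → A) (c : Cochains ι) : cev (n + 1) a (dHoch ι c) =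
    (-1 : K) ^ n • ∑ i ∈ Finset.range (n + 2), (-1 : K) ^ i • cev n (faceSeq i a) c := by
  refine (LinearMap.congr_fun (f := cev (n + 1) a ∘ₗ dHoch ι)
    (g := (-1 : K) ^ n • ∑ i ∈ Finset.range (n + 2), (-1 : K) ^ i • cev n (faceSeq i a))
    (DirectSum.linearMap_ext K fun m => LinearMap.ext fun D => ?_) c).trans ?_
  · simp only [LinearMap.comp_apply, LinearMap.smul_apply, LinearMap.sum_apply]
    rw [dHoch_in]
    by_cases h : n = m
    · subst h
      rw [cev_in_same, cobar_tp]
      simp only [cev_in_same]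
    · rw [cev_in_ne (by omega)]
      simp only [cev_in_ne h, smul_zero, Finset.sum_const_zero]
  · simp only [LinearMap.smul_apply, LinearMap.sum_apply]

theorem cev_dCurv (W : A) (n : ℕ) (a : ℕ → A) (c : Cochains ι) : cev n a (dCurv ι W c) =
    (-1 : K) ^ (n + 1) •
      ∑ i ∈ Finset.range (n + 1), (-1 : K) ^ i • cev (n + 1) (insSeq W i a) c := by
  refine (LinearMap.congr_fun (f := cev n a ∘ₗ dCurv ι W)
    (g := (-1 : K) ^ (n + 1) •
      ∑ i ∈ Finset.range (n + 1), (-1 : K) ^ i • cev (n + 1) (insSeq W i a))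
    (DirectSum.linearMap_ext K fun m => LinearMap.ext fun D => ?_) c).trans ?_
  · simp only [LinearMap.comp_apply, LinearMap.smul_apply, LinearMap.sum_apply]
    cases m with
    | zero =>
      rw [dCurv_in_zero, map_zero]
      simp only [cev_in_ne (show n + 1 ≠ 0 by omega), smul_zero, Finset.sum_const_zero]
    | succ m =>
      rw [dCurv_in_succ]
      by_cases h : n = m
      · subst h
        rw [cev_in_same, cocurv_tp]
        simp only [cev_in_same]
      · rw [cev_in_ne h]
        simp only [cev_in_ne (show n + 1 ≠ m + 1 by omega), smul_zero, Finset.sum_const_zero]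
  · simp only [LinearMap.smul_apply, LinearMap.sum_apply]

variable (ι)

/-- The Hochschild cochain mixed complex of `(A, W)` with coefficients in `M = R`, where `W ∈ A` is
central and acts on `M` in the same way from the left and from the right. -/
def cochainComplex (W : A) (hW : ∀ a : A, a * W = W * a) (hM : ∀ r : R, r * ι W = ι W * r) :
    MixedComplex K (Cochains ι) where
  gr := grBy K (fun n => Cochain ι n) fun n => (n : ℤ)
  isInternal := grBy_isInternal _
  b := dHoch ι
  B := dCurv ι W
  b_mem {k c} hc := by
    obtain rfl | ⟨n, D, rfl, rfl⟩ := grBy_cases Nat.cast_injective hc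
    · rw [map_zero]; exact zero_mem _
    · rw [dHoch_in]; exact lof_mem_grBy' _ _ _ (by push_cast; rfl)
  B_mem {k c} hc := by
    obtain rfl | ⟨n, D, rfl, rfl⟩ := grBy_cases Nat.cast_injective hc
    · rw [map_zero]; exact zero_mem _
    · cases n with
      | zero => rw [dCurv_in_zero]; exact zero_mem _
      | succ n => rw [dCurv_in_succ]; exact lof_mem_grBy' _ _ _ (by push_cast; ring)
  b_b c := by
    refine LinearMap.congr_fun (f := dHoch ι ∘ₗ dHoch ι) (g := 0)
      (DirectSum.linearMap_ext K fun n => LinearMap.ext fun D => ?_) c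
    simp only [LinearMap.comp_apply]
    rw [dHoch_in, dHoch_in]
    have : cobar ι (n + 1) (cobar ι n D) = 0 := Subtype.ext (LinearMap.ext fun x => by
      change (-1 : K) ^ (n + 1) • (-1 : K) ^ n • D.1 (δbar K (n + 1) (δbar K (n + 2) x)) = 0
      rw [δbar_δbar, map_zero, smul_zero, smul_zero])
    rw [this, map_zero]
    rfl
  B_B c := by
    refine LinearMap.congr_fun (f := dCurv ι W ∘ₗ dCurv ι W) (g := 0)
      (DirectSum.linearMap_ext K fun n => LinearMap.ext fun D => ?_) c
    simp only [LinearMap.comp_apply]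
    rcases n with _ | _ | n
    · rw [dCurv_in_zero, map_zero]; rfl
    · rw [dCurv_in_succ, dCurv_in_zero]; rfl
    · rw [dCurv_in_succ, dCurv_in_succ]
      have : cocurv ι W n (cocurv ι W (n + 1) D) = 0 := Subtype.ext (LinearMap.ext fun x => by
        change (-1 : K) ^ (n + 1) • (-1 : K) ^ (n + 2) •
          D.1 (δcurv K W (n + 2) (δcurv K W (n + 1) x)) = 0
        rw [δcurv_δcurv, map_zero, smul_zero, smul_zero])
      rw [this, map_zero]
      rfl
  b_B c := by
    refine LinearMap.congr_fun (f := dHoch ι ∘ₗ dCurv ι W + dCurv ι W ∘ₗ dHoch ι) (g := 0)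
      (DirectSum.linearMap_ext K fun n => LinearMap.ext fun D => ?_) c
    have key : ∀ x : T K A (n + 2),
        D.1 (δbar K (n + 1) (δcurv K W (n + 1) x)) + D.1 (δcurv K W n (δbar K n x)) = 0 := by
      intro x
      rw [← map_add, δbar_δcurv W hW, map_sub, (D.2 W x).1, (D.2 W x).2, hM, sub_self]
    simp only [LinearMap.comp_apply, LinearMap.add_apply]
    cases n with
    | zero =>
      rw [dCurv_in_zero, map_zero, zero_add, dHoch_in, dCurv_in_succ]
      have : cocurv ι W 0 (cobar ι 0 D) = 0 := Subtype.ext (LinearMap.ext fun x => by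
        change (-1 : K) ^ 1 • (-1 : K) ^ 0 • D.1 (δbar K 1 (δcurv K W 1 x)) = 0
        have h := key x
        rw [δcurv_zero, LinearMap.zero_apply, map_zero, add_zero] at h
        rw [h, smul_zero, smul_zero])
      rw [this, map_zero]
      rfl
    | succ n =>
      rw [dCurv_in_succ, dHoch_in, dHoch_in, dCurv_in_succ, ← map_add]
      have : cobar ι n (cocurv ι W n D) + cocurv ι W (n + 1) (cobar ι (n + 1) D) = 0 :=
        Subtype.ext (LinearMap.ext fun x => by
          change (-1 : K) ^ n • (-1 : K) ^ (n + 1) •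
              D.1 (δcurv K W (n + 1) (δbar K (n + 1) x)) +
            (-1 : K) ^ (n + 2) • (-1 : K) ^ (n + 1) •
              D.1 (δbar K (n + 2) (δcurv K W (n + 2) x)) = 0
          rw [eq_neg_of_add_eq_zero_left (key x)]
          module)
      rw [this, map_zero]
      rfl

end Cochains

section Chains

variable {K : Type u} {A : Type v} {R : Type w} [Field K] [Ring A] [Algebra K A] [Ring R]
  [Algebra K R] (ι : A →ₐ[K] R)

/-- The relations `a₀ m a₁ ⊗ x = m ⊗ a₁ x a₀` defining `M ⊗_{A ⊗ Aᵒᵖ} B₋ₙ(A)`. -/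
def chainRel (n : ℕ) : Submodule K (R ⊗[K] T K A (n + 2)) :=
  Submodule.span K {z | ∃ (a₀ a₁ : A) (m : R) (x : T K A (n + 2)),
    z = (ι a₀ * m * ι a₁) ⊗ₜ[K] x - m ⊗ₜ[K] lmul K (n + 1) a₁ (rmul K (n + 1) a₀ x)}

/-- The `n`-chains `M ⊗_{A ⊗ Aᵒᵖ} B₋ₙ(A)`, where `M` is a `K`-algebra `R` regarded as an
`A`-bimodule through an algebra map `ι : A → R`. -/
def Chain (n : ℕ) : Type (max u v w) := (R ⊗[K] T K A (n + 2)) ⧸ chainRel ι n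

instance (n : ℕ) : AddCommGroup (Chain ι n) :=
  inferInstanceAs (AddCommGroup ((R ⊗[K] T K A (n + 2)) ⧸ chainRel ι n))

instance (n : ℕ) : Module K (Chain ι n) :=
  inferInstanceAs (Module K ((R ⊗[K] T K A (n + 2)) ⧸ chainRel ι n))

/-- The quotient map `M ⊗ B₋ₙ(A) → M ⊗_{A ⊗ Aᵒᵖ} B₋ₙ(A)`. -/
def Chain.mk (n : ℕ) : R ⊗[K] T K A (n + 2) →ₗ[K] Chain ι n := (chainRel ι n).mkQ

/-- A linear map `M ⊗ B₋ₙ(A) → M ⊗ B₋ₘ(A)` respecting the relations acts on chains. -/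
def Chain.map {n m : ℕ} (f : R ⊗[K] T K A (n + 2) →ₗ[K] R ⊗[K] T K A (m + 2))
    (hf : ∀ (a₀ a₁ : A) (r : R) (x : T K A (n + 2)),
      f ((ι a₀ * r * ι a₁) ⊗ₜ[K] x) - f (r ⊗ₜ[K] lmul K (n + 1) a₁ (rmul K (n + 1) a₀ x)) ∈
        chainRel ι m) : Chain ι n →ₗ[K] Chain ι m :=
  Submodule.mapQ _ _ f (by
    refine Submodule.span_le.2 ?_
    rintro _ ⟨a₀, a₁, r, x, rfl⟩
    have := hf a₀ a₁ r x
    rw [← map_sub] at this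
    exact this)

variable {ι}

theorem Chain.map_mk {n m : ℕ} (f : R ⊗[K] T K A (n + 2) →ₗ[K] R ⊗[K] T K A (m + 2)) (hf)
    (z : R ⊗[K] T K A (n + 2)) : Chain.map ι f hf (Chain.mk ι n z) = Chain.mk ι m (f z) := rfl

theorem mem_chainRel (n : ℕ) (a₀ a₁ : A) (r : R) (x : T K A (n + 2)) :
    (ι a₀ * r * ι a₁) ⊗ₜ[K] x - r ⊗ₜ[K] lmul K (n + 1) a₁ (rmul K (n + 1) a₀ x) ∈ chainRel ι n :=
  Submodule.subset_span ⟨a₀, a₁, r, x, rfl⟩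

theorem Chain.mk_rel (n : ℕ) (a₀ a₁ : A) (r : R) (x : T K A (n + 2)) :
    Chain.mk ι n ((ι a₀ * r * ι a₁) ⊗ₜ[K] x) =
      Chain.mk ι n (r ⊗ₜ[K] lmul K (n + 1) a₁ (rmul K (n + 1) a₀ x)) :=
  (Submodule.Quotient.eq _).2 (mem_chainRel n a₀ a₁ r x)

theorem Chain.mk_eq_iff {n : ℕ} {y z : R ⊗[K] T K A (n + 2)} :
    Chain.mk ι n y = Chain.mk ι n z ↔ y - z ∈ chainRel ι n := Submodule.Quotient.eq _

variable (ι)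

/-- `b_Hoch = 1 ⊗ δ_bar` in a fixed degree. -/
def chainBar (n : ℕ) : Chain ι (n + 1) →ₗ[K] Chain ι n :=
  Chain.map ι (LinearMap.lTensor R (δbar K (n + 1))) fun a₀ a₁ r x => by
    rw [LinearMap.lTensor_tmul, LinearMap.lTensor_tmul, δbar_lmul, δbar_rmul]
    exact mem_chainRel _ _ _ _ _

/-- `b_curv = 1 ⊗ δ_curv` in a fixed degree. -/
def chainCurv (W : A) (n : ℕ) : Chain ι n →ₗ[K] Chain ι (n + 1) :=
  Chain.map ι (LinearMap.lTensor R (δcurv K W (n + 1))) fun a₀ a₁ r x => by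
    rw [LinearMap.lTensor_tmul, LinearMap.lTensor_tmul, δcurv_lmul, δcurv_rmul]
    exact mem_chainRel _ _ _ _ _

/-- All chains, `⨁ₙ M ⊗_{A ⊗ Aᵒᵖ} B₋ₙ(A)`. -/
abbrev Chains : Type (max u v w) := ⨁ n, Chain ι n

/-- The `n`-chain `ω` as an element of the space of all chains. -/
abbrev inD (n : ℕ) : Chain ι n →ₗ[K] Chains ι := DirectSum.lof K ℕ (fun n => Chain ι n) n

/-- `b_Hoch` on all chains. -/
def bHoch : Chains ι →ₗ[K] Chains ι :=
  DirectSum.toModule K ℕ _ fun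
    | 0 => 0
    | n + 1 => inD ι n ∘ₗ chainBar ι n

/-- `b_curv` on all chains. -/
def bCurv (W : A) : Chains ι →ₗ[K] Chains ι :=
  DirectSum.toModule K ℕ _ fun n => inD ι (n + 1) ∘ₗ chainCurv ι W n

/-- The chain `r ⊗ (a₀ ⊗ ⋯ ⊗ aₙ₊₁)`. -/
def sym (n : ℕ) (r : R) (a : ℕ → A) : Chains ι := inD ι n (Chain.mk ι n (r ⊗ₜ[K] tp K (n + 2) a))

variable {ι}

theorem bHoch_in_zero (x : Chain ι 0) : bHoch ι (inD ι 0 x) = 0 :=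
  DirectSum.toModule_lof _ _ _

theorem bHoch_in_succ (n : ℕ) (x : Chain ι (n + 1)) :
    bHoch ι (inD ι (n + 1) x) = inD ι n (chainBar ι n x) :=
  DirectSum.toModule_lof _ _ _

theorem bCurv_in (W : A) (n : ℕ) (x : Chain ι n) :
    bCurv ι W (inD ι n x) = inD ι (n + 1) (chainCurv ι W n x) :=
  DirectSum.toModule_lof _ _ _

theorem sym_congr {n m : ℕ} (h : n = m) (r : R) {a a' : ℕ → A} (ha : ∀ i < n + 2, a i = a' i) :
    sym ι n r a = sym ι m r a' := by
  subst h
  rw [sym, sym, tp_congr ha]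

theorem Chain.linearMap_ext {n : ℕ} {N : Type*} [AddCommGroup N] [Module K N]
    {f g : Chain ι n →ₗ[K] N} (h : ∀ (r : R) (a : ℕ → A),
      f (Chain.mk ι n (r ⊗ₜ[K] tp K (n + 2) a)) = g (Chain.mk ι n (r ⊗ₜ[K] tp K (n + 2) a))) :
    f = g :=
  Submodule.linearMap_qext _ (TensorProduct.ext (LinearMap.ext fun r => T_ext fun a => h r a))

theorem chains_ext {N : Type*} [AddCommGroup N] [Module K N] {f g : Chains ι →ₗ[K] N}
    (h : ∀ (n : ℕ) (r : R) (a : ℕ → A), f (sym ι n r a) = g (sym ι n r a)) : f = g :=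
  DirectSum.linearMap_ext K fun n => Chain.linearMap_ext fun r a => h n r a

theorem sym_lmul (n : ℕ) (r : R) (b : A) (a : ℕ → A) :
    sym ι n r (lmulSeq b a) = sym ι n (r * ι b) a := by
  have h := Chain.mk_rel (ι := ι) n 1 b r (tp K (n + 2) a)
  rw [map_one, one_mul, rmul_tp, lmul_tp] at h
  rw [sym, sym, h]
  refine congrArg (fun t => inD ι n (Chain.mk ι n (r ⊗ₜ[K] t))) (tp_congr fun i _ => ?_)
  simp [lmulSeq, rmulSeq]

theorem sym_rmul (n : ℕ) (r : R) (b : A) (a : ℕ → A) :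
    sym ι n r (rmulSeq (n + 1) b a) = sym ι n (ι b * r) a := by
  have h := Chain.mk_rel (ι := ι) n b 1 r (tp K (n + 2) a)
  rw [map_one, mul_one, rmul_tp, lmul_tp] at h
  rw [sym, sym, h]
  refine congrArg (fun t => inD ι n (Chain.mk ι n (r ⊗ₜ[K] t))) (tp_congr fun i _ => ?_)
  simp [lmulSeq]

theorem sym_add (n : ℕ) (r s : R) (a : ℕ → A) :
    sym ι n (r + s) a = sym ι n r a + sym ι n s a := by
  simp only [sym, TensorProduct.add_tmul, map_add]

theorem bHoch_sym_zero (r : R) (a : ℕ → A) : bHoch ι (sym ι 0 r a) = 0 := bHoch_in_zero _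

theorem bHoch_sym_succ (n : ℕ) (r : R) (a : ℕ → A) : bHoch ι (sym ι (n + 1) r a) =
    ∑ i ∈ Finset.range (n + 2), (-1 : K) ^ i • sym ι n r (faceSeq i a) := by
  rw [sym, bHoch_in_succ, chainBar, Chain.map_mk, LinearMap.lTensor_tmul, δbar_tp,
    TensorProduct.tmul_sum, map_sum, map_sum]
  refine Finset.sum_congr rfl fun i _ => ?_
  rw [TensorProduct.tmul_smul, map_smul, map_smul, sym]

theorem bCurv_sym (W : A) (n : ℕ) (r : R) (a : ℕ → A) : bCurv ι W (sym ι n r a) =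
    ∑ i ∈ Finset.range (n + 1), (-1 : K) ^ i • sym ι (n + 1) r (insSeq W i a) := by
  rw [sym, bCurv_in, chainCurv, Chain.map_mk, LinearMap.lTensor_tmul, δcurv_tp,
    TensorProduct.tmul_sum, map_sum, map_sum]
  refine Finset.sum_congr rfl fun i _ => ?_
  rw [TensorProduct.tmul_smul, map_smul, map_smul, sym]

variable (ι)

theorem neg_cast_injective : Function.Injective fun n : ℕ => -(n : ℤ) := fun a b h => by
  simpa using h

/-- The Hochschild chain mixed complex of `(A, W)` with coefficients in `M = R`, where `W ∈ A` is
central and acts on `M` in the same way from the left and from the right. It is non-positively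
graded. -/
def chainComplex (W : A) (hW : ∀ a : A, a * W = W * a) (hM : ∀ r : R, r * ι W = ι W * r) :
    MixedComplex K (Chains ι) where
  gr := grBy K (fun n => Chain ι n) fun n => -(n : ℤ)
  isInternal := grBy_isInternal _
  b := bHoch ι
  B := bCurv ι W
  b_mem {k c} hc := by
    obtain rfl | ⟨n, D, rfl, rfl⟩ := grBy_cases neg_cast_injective hc
    · rw [map_zero]; exact zero_mem _
    · cases n with
      | zero => rw [bHoch_in_zero]; exact zero_mem _
      | succ n => rw [bHoch_in_succ]; exact lof_mem_grBy' _ _ _ (by push_cast; ring)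
  B_mem {k c} hc := by
    obtain rfl | ⟨n, D, rfl, rfl⟩ := grBy_cases neg_cast_injective hc
    · rw [map_zero]; exact zero_mem _
    · rw [bCurv_in]; exact lof_mem_grBy' _ _ _ (by push_cast; ring)
  b_b c := by
    refine LinearMap.congr_fun (f := bHoch ι ∘ₗ bHoch ι) (g := 0)
      (DirectSum.linearMap_ext K fun n => Chain.linearMap_ext fun r a => ?_) c
    simp only [LinearMap.comp_apply]
    rcases n with _ | _ | n
    · rw [bHoch_in_zero, map_zero]; rfl
    · rw [bHoch_in_succ, bHoch_in_zero]; rfl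
    · rw [bHoch_in_succ, bHoch_in_succ, chainBar, chainBar, Chain.map_mk, Chain.map_mk,
        LinearMap.lTensor_tmul, LinearMap.lTensor_tmul, δbar_δbar, TensorProduct.tmul_zero,
        map_zero, map_zero]
      rfl
  B_B c := by
    refine LinearMap.congr_fun (f := bCurv ι W ∘ₗ bCurv ι W) (g := 0)
      (DirectSum.linearMap_ext K fun n => Chain.linearMap_ext fun r a => ?_) c
    simp only [LinearMap.comp_apply]
    rw [bCurv_in, bCurv_in, chainCurv, chainCurv, Chain.map_mk, Chain.map_mk,
        LinearMap.lTensor_tmul, LinearMap.lTensor_tmul, δcurv_δcurv, TensorProduct.tmul_zero,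
        map_zero, map_zero]
    rfl
  b_B c := by
    refine LinearMap.congr_fun (f := bHoch ι ∘ₗ bCurv ι W + bCurv ι W ∘ₗ bHoch ι) (g := 0)
      (DirectSum.linearMap_ext K fun n => Chain.linearMap_ext fun r a => ?_) c
    have key : ∀ x : T K A (n + 2), Chain.mk ι n (r ⊗ₜ[K] δbar K (n + 1) (δcurv K W (n + 1) x)) +
        Chain.mk ι n (r ⊗ₜ[K] δcurv K W n (δbar K n x)) = 0 := by
      intro x
      have h1 := Chain.mk_rel (ι := ι) n 1 W r x
      have h2 := Chain.mk_rel (ι := ι) n W 1 r x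
      have r1 : ∀ y : T K A (n + 2), rmul K (n + 1) 1 y = y := fun y => by
        refine lin_ext (f := rmul K (n + 1) 1) (g := LinearMap.id) (fun a => ?_) y
        rw [rmul_tp]
        exact tp_congr fun i _ => by simp [rmulSeq]
      have l1 : ∀ y : T K A (n + 2), lmul K (n + 1) 1 y = y := fun y => by
        refine lin_ext (f := lmul K (n + 1) 1) (g := LinearMap.id) (fun a => ?_) y
        rw [lmul_tp]
        exact tp_congr fun i _ => by simp [lmulSeq]
      rw [map_one, one_mul, r1] at h1
      rw [map_one, mul_one, l1] at h2
      rw [← map_add, ← TensorProduct.tmul_add, δbar_δcurv W hW, TensorProduct.tmul_sub, map_sub,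
        ← h1, ← h2, hM, sub_self]
    simp only [LinearMap.comp_apply, LinearMap.add_apply]
    cases n with
    | zero =>
      rw [bHoch_in_zero, map_zero, add_zero, bCurv_in, bHoch_in_succ, chainCurv, chainBar,
        Chain.map_mk, Chain.map_mk, LinearMap.lTensor_tmul, LinearMap.lTensor_tmul]
      have h := key (tp K (0 + 2) a)
      rw [δcurv_zero, LinearMap.zero_apply, TensorProduct.tmul_zero, map_zero, add_zero] at h
      rw [h, map_zero]
      rfl
    | succ n =>
      rw [bHoch_in_succ, bCurv_in, bCurv_in, bHoch_in_succ, ← map_add, chainCurv, chainBar,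
        chainCurv, chainBar,
        Chain.map_mk, Chain.map_mk, LinearMap.lTensor_tmul, LinearMap.lTensor_tmul,
        Chain.map_mk, Chain.map_mk, LinearMap.lTensor_tmul, LinearMap.lTensor_tmul]
      rw [key, map_zero]
      rfl

end Chains

/-! ## Cup and cap products -/

section Products

variable {K : Type u} {A : Type v} {R : Type w} [Field K] [Ring A] [Algebra K A] [Ring R]
  [Algebra K R] (ι : A →ₐ[K] R)

theorem Δbar_lmul (p q n : ℕ) (h : p + q = n) (b : A) (x : T K A (n + 2)) :
    Δbar K p q n h (lmul K (n + 1) b x) =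
      TensorProduct.map (lmul K (p + 1) b) LinearMap.id (Δbar K p q n h x) := by
  refine lin_ext (f := Δbar K p q n h ∘ₗ lmul K (n + 1) b)
    (g := TensorProduct.map (lmul K (p + 1) b) LinearMap.id ∘ₗ Δbar K p q n h) (fun a => ?_) x
  rw [LinearMap.comp_apply, LinearMap.comp_apply, lmul_tp, Δbar_tp, Δbar_tp,
    TensorProduct.map_tmul, lmul_tp, LinearMap.id_apply]
  refine congrArg₂ _ (tp_congr fun i _ => ?_) (tp_congr fun i _ => ?_)
  · simp only [leftSeq, lmulSeq]; split_ifs <;> first | rfl | omega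
  · simp only [rightSeq, lmulSeq]; split_ifs <;> first | rfl | omega

theorem Δbar_rmul (p q n : ℕ) (h : p + q = n) (b : A) (x : T K A (n + 2)) :
    Δbar K p q n h (rmul K (n + 1) b x) =
      TensorProduct.map LinearMap.id (rmul K (q + 1) b) (Δbar K p q n h x) := by
  refine lin_ext (f := Δbar K p q n h ∘ₗ rmul K (n + 1) b)
    (g := TensorProduct.map LinearMap.id (rmul K (q + 1) b) ∘ₗ Δbar K p q n h) (fun a => ?_) x
  rw [LinearMap.comp_apply, LinearMap.comp_apply, rmul_tp, Δbar_tp, Δbar_tp,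
    TensorProduct.map_tmul, rmul_tp, LinearMap.id_apply]
  refine congrArg₂ _ (tp_congr fun i _ => ?_) (tp_congr fun i _ => ?_)
  · simp only [leftSeq, rmulSeq]; split_ifs <;> first | rfl | omega
  · simp only [rightSeq, rmulSeq]; split_ifs <;> first | rfl | omega

/-- The cup product `⟨x, D ∪ E⟩ = (-1)^{|D||x₍₂₎|} ⟨x₍₁₎, D⟩ ⟨x₍₂₎, E⟩` of a `p`-cochain and a
`q`-cochain with values in the algebra `R`; it takes values in `R`, the product `R ⊗_A R → R` having
been applied. Only the component `Δbar` of bidegree `(p, q)` of the coproduct contributes. -/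
def cup (p q : ℕ) : Cochain ι p →ₗ[K] Cochain ι q →ₗ[K] Cochain ι (p + q) :=
  LinearMap.mk₂ K
    (fun D E => ⟨(-1 : K) ^ (p * q) •
        (LinearMap.mul' K R ∘ₗ TensorProduct.map D.1 E.1) ∘ₗ Δbar K p q (p + q) rfl, fun a x => by
      have h1 : ∀ z, LinearMap.mul' K R (TensorProduct.map D.1 E.1
          (TensorProduct.map (lmul K (p + 1) a) LinearMap.id z)) =
          ι a * LinearMap.mul' K R (TensorProduct.map D.1 E.1 z) := fun z => by
        induction z using TensorProduct.induction_on with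
        | zero => simp only [map_zero, mul_zero]
        | tmul y z => simp only [TensorProduct.map_tmul, LinearMap.mul'_apply, LinearMap.id_apply,
            (D.2 a y).1, mul_assoc]
        | add y z hy hz => simp only [map_add, hy, hz, mul_add]
      have h2 : ∀ z, LinearMap.mul' K R (TensorProduct.map D.1 E.1
          (TensorProduct.map LinearMap.id (rmul K (q + 1) a) z)) =
          LinearMap.mul' K R (TensorProduct.map D.1 E.1 z) * ι a := fun z => by
        induction z using TensorProduct.induction_on with
        | zero => simp only [map_zero, zero_mul]
        | tmul y z => simp only [TensorProduct.map_tmul, LinearMap.mul'_apply, LinearMap.id_apply,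
            (E.2 a z).2, mul_assoc]
        | add y z hy hz => simp only [map_add, hy, hz, add_mul]
      simp only [LinearMap.smul_apply, LinearMap.comp_apply, Δbar_lmul, Δbar_rmul, h1, h2,
        mul_smul_comm, smul_mul_assoc, and_self]⟩)
    (fun D D' E => Subtype.ext (by
      change (-1 : K) ^ (p * q) • (LinearMap.mul' K R ∘ₗ TensorProduct.map (D.1 + D'.1) E.1) ∘ₗ _ =
        (-1 : K) ^ (p * q) • (LinearMap.mul' K R ∘ₗ TensorProduct.map D.1 E.1) ∘ₗ _ +
        (-1 : K) ^ (p * q) • (LinearMap.mul' K R ∘ₗ TensorProduct.map D'.1 E.1) ∘ₗ _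
      rw [TensorProduct.map_add_left, LinearMap.comp_add, LinearMap.add_comp, smul_add]))
    (fun c D E => Subtype.ext (by
      change (-1 : K) ^ (p * q) • (LinearMap.mul' K R ∘ₗ TensorProduct.map (c • D.1) E.1) ∘ₗ _ =
        c • (-1 : K) ^ (p * q) • (LinearMap.mul' K R ∘ₗ TensorProduct.map D.1 E.1) ∘ₗ _
      rw [TensorProduct.map_smul_left, LinearMap.comp_smul, LinearMap.smul_comp, smul_comm]))
    (fun D E E' => Subtype.ext (by
      change (-1 : K) ^ (p * q) • (LinearMap.mul' K R ∘ₗ TensorProduct.map D.1 (E.1 + E'.1)) ∘ₗ _ =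
        (-1 : K) ^ (p * q) • (LinearMap.mul' K R ∘ₗ TensorProduct.map D.1 E.1) ∘ₗ _ +
        (-1 : K) ^ (p * q) • (LinearMap.mul' K R ∘ₗ TensorProduct.map D.1 E'.1) ∘ₗ _
      rw [TensorProduct.map_add_right, LinearMap.comp_add, LinearMap.add_comp, smul_add]))
    (fun c D E => Subtype.ext (by
      change (-1 : K) ^ (p * q) • (LinearMap.mul' K R ∘ₗ TensorProduct.map D.1 (c • E.1)) ∘ₗ _ =
        c • (-1 : K) ^ (p * q) • (LinearMap.mul' K R ∘ₗ TensorProduct.map D.1 E.1) ∘ₗ _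
      rw [TensorProduct.map_smul_right, LinearMap.comp_smul, LinearMap.smul_comp, smul_comm]))

variable {ι}

theorem cup_tp (p q : ℕ) (D : Cochain ι p) (E : Cochain ι q) (a : ℕ → A) :
    (cup ι p q D E).1 (tp K (p + q + 2) a) = (-1 : K) ^ (p * q) •
      (D.1 (tp K (p + 2) (leftSeq p a)) * E.1 (tp K (q + 2) (rightSeq p a))) := by
  change (-1 : K) ^ (p * q) • LinearMap.mul' K R (TensorProduct.map D.1 E.1
    (Δbar K p q (p + q) rfl (tp K (p + q + 2) a))) = _
  rw [Δbar_tp, TensorProduct.map_tmul, LinearMap.mul'_apply]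

variable (ι)

/-- The map `m ⊗ x ↦ (-1)^{|D||x₍₂₎|} m⟨x₍₁₎, D⟩ ⊗ x₍₂₎`, for `D` of degree `p` and `x₍₂₎` of degree
`-q`. -/
def capAux (p q n : ℕ) (h : p + q = n) (D : T K A (p + 2) →ₗ[K] R) :
    R ⊗[K] T K A (n + 2) →ₗ[K] R ⊗[K] T K A (q + 2) :=
  (-1 : K) ^ (p * q) • LinearMap.rTensor (T K A (q + 2)) (LinearMap.mul' K R) ∘ₗ
    (TensorProduct.assoc K R R (T K A (q + 2))).symm.toLinearMap ∘ₗ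
    LinearMap.lTensor R (LinearMap.rTensor (T K A (q + 2)) D ∘ₗ Δbar K p q n h)

theorem capAux_tmul (p q n : ℕ) (h : p + q = n) (D : T K A (p + 2) →ₗ[K] R) (r : R) (a : ℕ → A) :
    capAux p q n h D (r ⊗ₜ[K] tp K (n + 2) a) = (-1 : K) ^ (p * q) •
      ((r * D (tp K (p + 2) (leftSeq p a))) ⊗ₜ[K] tp K (q + 2) (rightSeq p a)) := by
  simp only [capAux, LinearMap.smul_apply, LinearMap.comp_apply, LinearMap.lTensor_tmul, Δbar_tp,
    LinearMap.rTensor_tmul, LinearEquiv.coe_coe, TensorProduct.assoc_symm_tmul,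
    LinearMap.mul'_apply]

/-- The cap product `(m ⊗ x) ∩ D = (-1)^{|D||x₍₂₎|} m⟨x₍₁₎, D⟩ ⊗ x₍₂₎` of an `n`-chain and a
`p`-cochain, where `n = p + q`, both with coefficients in the algebra `R`. -/
def cap (p q n : ℕ) (h : p + q = n) : Chain ι n →ₗ[K] Cochain ι p →ₗ[K] Chain ι q :=
  LinearMap.flip
    { toFun := fun D => Chain.map ι (capAux p q n h D.1) fun a₀ a₁ r x => by
        rw [← Chain.mk_eq_iff]
        refine lin_ext
          (f := Chain.mk ι q ∘ₗ capAux p q n h D.1 ∘ₗ TensorProduct.mk K R _ (ι a₀ * r * ι a₁))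
          (g := Chain.mk ι q ∘ₗ capAux p q n h D.1 ∘ₗ TensorProduct.mk K R _ r ∘ₗ
            lmul K (n + 1) a₁ ∘ₗ rmul K (n + 1) a₀) (fun a => ?_) x
        simp only [LinearMap.comp_apply, TensorProduct.mk_apply]
        rw [rmul_tp, lmul_tp, capAux_tmul, capAux_tmul, map_smul, map_smul]
        congr 1
        have e1 : tp K (p + 2) (leftSeq p (lmulSeq a₁ (rmulSeq (n + 1) a₀ a))) =
            lmul K (p + 1) a₁ (tp K (p + 2) (leftSeq p a)) := by
          rw [lmul_tp]
          refine tp_congr fun i _ => ?_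
          simp only [leftSeq, lmulSeq, rmulSeq]
          split_ifs <;> first | rfl | omega
        have e2 : tp K (q + 2) (rightSeq p (lmulSeq a₁ (rmulSeq (n + 1) a₀ a))) =
            rmul K (q + 1) a₀ (tp K (q + 2) (rightSeq p a)) := by
          rw [rmul_tp]
          refine tp_congr fun i _ => ?_
          simp only [rightSeq, lmulSeq, rmulSeq]
          split_ifs <;> first | rfl | omega
        have h1 := Chain.mk_rel (ι := ι) q a₀ 1 (r * ι a₁ * D.1 (tp K (p + 2) (leftSeq p a)))
          (tp K (q + 2) (rightSeq p a))
        have e3 : lmul K (q + 1) 1 (rmul K (q + 1) a₀ (tp K (q + 2) (rightSeq p a))) =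
            rmul K (q + 1) a₀ (tp K (q + 2) (rightSeq p a)) := by
          rw [rmul_tp, lmul_tp]
          exact tp_congr fun i _ => by simp [lmulSeq]
        rw [map_one, mul_one, e3] at h1
        rw [e1, e2, (D.2 a₁ _).1, ← mul_assoc r, ← h1]
        simp only [mul_assoc]
      map_add' := fun D E => Chain.linearMap_ext fun r a => by
        rw [LinearMap.add_apply, Chain.map_mk, Chain.map_mk, Chain.map_mk, ← map_add]
        congr 1
        rw [capAux_tmul, capAux_tmul, capAux_tmul, ← smul_add, ← TensorProduct.add_tmul, ← mul_add]
        rfl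
      map_smul' := fun c D => Chain.linearMap_ext fun r a => by
        rw [LinearMap.smul_apply, Chain.map_mk, Chain.map_mk, ← map_smul]
        congr 1
        rw [capAux_tmul, capAux_tmul, RingHom.id_apply, smul_comm, TensorProduct.smul_tmul' c,
          ← mul_smul_comm]
        rfl }

variable {ι}

theorem cap_mk (p q n : ℕ) (h : p + q = n) (r : R) (a : ℕ → A) (D : Cochain ι p) :
    cap ι p q n h (Chain.mk ι n (r ⊗ₜ[K] tp K (n + 2) a)) D = (-1 : K) ^ (p * q) •
      Chain.mk ι q ((r * D.1 (tp K (p + 2) (leftSeq p a))) ⊗ₜ[K] tp K (q + 2) (rightSeq p a)) := by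
  rw [← map_smul, ← capAux_tmul p q n h]
  rfl

variable (ι)

/-- The cup product on all cochains. -/
def cupProd : Cochains ι →ₗ[K] Cochains ι →ₗ[K] Cochains ι :=
  DirectSum.toModule K ℕ _ fun p => LinearMap.flip <|
    DirectSum.toModule K ℕ _ fun q => LinearMap.flip <| (cup ι p q).compr₂ (inC ι (p + q))

/-- The cap product of all chains and all cochains; it is zero on `n`-chains and `p`-cochains
with `n < p`. -/
def capProd : Chains ι →ₗ[K] Cochains ι →ₗ[K] Chains ι :=
  DirectSum.toModule K ℕ _ fun n => LinearMap.flip <|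
    DirectSum.toModule K ℕ _ fun p => LinearMap.flip <|
      if h : p ≤ n then (cap ι p (n - p) n (Nat.add_sub_of_le h)).compr₂ (inD ι (n - p)) else 0

variable {ι}

theorem cupProd_in (p q : ℕ) (D : Cochain ι p) (E : Cochain ι q) :
    cupProd ι (inC ι p D) (inC ι q E) = inC ι (p + q) (cup ι p q D E) := by
  rw [cupProd, DirectSum.toModule_lof, LinearMap.flip_apply, DirectSum.toModule_lof]
  rfl

theorem capProd_sym_of_lt {n p : ℕ} (h : n < p) (r : R) (a : ℕ → A) (D : Cochain ι p) :
    capProd ι (sym ι n r a) (inC ι p D) = 0 := by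
  rw [capProd, sym, DirectSum.toModule_lof, LinearMap.flip_apply, DirectSum.toModule_lof,
    dif_neg (by omega)]
  rfl

theorem capProd_sym {n p q : ℕ} (h : p + q = n) (r : R) (a : ℕ → A) (D : Cochain ι p) :
    capProd ι (sym ι n r a) (inC ι p D) = (-1 : K) ^ (p * q) •
      sym ι q (r * D.1 (tp K (p + 2) (leftSeq p a))) (rightSeq p a) := by
  obtain rfl : q = n - p := by omega
  rw [capProd, sym, DirectSum.toModule_lof, LinearMap.flip_apply, DirectSum.toModule_lof,
    dif_pos (by omega)]
  change inD ι (n - p) (cap ι p (n - p) n _ _ D) = _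
  rw [cap_mk, map_smul, sym]

/-! ### Sequence identities -/

theorem leftSeq_faceSeq_le {p i : ℕ} (h : i ≤ p) (a : ℕ → A) :
    ∀ j < p + 2, leftSeq p (faceSeq i a) j = faceSeq i (leftSeq (p + 1) a) j := by
  intro j hj
  simp only [leftSeq, faceSeq]
  split_ifs <;> first | rfl | omega

theorem rightSeq_faceSeq_le {p i : ℕ} (h : i ≤ p) (a : ℕ → A) :
    rightSeq p (faceSeq i a) = rightSeq (p + 1) a := by
  funext j
  simp only [rightSeq, faceSeq]
  split_ifs <;> first | rfl | omega | (congr 1; omega)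

theorem leftSeq_faceSeq_gt (p j : ℕ) (a : ℕ → A) :
    leftSeq p (faceSeq (p + 1 + j) a) = leftSeq p a := by
  funext k
  simp only [leftSeq, faceSeq]
  split_ifs <;> first | rfl | omega

theorem rightSeq_faceSeq_gt (p j : ℕ) (a : ℕ → A) :
    rightSeq p (faceSeq (p + 1 + j) a) = faceSeq (j + 1) (rightSeq p a) := by
  funext k
  rcases k with _ | k
  · simp [rightSeq, faceSeq]
  · simp only [rightSeq, faceSeq]
    split_ifs <;> first | rfl | omega | contradiction

theorem faceSeq_leftSeq (p : ℕ) (a : ℕ → A) : ∀ j < p + 2,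
    faceSeq (p + 1) (leftSeq (p + 1) a) j = rmulSeq (p + 1) (a (p + 1)) (leftSeq p a) j := by
  intro j hj
  simp only [leftSeq, faceSeq, rmulSeq]
  split_ifs <;> first | rfl | omega | skip
  subst_vars
  simp

theorem faceSeq_rightSeq (p : ℕ) (a : ℕ → A) :
    faceSeq 0 (rightSeq p a) = lmulSeq (a (p + 1)) (rightSeq (p + 1) a) := by
  funext j
  rcases j with _ | j
  · simp [rightSeq, faceSeq, lmulSeq]
  · simp only [rightSeq, faceSeq, lmulSeq]
    simp [add_assoc, add_comm]

theorem leftSeq_insSeq_lt (W : A) {p i : ℕ} (h : i ≤ p) (a : ℕ → A) :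
    ∀ j < p + 3, leftSeq (p + 1) (insSeq W i a) j = insSeq W i (leftSeq p a) j := by
  intro j hj
  simp only [leftSeq, insSeq]
  split_ifs <;> first | rfl | omega

theorem rightSeq_insSeq_lt (W : A) {p i : ℕ} (h : i ≤ p) (a : ℕ → A) :
    rightSeq (p + 1) (insSeq W i a) = rightSeq p a := by
  funext j
  simp only [rightSeq, insSeq]
  split_ifs <;> first | rfl | omega | (congr 1; omega)

theorem leftSeq_insSeq_ge (W : A) (p j : ℕ) (a : ℕ → A) :
    leftSeq p (insSeq W (p + j) a) = leftSeq p a := by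
  funext k
  simp only [leftSeq, insSeq]
  split_ifs <;> first | rfl | omega

theorem rightSeq_insSeq_ge (W : A) (p j : ℕ) (a : ℕ → A) :
    rightSeq p (insSeq W (p + j) a) = insSeq W j (rightSeq p a) := by
  funext k
  simp only [rightSeq, insSeq]
  split_ifs <;> first | rfl | omega | (congr 1; omega)

/-! ### Leibniz rules -/

theorem cev_cupProd_of_lt {n p : ℕ} (h : n < p) (a : ℕ → A) (D : Cochain ι p) (e : Cochains ι) :
    cev n a (cupProd ι (inC ι p D) e) = 0 := by
  refine LinearMap.congr_fun (f := cev n a ∘ₗ cupProd ι (inC ι p D)) (g := 0)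
    (DirectSum.linearMap_ext K fun q => LinearMap.ext fun E => ?_) e
  simp only [LinearMap.comp_apply]
  rw [cupProd_in, cev_in_ne (by omega)]
  rfl

theorem cev_cupProd (p q : ℕ) (a : ℕ → A) (D : Cochain ι p) (e : Cochains ι) :
    cev (p + q) a (cupProd ι (inC ι p D) e) = (-1 : K) ^ (p * q) •
      (D.1 (tp K (p + 2) (leftSeq p a)) * cev q (rightSeq p a) e) := by
  refine LinearMap.congr_fun (f := cev (p + q) a ∘ₗ cupProd ι (inC ι p D))
    (g := (-1 : K) ^ (p * q) •
      LinearMap.mulLeft K (D.1 (tp K (p + 2) (leftSeq p a))) ∘ₗ cev q (rightSeq p a))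
    (DirectSum.linearMap_ext K fun q' => LinearMap.ext fun E => ?_) e
  simp only [LinearMap.comp_apply, LinearMap.smul_apply, LinearMap.mulLeft_apply]
  rw [cupProd_in]
  by_cases h : q = q'
  · subst h
    rw [cev_in_same, cev_in_same, cup_tp]
  · rw [cev_in_ne (by omega), cev_in_ne h, mul_zero, smul_zero]

theorem sgn_sq (n : ℕ) : (-1 : K) ^ n * (-1 : K) ^ n = 1 := by
  rw [← mul_pow]; simp

theorem cup_leibniz_b (p : ℕ) (D : Cochain ι p) (e : Cochains ι) :
    dHoch ι (cupProd ι (inC ι p D) e) = cupProd ι (dHoch ι (inC ι p D)) e +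
      (-1 : K) ^ p • cupProd ι (inC ι p D) (dHoch ι e) := by
  refine cochains_ext fun m a => ?_
  rw [map_add, map_smul, dHoch_in]
  rcases lt_or_ge m p with hm | hm
  · rw [cev_cupProd_of_lt (by omega), cev_cupProd_of_lt hm, smul_zero, add_zero]
    cases m with
    | zero => rw [cev_dHoch_zero]
    | succ m =>
      rw [cev_dHoch_succ]
      simp only [cev_cupProd_of_lt (show m < p by omega), smul_zero, Finset.sum_const_zero]
  obtain ⟨q, rfl⟩ := Nat.exists_eq_add_of_le hm
  cases q with
  | zero =>
    rw [cev_cupProd_of_lt (by omega), cev_cupProd, cev_dHoch_zero]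
    simp only [mul_zero, smul_zero, add_zero]
    cases p with
    | zero => rw [cev_dHoch_zero]
    | succ p =>
      refine (cev_dHoch_succ p a _).trans ?_
      simp only [cev_cupProd_of_lt (show p < p + 1 by omega), smul_zero, Finset.sum_const_zero]
  | succ q =>
    have hT : D.1 (tp K (p + 2) (faceSeq (p + 1) (leftSeq (p + 1) a))) =
        D.1 (tp K (p + 2) (leftSeq p a)) * ι (a (p + 1)) := by
      rw [tp_congr (faceSeq_leftSeq p a), ← rmul_tp, (D.2 _ _).2]
    have hE : cev q (faceSeq 0 (rightSeq p a)) e = ι (a (p + 1)) * cev q (rightSeq (p + 1) a) e := by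
      rw [faceSeq_rightSeq, cev_lmul]
    have h1 : ∑ i ∈ Finset.range (p + q + 2), (-1 : K) ^ i •
        cev (p + q) (faceSeq i a) (cupProd ι (inC ι p D) e) = (-1 : K) ^ (p * q) •
        ((∑ i ∈ Finset.range (p + 1), (-1 : K) ^ i •
          D.1 (tp K (p + 2) (faceSeq i (leftSeq (p + 1) a)))) * cev q (rightSeq (p + 1) a) e +
        (-1 : K) ^ (p + 1) • (D.1 (tp K (p + 2) (leftSeq p a)) * ∑ j ∈ Finset.range (q + 1),
          (-1 : K) ^ j • cev q (faceSeq (j + 1) (rightSeq p a)) e)) := by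
      rw [show p + q + 2 = (p + 1) + (q + 1) by ring, Finset.sum_range_add, Finset.sum_mul,
        Finset.mul_sum, smul_add, Finset.smul_sum, Finset.smul_sum, Finset.smul_sum]
      refine congrArg₂ _ (Finset.sum_congr rfl fun i hi => ?_)
        (Finset.sum_congr rfl fun j _ => ?_)
      · have hi' : i ≤ p := by simpa [Nat.lt_succ_iff] using hi
        rw [cev_cupProd, tp_congr (leftSeq_faceSeq_le hi' a), rightSeq_faceSeq_le hi',
          smul_mul_assoc, smul_comm]
      · rw [cev_cupProd, leftSeq_faceSeq_gt, rightSeq_faceSeq_gt, mul_smul_comm, pow_add,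
          mul_smul, smul_comm ((-1 : K) ^ j) ((-1 : K) ^ (p * q)),
          smul_comm ((-1 : K) ^ (p + 1)) ((-1 : K) ^ (p * q))]
    rw [show p + (q + 1) = p + q + 1 from rfl, cev_dHoch_succ, h1]
    rw [show cev (p + q + 1) a (cupProd ι (inC ι (p + 1) (cobar ι p D)) e) =
      (-1 : K) ^ ((p + 1) * q) • ((cobar ι p D).1 (tp K (p + 3) (leftSeq (p + 1) a)) *
        cev q (rightSeq (p + 1) a) e) by
        rw [← cev_cupProd]; rw [show p + q + 1 = p + 1 + q by ring]]
    rw [show p + q + 1 = p + (q + 1) from rfl, cev_cupProd, cobar_tp, cev_dHoch_succ,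
      Finset.sum_range_succ _ (p + 1), Finset.sum_range_succ' _ (q + 1), hT, hE]
    have e1 : (-1 : K) ^ (p + 1) = -(-1) ^ p := by rw [pow_succ]; ring
    have e2 : ∑ j ∈ Finset.range (q + 1), (-1 : K) ^ (j + 1) •
        cev q (faceSeq (j + 1) (rightSeq p a)) e = - ∑ j ∈ Finset.range (q + 1), (-1 : K) ^ j •
        cev q (faceSeq (j + 1) (rightSeq p a)) e := by
      rw [← Finset.sum_neg_distrib]
      refine Finset.sum_congr rfl fun j _ => ?_
      rw [pow_succ, mul_neg_one, neg_smul]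
    rw [e2, e1, pow_zero, one_smul]
    generalize (∑ i ∈ Finset.range (p + 1), (-1 : K) ^ i •
      D.1 (tp K (p + 2) (faceSeq i (leftSeq (p + 1) a)))) = S1
    generalize (∑ j ∈ Finset.range (q + 1), (-1 : K) ^ j •
      cev q (faceSeq (j + 1) (rightSeq p a)) e) = S2
    generalize D.1 (tp K (p + 2) (leftSeq p a)) = d
    generalize cev q (rightSeq (p + 1) a) e = f
    have s1 := sgn_sq (K := K) p
    rw [show (p + 1) * q = p * q + q by ring, show p * (q + 1) = p * q + p by ring, pow_add,
      pow_add, pow_add]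
    generalize (-1 : K) ^ p = x at *
    generalize (-1 : K) ^ q = y at *
    generalize (-1 : K) ^ (p * q) = z at *
    simp only [smul_mul_assoc, mul_smul_comm, add_mul, mul_add, mul_neg, smul_add, smul_neg,
      neg_smul, smul_smul, mul_assoc]
    have e3 : x * (z * (x * y)) = z * y := by linear_combination (z * y) * s1
    have e4 : x * (y * (z * x)) = z * y := by linear_combination (z * y) * s1
    rw [e3, e4, s1, one_smul, neg_mul, mul_assoc]
    module

end Products

section Leibniz

variable {K : Type u} {A : Type v} {R : Type w} [Field K] [Ring A] [Algebra K A] [Ring R]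
  [Algebra K R] {ι : A →ₐ[K] R}

theorem cev_cupProd' {p q n : ℕ} (h : n = p + q) (a : ℕ → A) (D : Cochain ι p) (e : Cochains ι) :
    cev n a (cupProd ι (inC ι p D) e) = (-1 : K) ^ (p * q) •
      (D.1 (tp K (p + 2) (leftSeq p a)) * cev q (rightSeq p a) e) := by
  subst h
  exact cev_cupProd p q a D e

theorem cup_leibniz_B (W : A) (p : ℕ) (D : Cochain ι p) (e : Cochains ι) :
    dCurv ι W (cupProd ι (inC ι p D) e) = cupProd ι (dCurv ι W (inC ι p D)) e +
      (-1 : K) ^ p • cupProd ι (inC ι p D) (dCurv ι W e) := by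
  refine cochains_ext fun m a => ?_
  rw [map_add, map_smul, cev_dCurv]
  cases p with
  | zero =>
    rw [dCurv_in_zero, map_zero, LinearMap.zero_apply, map_zero, zero_add,
      cev_cupProd' (show m = 0 + m by omega), cev_dCurv]
    simp only [cev_cupProd' (show m + 1 = 0 + (m + 1) by omega), zero_mul, pow_zero, one_smul,
      mul_smul_comm, Finset.mul_sum]
    congr 1
    refine Finset.sum_congr rfl fun i _ => ?_
    have h1 := leftSeq_insSeq_ge W 0 i a
    have h2 := rightSeq_insSeq_ge W 0 i a
    rw [zero_add] at h1 h2
    rw [h1, h2]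
  | succ p =>
    rw [dCurv_in_succ]
    rcases lt_or_ge m p with hm | hm
    · rw [cev_cupProd_of_lt hm, cev_cupProd_of_lt (by omega)]
      simp only [cev_cupProd_of_lt (show m + 1 < p + 1 by omega), smul_zero,
        Finset.sum_const_zero, add_zero]
    obtain ⟨q, rfl⟩ := Nat.exists_eq_add_of_le hm
    have h1 : ∑ i ∈ Finset.range (p + q + 1), (-1 : K) ^ i •
        cev (p + q + 1) (insSeq W i a) (cupProd ι (inC ι (p + 1) D) e) = (-1 : K) ^ ((p + 1) * q) •
        ((∑ i ∈ Finset.range (p + 1), (-1 : K) ^ i •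
          D.1 (tp K (p + 3) (insSeq W i (leftSeq p a)))) * cev q (rightSeq p a) e +
        (-1 : K) ^ (p + 1) • (D.1 (tp K (p + 3) (leftSeq (p + 1) a)) * ∑ j ∈ Finset.range q,
          (-1 : K) ^ j • cev q (insSeq W j (rightSeq (p + 1) a)) e)) := by
      rw [show p + q + 1 = (p + 1) + q by ring, Finset.sum_range_add, Finset.sum_mul,
        Finset.mul_sum, smul_add, Finset.smul_sum, Finset.smul_sum, Finset.smul_sum]
      refine congrArg₂ _ (Finset.sum_congr rfl fun i hi => ?_)
        (Finset.sum_congr rfl fun j _ => ?_)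
      · have hi' : i ≤ p := by simpa [Nat.lt_succ_iff] using hi
        rw [cev_cupProd, tp_congr (leftSeq_insSeq_lt W hi' a), rightSeq_insSeq_lt W hi',
          smul_mul_assoc, smul_comm]
      · rw [cev_cupProd, leftSeq_insSeq_ge, rightSeq_insSeq_ge, mul_smul_comm, pow_add,
          mul_smul, smul_comm ((-1 : K) ^ j) ((-1 : K) ^ ((p + 1) * q)),
          smul_comm ((-1 : K) ^ (p + 1)) ((-1 : K) ^ ((p + 1) * q))]
    have h2 : cev (p + q) a (cupProd ι (inC ι (p + 1) D) (dCurv ι W e)) =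
        (-1 : K) ^ ((p + 1) * q + p + 1 + q) • (D.1 (tp K (p + 3) (leftSeq (p + 1) a)) *
          ∑ j ∈ Finset.range q, (-1 : K) ^ j • cev q (insSeq W j (rightSeq (p + 1) a)) e) := by
      cases q with
      | zero => rw [cev_cupProd_of_lt (by omega), Finset.sum_range_zero]; simp only [mul_zero, smul_zero]
      | succ q =>
        rw [cev_cupProd' (show p + (q + 1) = p + 1 + q by ring), cev_dCurv, mul_smul_comm,
          smul_smul]
        congr 1
        rw [show (p + 1) * (q + 1) + p + 1 + (q + 1) = 2 * (p + 1) + ((p + 1) * q + (q + 1)) by ring,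
          pow_add _ (2 * (p + 1)), pow_mul _ 2, neg_one_sq, one_pow, one_mul, pow_add _ _ (q + 1)]
    rw [h1, h2, cev_cupProd, cocurv_tp]
    generalize (∑ i ∈ Finset.range (p + 1), (-1 : K) ^ i •
      D.1 (tp K (p + 3) (insSeq W i (leftSeq p a)))) = S1
    generalize (∑ j ∈ Finset.range q, (-1 : K) ^ j •
      cev q (insSeq W j (rightSeq (p + 1) a)) e) = S2
    generalize D.1 (tp K (p + 3) (leftSeq (p + 1) a)) = d
    generalize cev q (rightSeq p a) e = f
    have s1 := sgn_sq (K := K) p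
    have s2 := sgn_sq (K := K) q
    rw [show (p + 1) * q = p * q + q by ring]
    simp only [pow_add, pow_one]
    generalize (-1 : K) ^ p = x at *
    generalize (-1 : K) ^ q = y at *
    generalize (-1 : K) ^ (p * q) = z at *
    simp only [smul_mul_assoc, smul_add, smul_smul]
    congr 2
    · linear_combination (-x * z) * s2
    · ring

/-- `sym` as a linear map in the coefficient. -/
def symL (q : ℕ) (a : ℕ → A) : R →ₗ[K] Chains ι :=
  inD ι q ∘ₗ Chain.mk ι q ∘ₗ (TensorProduct.mk K R (T K A (q + 2))).flip (tp K (q + 2) a)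

theorem sym_eq (q : ℕ) (r : R) (a : ℕ → A) : sym ι q r a = symL (K := K) q a r := rfl

theorem symL_mul_sum (q : ℕ) (a : ℕ → A) (r : R) (s : Finset ℕ) (f : ℕ → R) :
    sym ι q (r * ∑ i ∈ s, (-1 : K) ^ i • f i) a =
      ∑ i ∈ s, (-1 : K) ^ i • sym ι q (r * f i) a := by
  simp only [sym_eq, Finset.mul_sum, mul_smul_comm, map_sum, map_smul]

theorem symL_mul_smul (q : ℕ) (a : ℕ → A) (r s : R) (c : K) :
    sym ι q (r * c • s) a = c • sym ι q (r * s) a := by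
  simp only [sym_eq, mul_smul_comm, map_smul]

theorem symL_mul_add (q : ℕ) (a : ℕ → A) (r s s' : R) :
    sym ι q (r * (s + s')) a = sym ι q (r * s) a + sym ι q (r * s') a := by
  simp only [sym_eq, mul_add, map_add]

theorem cap_leibniz_b_sym (n p : ℕ) (r : R) (a : ℕ → A) (D : Cochain ι p) :
    bHoch ι (capProd ι (sym ι n r a) (inC ι p D)) =
      capProd ι (bHoch ι (sym ι n r a)) (inC ι p D) +
      (-1 : K) ^ n • capProd ι (sym ι n r a) (dHoch ι (inC ι p D)) := by
  have small : n ≤ p → capProd ι (bHoch ι (sym ι n r a)) (inC ι p D) = 0 := fun h => by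
    cases n with
    | zero => rw [bHoch_sym_zero, map_zero, LinearMap.zero_apply]
    | succ n =>
      rw [bHoch_sym_succ, map_sum, LinearMap.sum_apply]
      refine Finset.sum_eq_zero fun i _ => ?_
      rw [map_smul, LinearMap.smul_apply, capProd_sym_of_lt (by omega), smul_zero]
  rw [dHoch_in]
  rcases lt_or_ge n p with hm | hm
  · rw [small hm.le, capProd_sym_of_lt hm, capProd_sym_of_lt (by omega), map_zero, smul_zero,
      add_zero]
  obtain ⟨q, rfl⟩ := Nat.exists_eq_add_of_le hm
  cases q with
  | zero =>
    rw [small le_rfl, capProd_sym (q := 0) rfl, capProd_sym_of_lt (by omega), map_smul,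
      bHoch_sym_zero, smul_zero, smul_zero, add_zero]
  | succ q =>
    have hT : D.1 (tp K (p + 2) (faceSeq (p + 1) (leftSeq (p + 1) a))) =
        D.1 (tp K (p + 2) (leftSeq p a)) * ι (a (p + 1)) := by
      rw [tp_congr (faceSeq_leftSeq p a), ← rmul_tp, (D.2 _ _).2]
    have h1 : capProd ι (bHoch ι (sym ι (p + (q + 1)) r a)) (inC ι p D) = (-1 : K) ^ (p * q) •
        (∑ i ∈ Finset.range (p + 1), (-1 : K) ^ i •
          sym ι q (r * D.1 (tp K (p + 2) (faceSeq i (leftSeq (p + 1) a)))) (rightSeq (p + 1) a) +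
        (-1 : K) ^ (p + 1) • ∑ j ∈ Finset.range (q + 1),
          (-1 : K) ^ j • sym ι q (r * D.1 (tp K (p + 2) (leftSeq p a)))
            (faceSeq (j + 1) (rightSeq p a))) := by
      rw [show p + (q + 1) = p + q + 1 from rfl, bHoch_sym_succ, map_sum, LinearMap.sum_apply,
        show p + q + 2 = (p + 1) + (q + 1) by ring, Finset.sum_range_add,
        smul_add, Finset.smul_sum, Finset.smul_sum, Finset.smul_sum]
      refine congrArg₂ _ (Finset.sum_congr rfl fun i hi => ?_)
        (Finset.sum_congr rfl fun j _ => ?_)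
      · have hi' : i ≤ p := by simpa [Nat.lt_succ_iff] using hi
        rw [map_smul, LinearMap.smul_apply, capProd_sym (q := q) rfl,
          tp_congr (leftSeq_faceSeq_le hi' a), rightSeq_faceSeq_le hi', smul_comm]
      · rw [map_smul, LinearMap.smul_apply, capProd_sym (q := q) rfl, leftSeq_faceSeq_gt,
          rightSeq_faceSeq_gt, pow_add,
          mul_smul, smul_comm ((-1 : K) ^ j) ((-1 : K) ^ (p * q)),
          smul_comm ((-1 : K) ^ (p + 1)) ((-1 : K) ^ (p * q))]
    rw [h1, capProd_sym (q := q + 1) rfl, capProd_sym (q := q) (show p + 1 + q = p + (q + 1) by ring),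
      map_smul, bHoch_sym_succ, Finset.sum_range_succ' _ (q + 1), faceSeq_rightSeq, sym_lmul,
      cobar_tp, Finset.sum_range_succ _ (p + 1), hT, symL_mul_smul, symL_mul_add, symL_mul_sum,
      symL_mul_smul, mul_assoc]
    have e2 : ∑ j ∈ Finset.range (q + 1), (-1 : K) ^ (j + 1) •
        sym ι q (r * D.1 (tp K (p + 2) (leftSeq p a))) (faceSeq (j + 1) (rightSeq p a)) =
        - ∑ j ∈ Finset.range (q + 1), (-1 : K) ^ j •
        sym ι q (r * D.1 (tp K (p + 2) (leftSeq p a))) (faceSeq (j + 1) (rightSeq p a)) := by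
      rw [← Finset.sum_neg_distrib]
      refine Finset.sum_congr rfl fun j _ => ?_
      rw [pow_succ, mul_neg_one, neg_smul]
    rw [e2, pow_zero, one_smul]
    generalize (∑ i ∈ Finset.range (p + 1), (-1 : K) ^ i •
      sym ι q (r * D.1 (tp K (p + 2) (faceSeq i (leftSeq (p + 1) a)))) (rightSeq (p + 1) a)) = S1
    generalize (∑ j ∈ Finset.range (q + 1), (-1 : K) ^ j •
      sym ι q (r * D.1 (tp K (p + 2) (leftSeq p a))) (faceSeq (j + 1) (rightSeq p a))) = S2
    generalize sym ι q (r * (D.1 (tp K (p + 2) (leftSeq p a)) * ι (a (p + 1))))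
      (rightSeq (p + 1) a) = E
    have s1 := sgn_sq (K := K) p
    have s2 := sgn_sq (K := K) q
    rw [show (p + 1) * q = p * q + q by ring, show p * (q + 1) = p * q + p by ring]
    simp only [pow_add, pow_one]
    generalize (-1 : K) ^ p = x at *
    generalize (-1 : K) ^ q = y at *
    generalize (-1 : K) ^ (p * q) = z at *
    have e3 : x * (y * -1) * (z * y * x) = -z := by
      linear_combination (-z * y * y) * s1 - z * s2
    have e4 : x * (y * -1) * (z * y * (x * (x * -1))) = z * x := by
      linear_combination (z * x * y * y) * s1 + z * x * s2
    simp only [smul_add, smul_neg, smul_smul, mul_assoc] at *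
    rw [e3, e4]
    module

theorem cap_leibniz_B_sym (W : A) (n p : ℕ) (r : R) (a : ℕ → A) (D : Cochain ι p) :
    bCurv ι W (capProd ι (sym ι n r a) (inC ι p D)) =
      capProd ι (bCurv ι W (sym ι n r a)) (inC ι p D) +
      (-1 : K) ^ n • capProd ι (sym ι n r a) (dCurv ι W (inC ι p D)) := by
  rw [bCurv_sym, map_sum, LinearMap.sum_apply]
  simp only [map_smul, LinearMap.smul_apply]
  cases p with
  | zero =>
    rw [dCurv_in_zero, map_zero, smul_zero, add_zero, capProd_sym (q := n) (zero_add n), map_smul,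
      bCurv_sym, Finset.smul_sum]
    refine Finset.sum_congr rfl fun i _ => ?_
    have h1 := leftSeq_insSeq_ge W 0 i a
    have h2 := rightSeq_insSeq_ge W 0 i a
    rw [zero_add] at h1 h2
    rw [capProd_sym (q := n + 1) (zero_add _), h1, h2, zero_mul, zero_mul, pow_zero, one_smul,
      one_smul]
  | succ p =>
    rw [dCurv_in_succ]
    rcases lt_or_ge n p with hm | hm
    · rw [capProd_sym_of_lt hm, capProd_sym_of_lt (by omega)]
      simp only [capProd_sym_of_lt (show n + 1 < p + 1 by omega), smul_zero, map_zero,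
        Finset.sum_const_zero, add_zero]
    obtain ⟨q, rfl⟩ := Nat.exists_eq_add_of_le hm
    have h1 : ∑ i ∈ Finset.range (p + q + 1), (-1 : K) ^ i •
        capProd ι (sym ι (p + q + 1) r (insSeq W i a)) (inC ι (p + 1) D) =
        (-1 : K) ^ ((p + 1) * q) • (∑ i ∈ Finset.range (p + 1), (-1 : K) ^ i •
          sym ι q (r * D.1 (tp K (p + 3) (insSeq W i (leftSeq p a)))) (rightSeq p a) +
        (-1 : K) ^ (p + 1) • ∑ j ∈ Finset.range q, (-1 : K) ^ j •
          sym ι q (r * D.1 (tp K (p + 3) (leftSeq (p + 1) a)))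
            (insSeq W j (rightSeq (p + 1) a))) := by
      rw [show p + q + 1 = (p + 1) + q by ring, Finset.sum_range_add,
        smul_add, Finset.smul_sum, Finset.smul_sum, Finset.smul_sum]
      refine congrArg₂ _ (Finset.sum_congr rfl fun i hi => ?_)
        (Finset.sum_congr rfl fun j _ => ?_)
      · have hi' : i ≤ p := by simpa [Nat.lt_succ_iff] using hi
        rw [capProd_sym (q := q) rfl, tp_congr (leftSeq_insSeq_lt W hi' a),
          rightSeq_insSeq_lt W hi', smul_comm]
      · rw [capProd_sym (q := q) rfl, leftSeq_insSeq_ge, rightSeq_insSeq_ge, pow_add,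
          mul_smul, smul_comm ((-1 : K) ^ j) ((-1 : K) ^ ((p + 1) * q)),
          smul_comm ((-1 : K) ^ (p + 1)) ((-1 : K) ^ ((p + 1) * q))]
    have h2 : bCurv ι W (capProd ι (sym ι (p + q) r a) (inC ι (p + 1) D)) =
        (-1 : K) ^ ((p + 1) * q + p + 1) • ∑ j ∈ Finset.range q, (-1 : K) ^ j •
          sym ι q (r * D.1 (tp K (p + 3) (leftSeq (p + 1) a)))
            (insSeq W j (rightSeq (p + 1) a)) := by
      cases q with
      | zero =>
        rw [capProd_sym_of_lt (by omega), Finset.sum_range_zero, smul_zero, map_zero]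
      | succ q =>
        rw [capProd_sym (q := q) (show p + 1 + q = p + (q + 1) by ring), map_smul, bCurv_sym]
        congr 1
        rw [show (p + 1) * (q + 1) + p + 1 = 2 * (p + 1) + (p + 1) * q by ring,
          pow_add _ (2 * (p + 1)), pow_mul _ 2, neg_one_sq, one_pow, one_mul]
    rw [h1, h2, capProd_sym (q := q) rfl, cocurv_tp, symL_mul_smul, symL_mul_sum]
    generalize (∑ i ∈ Finset.range (p + 1), (-1 : K) ^ i •
      sym ι q (r * D.1 (tp K (p + 3) (insSeq W i (leftSeq p a)))) (rightSeq p a)) = S1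
    generalize (∑ j ∈ Finset.range q, (-1 : K) ^ j •
      sym ι q (r * D.1 (tp K (p + 3) (leftSeq (p + 1) a)))
        (insSeq W j (rightSeq (p + 1) a))) = S2
    have s1 := sgn_sq (K := K) p
    rw [show (p + 1) * q = p * q + q by ring]
    simp only [pow_add, pow_one]
    generalize (-1 : K) ^ p = x at *
    generalize (-1 : K) ^ q = y at *
    generalize (-1 : K) ^ (p * q) = z at *
    have e3 : x * y * (z * (x * -1)) = -(z * y) := by linear_combination (-z * y) * s1
    simp only [smul_add, smul_smul]
    rw [e3]
    module

variable (ι)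

/-- The cup product as a morphism of mixed complexes. -/
def cupPairing (W : A) (hW : ∀ a : A, a * W = W * a) (hM : ∀ r : R, r * ι W = ι W * r) :
    MixedPairing (cochainComplex ι W hW hM) (cochainComplex ι W hW hM)
      (cochainComplex ι W hW hM) where
  μ := cupProd ι
  mem {p q c d} hc hd := by
    obtain rfl | ⟨n, D, rfl, rfl⟩ := grBy_cases Nat.cast_injective hc
    · rw [map_zero]; exact zero_mem _
    obtain rfl | ⟨m, E, rfl, rfl⟩ := grBy_cases Nat.cast_injective hd
    · rw [map_zero]; exact zero_mem _
    rw [cupProd_in]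
    exact lof_mem_grBy' _ _ _ (by push_cast; rfl)
  leibniz_b {p c} d hc := by
    obtain rfl | ⟨n, D, rfl, rfl⟩ := grBy_cases Nat.cast_injective hc
    · simp only [map_zero, LinearMap.zero_apply, smul_zero, add_zero]
    · have h : (((n : ℤ).negOnePow : ℤ) : K) = (-1) ^ n := by simp [Int.negOnePow_def]
      rw [h]
      exact cup_leibniz_b n D d
  leibniz_B {p c} d hc := by
    obtain rfl | ⟨n, D, rfl, rfl⟩ := grBy_cases Nat.cast_injective hc
    · simp only [map_zero, LinearMap.zero_apply, smul_zero, add_zero]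
    · have h : (((n : ℤ).negOnePow : ℤ) : K) = (-1) ^ n := by simp [Int.negOnePow_def]
      rw [h]
      exact cup_leibniz_B W n D d

theorem cap_leibniz {b : Chains ι →ₗ[K] Chains ι} {d : Cochains ι →ₗ[K] Cochains ι}
    (h : ∀ (n p : ℕ) (r : R) (a : ℕ → A) (D : Cochain ι p),
      b (capProd ι (sym ι n r a) (inC ι p D)) = capProd ι (b (sym ι n r a)) (inC ι p D) +
        (-1 : K) ^ n • capProd ι (sym ι n r a) (d (inC ι p D)))
    (n : ℕ) (x : Chain ι n) (D : Cochains ι) :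
    b (capProd ι (inD ι n x) D) = capProd ι (b (inD ι n x)) D +
      (-1 : K) ^ n • capProd ι (inD ι n x) (d D) := by
  refine LinearMap.congr_fun (f := b ∘ₗ (capProd ι).flip D ∘ₗ inD ι n)
    (g := (capProd ι).flip D ∘ₗ b ∘ₗ inD ι n + (-1 : K) ^ n • (capProd ι).flip (d D) ∘ₗ inD ι n)
    (Chain.linearMap_ext fun r a => ?_) x
  refine LinearMap.congr_fun (f := b ∘ₗ capProd ι (sym ι n r a))
    (g := capProd ι (b (sym ι n r a)) + (-1 : K) ^ n • capProd ι (sym ι n r a) ∘ₗ d)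
    (DirectSum.linearMap_ext K fun p => LinearMap.ext fun D => ?_) D
  exact h n p r a D

/-- The cap product as a morphism of mixed complexes. -/
def capPairing (W : A) (hW : ∀ a : A, a * W = W * a) (hM : ∀ r : R, r * ι W = ι W * r) :
    MixedPairing (chainComplex ι W hW hM) (cochainComplex ι W hW hM)
      (chainComplex ι W hW hM) where
  μ := capProd ι
  mem {p q c d} hc hd := by
    obtain rfl | ⟨n, x, rfl, rfl⟩ := grBy_cases neg_cast_injective hc
    · rw [map_zero]; exact zero_mem _
    obtain rfl | ⟨m, D, rfl, rfl⟩ := grBy_cases Nat.cast_injective hd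
    · rw [map_zero]; exact zero_mem _
    change capProd ι (inD ι n x) (inC ι m D) ∈ _
    rw [capProd, DirectSum.toModule_lof, LinearMap.flip_apply, DirectSum.toModule_lof]
    by_cases h : m ≤ n
    · rw [dif_pos h]
      exact lof_mem_grBy' _ _ _ (by push_cast [h]; ring)
    · rw [dif_neg h]
      exact zero_mem _
  leibniz_b {p c} d hc := by
    obtain rfl | ⟨n, x, rfl, rfl⟩ := grBy_cases neg_cast_injective hc
    · simp only [map_zero, LinearMap.zero_apply, smul_zero, add_zero]
    · have h : (((-(n : ℤ)).negOnePow : ℤ) : K) = (-1) ^ n := by simp [Int.negOnePow_def]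
      rw [h]
      exact cap_leibniz ι cap_leibniz_b_sym n x d
  leibniz_B {p c} d hc := by
    obtain rfl | ⟨n, x, rfl, rfl⟩ := grBy_cases neg_cast_injective hc
    · simp only [map_zero, LinearMap.zero_apply, smul_zero, add_zero]
    · have h : (((-(n : ℤ)).negOnePow : ℤ) : K) = (-1) ^ n := by simp [Int.negOnePow_def]
      rw [h]
      exact cap_leibniz ι (cap_leibniz_B_sym W) n x d

end Leibniz

/-! ## The group action -/

section GroupAction

variable {K : Type u} {A : Type v} {R : Type w} {G : Type v₁} [Field K] [Ring A] [Algebra K A]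
  [Ring R] [Algebra K R] [Group G]

/-- Conjugation `r ↦ u(g) r u(g)⁻¹` on `R`, where `u : G → R` is multiplicative. -/
def conj (u : G →* R) (g : G) : R →ₗ[K] R :=
  LinearMap.mulLeft K (u g) ∘ₗ LinearMap.mulRight K (u g⁻¹)

theorem conj_apply (u : G →* R) (g : G) (r : R) : conj (K := K) u g r = u g * (r * u g⁻¹) := rfl

theorem conj_mul (u : G →* R) (g : G) (r s : R) :
    conj (K := K) u g (r * s) = conj (K := K) u g r * conj (K := K) u g s := by
  have h : u g⁻¹ * u g = 1 := by rw [← map_mul, inv_mul_cancel, map_one]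
  simp only [conj_apply, mul_assoc]
  rw [← mul_assoc (u g⁻¹) (u g), h, one_mul]

theorem conj_one (u : G →* R) (r : R) : conj (K := K) u 1 r = r := by
  rw [conj_apply, inv_one, map_one, mul_one, one_mul]

theorem conj_conj (u : G →* R) (g h : G) (r : R) :
    conj (K := K) u (g * h) r = conj (K := K) u g (conj (K := K) u h r) := by
  simp only [conj_apply, mul_inv_rev, map_mul, mul_assoc]

variable [MulSemiringAction G A] {ι : A →ₐ[K] R} {u : G →* R}

theorem conj_ι (hu : ∀ (g : G) (a : A), u g * ι a = ι (g • a) * u g) (g : G) (a : A) : conj (K := K) u g (ι a) = ι (g • a) := by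
  rw [conj_apply, ← mul_assoc, hu, mul_assoc, ← map_mul, mul_inv_cancel, map_one, mul_one]

variable [SMulCommClass G K A]

variable (K A) in
/-- The diagonal action of `G` on `A ⊗ ⋯ ⊗ A`. -/
def diag (m : ℕ) (g : G) : T K A m →ₗ[K] T K A m :=
  PiTensorProduct.map fun _ => DistribSMul.toLinearMap K A g

theorem diag_tp (m : ℕ) (g : G) (a : ℕ → A) :
    diag K A m g (tp K m a) = tp K m fun i => g • a i := by
  unfold diag tp
  rw [PiTensorProduct.map_tprod]
  rfl

theorem diag_one (m : ℕ) (x : T K A m) : diag K A m (1 : G) x = x := by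
  refine lin_ext (f := diag K A m (1 : G)) (g := LinearMap.id) (fun a => ?_) x
  rw [diag_tp, LinearMap.id_apply]
  exact tp_congr fun i _ => one_smul _ _

theorem diag_diag (m : ℕ) (g h : G) (x : T K A m) :
    diag K A m (g * h) x = diag K A m g (diag K A m h x) := by
  refine lin_ext (f := diag K A m (g * h)) (g := diag K A m g ∘ₗ diag K A m h) (fun a => ?_) x
  rw [LinearMap.comp_apply, diag_tp, diag_tp, diag_tp]
  exact tp_congr fun i _ => mul_smul _ _ _

theorem diag_lmul (m : ℕ) (g : G) (b : A) (x : T K A (m + 1)) :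
    diag K A (m + 1) g (lmul K m b x) = lmul K m (g • b) (diag K A (m + 1) g x) := by
  refine lin_ext (f := diag K A (m + 1) g ∘ₗ lmul K m b)
    (g := lmul K m (g • b) ∘ₗ diag K A (m + 1) g) (fun a => ?_) x
  rw [LinearMap.comp_apply, LinearMap.comp_apply, lmul_tp, diag_tp, diag_tp, lmul_tp]
  refine tp_congr fun i _ => ?_
  simp only [lmulSeq]; split_ifs <;> simp only [smul_mul']

theorem diag_rmul (m : ℕ) (g : G) (b : A) (x : T K A (m + 1)) :
    diag K A (m + 1) g (rmul K m b x) = rmul K m (g • b) (diag K A (m + 1) g x) := by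
  refine lin_ext (f := diag K A (m + 1) g ∘ₗ rmul K m b)
    (g := rmul K m (g • b) ∘ₗ diag K A (m + 1) g) (fun a => ?_) x
  rw [LinearMap.comp_apply, LinearMap.comp_apply, rmul_tp, diag_tp, diag_tp, rmul_tp]
  refine tp_congr fun i _ => ?_
  simp only [rmulSeq]; split_ifs <;> simp only [smul_mul']

theorem δbar_diag (m : ℕ) (g : G) (x : T K A (m + 2)) :
    δbar K m (diag K A (m + 2) g x) = diag K A (m + 1) g (δbar K m x) := by
  refine lin_ext (f := δbar K m ∘ₗ diag K A (m + 2) g)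
    (g := diag K A (m + 1) g ∘ₗ δbar K m) (fun a => ?_) x
  rw [LinearMap.comp_apply, LinearMap.comp_apply, diag_tp, δbar_tp, δbar_tp, map_sum]
  refine Finset.sum_congr rfl fun i _ => ?_
  rw [map_smul, diag_tp]
  congr 1
  refine tp_congr fun j _ => ?_
  simp only [faceSeq]; split_ifs <;> simp only [smul_mul']

theorem δcurv_diag {W : A} {g : G} (hg : g • W = W) (m : ℕ) (x : T K A (m + 1)) :
    δcurv K W m (diag K A (m + 1) g x) = diag K A (m + 2) g (δcurv K W m x) := by
  refine lin_ext (f := δcurv K W m ∘ₗ diag K A (m + 1) g)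
    (g := diag K A (m + 2) g ∘ₗ δcurv K W m) (fun a => ?_) x
  rw [LinearMap.comp_apply, LinearMap.comp_apply, diag_tp, δcurv_tp, δcurv_tp, map_sum]
  refine Finset.sum_congr rfl fun i _ => ?_
  rw [map_smul, diag_tp]
  congr 1
  refine tp_congr fun j _ => ?_
  simp only [insSeq]; split_ifs <;> simp only [hg]

/-- The action `D ↦ g ∘ D ∘ g⁻¹` of `G` on `n`-cochains. -/
def cochainAction (hu : ∀ (g : G) (a : A), u g * ι a = ι (g • a) * u g) (n : ℕ) (g : G) :
    Cochain ι n →ₗ[K] Cochain ι n where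
  toFun D := ⟨conj u g ∘ₗ D.1 ∘ₗ diag K A (n + 2) g⁻¹, fun a x => by
    simp only [LinearMap.comp_apply, diag_lmul, diag_rmul, (D.2 _ _).1, (D.2 _ _).2, conj_mul,
      conj_ι hu, smul_inv_smul, and_self]⟩
  map_add' D E := Subtype.ext (LinearMap.ext fun x => map_add (conj u g) (D.1 _) (E.1 _))
  map_smul' c D := Subtype.ext (LinearMap.ext fun x => map_smul (conj u g) c (D.1 _))

/-- The action `m ⊗ x ↦ g(m) ⊗ g(x)` of `G` on `n`-chains. -/
def chainAction (hu : ∀ (g : G) (a : A), u g * ι a = ι (g • a) * u g) (n : ℕ) (g : G) :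
    Chain ι n →ₗ[K] Chain ι n :=
  Chain.map ι (TensorProduct.map (conj u g) (diag K A (n + 2) g)) fun a₀ a₁ r x => by
    rw [TensorProduct.map_tmul, TensorProduct.map_tmul, diag_lmul, diag_rmul, conj_mul, conj_mul,
      conj_ι hu, conj_ι hu]
    exact mem_chainRel _ _ _ _ _

theorem cochainAction_tp (hu : ∀ (g : G) (a : A), u g * ι a = ι (g • a) * u g) (n : ℕ) (g : G)
    (D : Cochain ι n) (a : ℕ → A) : (cochainAction hu n g D).1 (tp K (n + 2) a) =
      conj (K := K) u g (D.1 (tp K (n + 2) fun i => g⁻¹ • a i)) := by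
  rw [← diag_tp]
  rfl

variable (ι) in
/-- The action of `G` on all cochains. -/
def cochainRep (hu : ∀ (g : G) (a : A), u g * ι a = ι (g • a) * u g) :
    Representation K G (Cochains ι) where
  toFun g := DirectSum.lmap fun n => cochainAction hu n g
  map_one' := DirectSum.linearMap_ext K fun n => LinearMap.ext fun D => by
    simp only [LinearMap.comp_apply]
    rw [DirectSum.lmap_lof]
    refine congrArg (inC ι n) (Subtype.ext (LinearMap.ext fun x => ?_))
    change conj u 1 (D.1 (diag K A (n + 2) 1⁻¹ x)) = D.1 x
    rw [inv_one, diag_one, conj_one]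
  map_mul' g h := DirectSum.linearMap_ext K fun n => LinearMap.ext fun D => by
    simp only [LinearMap.comp_apply, Module.End.mul_apply]
    rw [DirectSum.lmap_lof, DirectSum.lmap_lof, DirectSum.lmap_lof]
    refine congrArg (inC ι n) (Subtype.ext (LinearMap.ext fun x => ?_))
    change conj u (g * h) (D.1 (diag K A (n + 2) (g * h)⁻¹ x)) =
      conj u g (conj u h (D.1 (diag K A (n + 2) h⁻¹ (diag K A (n + 2) g⁻¹ x))))
    rw [mul_inv_rev, diag_diag, conj_conj]

variable (ι) in
/-- The action of `G` on all chains. -/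
def chainRep (hu : ∀ (g : G) (a : A), u g * ι a = ι (g • a) * u g) :
    Representation K G (Chains ι) where
  toFun g := DirectSum.lmap fun n => chainAction hu n g
  map_one' := chains_ext fun n r a => by
    rw [sym, DirectSum.lmap_lof, chainAction, Chain.map_mk, TensorProduct.map_tmul, conj_one,
      diag_one]
    rfl
  map_mul' g h := chains_ext fun n r a => by
    rw [Module.End.mul_apply, sym, DirectSum.lmap_lof, DirectSum.lmap_lof, DirectSum.lmap_lof,
      chainAction, chainAction, chainAction, Chain.map_mk, Chain.map_mk, Chain.map_mk,
      TensorProduct.map_tmul, TensorProduct.map_tmul, TensorProduct.map_tmul, conj_conj, diag_diag]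

theorem cochainRep_in (hu : ∀ (g : G) (a : A), u g * ι a = ι (g • a) * u g) (g : G) (n : ℕ)
    (D : Cochain ι n) : cochainRep ι hu g (inC ι n D) = inC ι n (cochainAction hu n g D) :=
  DirectSum.lmap_lof _ _ _

theorem chainRep_sym (hu : ∀ (g : G) (a : A), u g * ι a = ι (g • a) * u g) (g : G) (n : ℕ)
    (r : R) (a : ℕ → A) :
    chainRep ι hu g (sym ι n r a) = sym ι n (conj (K := K) u g r) fun i => g • a i := by
  refine (DirectSum.lmap_lof _ _ _).trans ?_
  rw [chainAction, Chain.map_mk, TensorProduct.map_tmul, diag_tp]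
  rfl

variable (ι) in
/-- The action of `G` on the Hochschild cochain mixed complex. -/
def cochainComplexAction (hu : ∀ (g : G) (a : A), u g * ι a = ι (g • a) * u g) {W : A}
    (hW : ∀ a : A, a * W = W * a) (hM : ∀ r : R, r * ι W = ι W * r) (hG : ∀ g : G, g • W = W) :
    (cochainComplex ι W hW hM).Action G where
  ρ := cochainRep ι hu
  gr_mem g {n c} hc m hm := by
    change cochainAction hu m g (c m) = 0
    rw [hc m hm, map_zero]
  comm_b g c := by
    refine LinearMap.congr_fun (f := dHoch ι ∘ₗ cochainRep ι hu g) (g := cochainRep ι hu g ∘ₗ dHoch ι)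
      (DirectSum.linearMap_ext K fun n => LinearMap.ext fun D => ?_) c
    simp only [LinearMap.comp_apply]
    rw [cochainRep_in, dHoch_in, dHoch_in, cochainRep_in]
    refine congrArg (inC ι (n + 1)) (Subtype.ext (LinearMap.ext fun x => ?_))
    change (-1 : K) ^ n • conj u g (D.1 (diag K A (n + 2) g⁻¹ (δbar K (n + 1) x))) =
      conj u g ((-1 : K) ^ n • D.1 (δbar K (n + 1) (diag K A (n + 3) g⁻¹ x)))
    rw [δbar_diag, map_smul]
  comm_B g c := by
    refine LinearMap.congr_fun (f := dCurv ι W ∘ₗ cochainRep ι hu g)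
      (g := cochainRep ι hu g ∘ₗ dCurv ι W)
      (DirectSum.linearMap_ext K fun n => LinearMap.ext fun D => ?_) c
    simp only [LinearMap.comp_apply]
    rw [cochainRep_in]
    cases n with
    | zero => rw [dCurv_in_zero, dCurv_in_zero, map_zero]
    | succ n =>
      rw [dCurv_in_succ, dCurv_in_succ, cochainRep_in]
      refine congrArg (inC ι n) (Subtype.ext (LinearMap.ext fun x => ?_))
      change (-1 : K) ^ (n + 1) • conj u g (D.1 (diag K A (n + 3) g⁻¹ (δcurv K W (n + 1) x))) =
        conj u g ((-1 : K) ^ (n + 1) • D.1 (δcurv K W (n + 1) (diag K A (n + 2) g⁻¹ x)))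
      rw [δcurv_diag (hG _), map_smul]

variable (ι) in
/-- The action of `G` on the Hochschild chain mixed complex. -/
def chainComplexAction (hu : ∀ (g : G) (a : A), u g * ι a = ι (g • a) * u g) {W : A}
    (hW : ∀ a : A, a * W = W * a) (hM : ∀ r : R, r * ι W = ι W * r) (hG : ∀ g : G, g • W = W) :
    (chainComplex ι W hW hM).Action G where
  ρ := chainRep ι hu
  gr_mem g {n c} hc m hm := by
    change chainAction hu m g (c m) = 0
    rw [hc m hm, map_zero]
  comm_b g c := by
    refine LinearMap.congr_fun (f := bHoch ι ∘ₗ chainRep ι hu g) (g := chainRep ι hu g ∘ₗ bHoch ι)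
      (chains_ext fun n r a => ?_) c
    rw [LinearMap.comp_apply, LinearMap.comp_apply, chainRep_sym]
    cases n with
    | zero => rw [bHoch_sym_zero, bHoch_sym_zero, map_zero]
    | succ n =>
      rw [bHoch_sym_succ, bHoch_sym_succ, map_sum]
      refine Finset.sum_congr rfl fun i _ => ?_
      rw [map_smul, chainRep_sym]
      refine congrArg _ (sym_congr rfl _ fun j _ => ?_)
      simp only [faceSeq]; split_ifs <;> simp only [smul_mul']
  comm_B g c := by
    refine LinearMap.congr_fun (f := bCurv ι W ∘ₗ chainRep ι hu g)
      (g := chainRep ι hu g ∘ₗ bCurv ι W) (chains_ext fun n r a => ?_) c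
    rw [LinearMap.comp_apply, LinearMap.comp_apply, chainRep_sym, bCurv_sym, bCurv_sym, map_sum]
    refine Finset.sum_congr rfl fun i _ => ?_
    rw [map_smul, chainRep_sym]
    refine congrArg _ (sym_congr rfl _ fun j _ => ?_)
    simp only [insSeq]; split_ifs <;> simp only [hG]

theorem cupProd_equivariant (hu : ∀ (g : G) (a : A), u g * ι a = ι (g • a) * u g) (g : G)
    (c d : Cochains ι) :
    cupProd ι (cochainRep ι hu g c) (cochainRep ι hu g d) = cochainRep ι hu g (cupProd ι c d) := by
  refine LinearMap.congr_fun₂ (f := (cupProd ι).compl₁₂ (cochainRep ι hu g) (cochainRep ι hu g))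
    (g := (cupProd ι).compr₂ (cochainRep ι hu g))
    (DirectSum.linearMap_ext K fun p => LinearMap.ext fun D =>
      DirectSum.linearMap_ext K fun q => LinearMap.ext fun E => ?_) c d
  change cupProd ι (cochainRep ι hu g (inC ι p D)) (cochainRep ι hu g (inC ι q E)) =
    cochainRep ι hu g (cupProd ι (inC ι p D) (inC ι q E))
  rw [cochainRep_in, cochainRep_in, cupProd_in, cupProd_in, cochainRep_in]
  refine congrArg (inC ι (p + q)) (Subtype.ext (T_ext fun a => ?_))
  rw [cup_tp, cochainAction_tp, cochainAction_tp, cochainAction_tp, cup_tp, map_smul, conj_mul]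
  congr 3 <;> refine congrArg _ (tp_congr fun j _ => ?_)
  · simp only [leftSeq]; split_ifs <;> simp only [smul_one]
  · simp only [rightSeq]; split_ifs <;> simp only [smul_one]

theorem capProd_equivariant (hu : ∀ (g : G) (a : A), u g * ι a = ι (g • a) * u g) (g : G)
    (c : Chains ι) (d : Cochains ι) :
    capProd ι (chainRep ι hu g c) (cochainRep ι hu g d) = chainRep ι hu g (capProd ι c d) := by
  refine LinearMap.congr_fun₂ (f := (capProd ι).compl₁₂ (chainRep ι hu g) (cochainRep ι hu g))
    (g := (capProd ι).compr₂ (chainRep ι hu g))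
    (chains_ext fun n r a => DirectSum.linearMap_ext K fun p => LinearMap.ext fun D => ?_) c d
  change capProd ι (chainRep ι hu g (sym ι n r a)) (cochainRep ι hu g (inC ι p D)) =
    chainRep ι hu g (capProd ι (sym ι n r a) (inC ι p D))
  rw [cochainRep_in, chainRep_sym]
  rcases lt_or_ge n p with h | h
  · rw [capProd_sym_of_lt h, capProd_sym_of_lt h, map_zero]
  · obtain ⟨q, rfl⟩ := Nat.exists_eq_add_of_le h
    rw [capProd_sym (q := q) rfl, capProd_sym (q := q) rfl, map_smul, chainRep_sym,
      cochainAction_tp, conj_mul]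
    have e : tp K (p + 2) (fun i => g⁻¹ • leftSeq p (fun i => g • a i) i) =
        tp K (p + 2) (leftSeq p a) := tp_congr fun j _ => by
      simp only [leftSeq]; split_ifs <;> simp only [smul_one, inv_smul_smul]
    rw [e]
    refine congrArg _ (sym_congr rfl _ fun j _ => ?_)
    simp only [rightSeq]; split_ifs <;> simp only [smul_one]

end GroupAction

/-! ## The curved crossed product -/

section CrossedProduct

variable (K : Type u) {A : Type v} {G : Type w} [Field K] [Ring A] [Algebra K A] [Group G]
  [MulSemiringAction G A] [SMulCommClass G K A]

variable (A G) in
/-- The embedding `a ↦ a ⊗ 1` of `A` into the crossed product `A ⋊ G = ⨁_g A ⊗ g`, in which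
`(a ⊗ g)(b ⊗ h) = a g(b) ⊗ gh`. -/
def inl : A →ₐ[K] SkewMonoidAlgebra A G :=
  { (SkewMonoidAlgebra.singleOneRingHom : A →+* SkewMonoidAlgebra A G) with
    commutes' := fun _ => rfl }

theorem inl_apply (a : A) : inl K A G a = SkewMonoidAlgebra.single (1 : G) a := rfl

variable (A G) in
/-- The embedding `g ↦ 1 ⊗ g` of `G` into the crossed product. -/
def grp : G →* SkewMonoidAlgebra A G where
  toFun g := SkewMonoidAlgebra.single g 1
  map_one' := rfl
  map_mul' g h := by rw [SkewMonoidAlgebra.single_mul_single, smul_one, one_mul]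

theorem grp_mul_inl (g : G) (a : A) :
    grp A G g * inl K A G a = inl K A G (g • a) * grp A G g := by
  change SkewMonoidAlgebra.single g 1 * SkewMonoidAlgebra.single 1 a =
    SkewMonoidAlgebra.single 1 (g • a) * SkewMonoidAlgebra.single g 1
  rw [SkewMonoidAlgebra.single_mul_single, SkewMonoidAlgebra.single_mul_single, one_mul, mul_one,
    one_mul, one_smul, mul_one]

/-- Conjugation by `h` is `a ⊗ g ↦ h(a) ⊗ h g h⁻¹`. -/
theorem conj_single (h g : G) (a : A) :
    conj (K := K) (grp A G) h (SkewMonoidAlgebra.single g a) =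
      SkewMonoidAlgebra.single (h * g * h⁻¹) (h • a) := by
  change SkewMonoidAlgebra.single h 1 * (SkewMonoidAlgebra.single g a *
    SkewMonoidAlgebra.single h⁻¹ 1) = _
  rw [SkewMonoidAlgebra.single_mul_single, SkewMonoidAlgebra.single_mul_single, smul_one, mul_one,
    one_mul, mul_assoc]

/-- A central `G`-invariant element of `A` is central in the crossed product. -/
theorem inl_central {W : A} (hW : ∀ a : A, a * W = W * a) (hG : ∀ g : G, g • W = W)
    (x : SkewMonoidAlgebra A G) : x * inl K A G W = inl K A G W * x := by
  induction x using SkewMonoidAlgebra.induction_on with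
  | zero => rw [zero_mul, mul_zero]
  | single g a =>
    rw [inl_apply, SkewMonoidAlgebra.single_mul_single, SkewMonoidAlgebra.single_mul_single, hG,
      hW, one_smul, one_mul, mul_one]
  | add x y hx hy => rw [add_mul, mul_add, hx, hy]

variable (W : A) (hW : ∀ a : A, a * W = W * a) (hG : ∀ g : G, g • W = W)

/-- The Hochschild cochain mixed complex `HH^*(A ⋊ G, W)`. -/
abbrev crossedCochains : MixedComplex K (Cochains (AlgHom.id K (SkewMonoidAlgebra A G))) :=
  cochainComplex (AlgHom.id K _) (inl K A G W) (inl_central K hW hG) (inl_central K hW hG)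

/-- The Hochschild chain mixed complex `HH_*(A ⋊ G, W)`. -/
abbrev crossedChains : MixedComplex K (Chains (AlgHom.id K (SkewMonoidAlgebra A G))) :=
  chainComplex (AlgHom.id K _) (inl K A G W) (inl_central K hW hG) (inl_central K hW hG)

/-- The cup product on `HH^*(A ⋊ G, W)`. -/
abbrev crossedCup : MixedPairing (crossedCochains K W hW hG) (crossedCochains K W hW hG)
    (crossedCochains K W hW hG) :=
  cupPairing (AlgHom.id K _) (inl K A G W) (inl_central K hW hG) (inl_central K hW hG)

/-- The cap product of `HH_*(A ⋊ G, W)` and `HH^*(A ⋊ G, W)`. -/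
abbrev crossedCap : MixedPairing (crossedChains K W hW hG) (crossedCochains K W hW hG)
    (crossedChains K W hW hG) :=
  capPairing (AlgHom.id K _) (inl K A G W) (inl_central K hW hG) (inl_central K hW hG)

/-- The Hochschild cochain mixed complex `HH^*(A, W; A ⋊ G)`. -/
abbrev twistedCochains : MixedComplex K (Cochains (inl K A G)) :=
  cochainComplex (inl K A G) W hW (inl_central K hW hG)

/-- The Hochschild chain mixed complex `HH_*(A, W; A ⋊ G)`. -/
abbrev twistedChains : MixedComplex K (Chains (inl K A G)) :=
  chainComplex (inl K A G) W hW (inl_central K hW hG)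

/-- The action of `G` on `HH^*(A, W; A ⋊ G)`. -/
abbrev twistedCochainsAction : (twistedCochains K W hW hG).Action G :=
  cochainComplexAction (inl K A G) (grp_mul_inl K) hW (inl_central K hW hG) hG

/-- The action of `G` on `HH_*(A, W; A ⋊ G)`. -/
abbrev twistedChainsAction : (twistedChains K W hW hG).Action G :=
  chainComplexAction (inl K A G) (grp_mul_inl K) hW (inl_central K hW hG) hG

/-- The `G`-invariants of the periodic cohomology of `HH^*(A, W; A ⋊ G)`. -/
abbrev TwistedInv (n : ℤ) : Submodule K ((twistedCochains K W hW hG).H n) :=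
  ((twistedCochainsAction K W hW hG).onH n).invariants

/-- The `G`-coinvariants of the periodic cohomology of `HH_*(A, W; A ⋊ G)`. -/
abbrev TwistedCoinv (n : ℤ) : Type (max u v w) :=
  ((twistedChainsAction K W hW hG).onH n).Coinvariants

/-- The cup product on the `G`-invariants of the periodic cohomology of `HH^*(A, W; A ⋊ G)`. -/
abbrev twistedCup (p q : ℤ) : TwistedInv K W hW hG p →ₗ[K] TwistedInv K W hW hG q →ₗ[K]
    TwistedInv K W hW hG (p + q) :=
  MixedPairing.onInvariants (α := twistedCochainsAction K W hW hG)
    (β := twistedCochainsAction K W hW hG) (γ := twistedCochainsAction K W hW hG)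
    (cupPairing (inl K A G) W hW (inl_central K hW hG)) (cupProd_equivariant (grp_mul_inl K)) p q

/-- The cap product of the `G`-coinvariants of the periodic cohomology of `HH_*(A, W; A ⋊ G)` and
the `G`-invariants of the periodic cohomology of `HH^*(A, W; A ⋊ G)`. -/
abbrev twistedCap (p q : ℤ) : TwistedCoinv K W hW hG p →ₗ[K] TwistedInv K W hW hG q →ₗ[K]
    TwistedCoinv K W hW hG (p + q) :=
  MixedPairing.onCoinvariants (α := twistedChainsAction K W hW hG)
    (β := twistedCochainsAction K W hW hG) (γ := twistedChainsAction K W hW hG)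
    (capPairing (inl K A G) W hW (inl_central K hW hG)) (capProd_equivariant (grp_mul_inl K)) p q

end CrossedProduct

end

end CurvedHochschild

/-!
The crossed product `R = A ⋊ G` is compared with `A` through its matrix representation
`φ : R → Mat_G(A)`, where `φ(x)` has the coefficient at `1` of `g x h⁻¹` as its entry at `(g, h)`
(`toMatrix`). The generalised trace `x₁ ⊗ ⋯ ⊗ xₘ ↦ ∑ φ(x₁) ⊗ ⋯ ⊗ φ(xₘ)` (sum over paths in `G`,
`tr`) maps tensor powers of `R` to those of `A` and commutes with `δ_bar`, and also with `δ_curv`,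
because `φ(W)` is the scalar matrix `W`. Since `x` is recovered from any row or column of `φ(x)`,
averaging `u(g)⁻¹ (·) u(h)` against the trace extends cochains of `A` with values in `R` to cochains
of `R` (`extC`) and pushes chains of `R` forward to chains of `A` with values in `R` (`pushD`). Both
are morphisms of mixed complexes. In the other direction there are restriction of cochains (`resC`)
and inclusion of chains (`inclD`).

On the side of `A` both composites are the averaging operator of `G`. On the side of `R` they are
induced by one idempotent bimodule endomorphism of the bar resolution of `R` (`averageEndo`), which
is homotopic to the identity, because it covers the identity of `R` and the bar resolution is free
(`BarEndo.homotopy`). This homotopy is compatible with `δ_bar` only, but an idempotent endomorphism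
of a mixed complex which is `b`-homotopic to the identity acts as the identity on periodic
cohomology (`MixedComplex.onH_eq_self_of_homotopy`), because perturbations by
positive powers of `t` can be inverted by a geometric series. Hence the periodic cohomology for `R`
is both the invariants and the coinvariants of that for `A` (`AveragingPair`).

On cohomology the isomorphism is restriction, which is multiplicative already on cochains. On
homology the inverse isomorphism is the inclusion `j` of chains, and the cap product is handled by
the projection formula `j (c ∩ res D) = j c ∩ D`, which also holds on chains.
-/

namespace CurvedHochschild

noncomputable section

universe u v v₁ v₂ w

/-! ### Morphisms of mixed complexes and periodic cohomology -/

/-- A morphism of mixed complexes: a degree preserving linear map commuting with both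
differentials. -/
structure MixedHom {K : Type u} {C : Type v} {C' : Type w} [Field K] [AddCommGroup C] [Module K C]
    [AddCommGroup C'] [Module K C'] (X : MixedComplex K C) (Y : MixedComplex K C') where
  f : C →ₗ[K] C'
  gr_mem : ∀ {n : ℤ} {c : C}, c ∈ X.gr n → f c ∈ Y.gr n
  comm_b : ∀ c : C, Y.b (f c) = f (X.b c)
  comm_B : ∀ c : C, Y.B (f c) = f (X.B c)

namespace MixedHom

variable {K : Type u} {C : Type v} {C' : Type w} [Field K] [AddCommGroup C] [Module K C]
  [AddCommGroup C'] [Module K C'] {X : MixedComplex K C} {Y : MixedComplex K C'}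

/-- The map induced on periodic cohomology, coefficientwise on series. -/
def onH (φ : MixedHom X Y) (n : ℤ) : X.H n →ₗ[K] Y.H n :=
  perMap X Y (φ.f.compLeft ℤ) 0
    (fun n c hc => by
      obtain ⟨hc₀, hg⟩ := hc
      refine ⟨bnd_map φ.f hc₀, fun i => ?_⟩
      rw [add_zero]
      exact φ.gr_mem (hg i))
    (fun c => by ext i; simp [MixedComplex.perDiff_apply, φ.comm_b, φ.comm_B]) n n
    (add_zero n).symm

theorem onH_toH (φ : MixedHom X Y) (n : ℤ) (z : X.cocycles n) :
    ∃ h, φ.onH n (X.toH n z) = Y.toH n ⟨fun i => φ.f (z.1 i), h⟩ := ⟨_, rfl⟩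

theorem onH_tPow (φ : MixedHom X Y) (k n : ℤ) (x : X.H n) :
    φ.onH (n + 2 * k) (X.tPow k n x) = Y.tPow k n (φ.onH n x) := by
  obtain ⟨z, rfl⟩ := X.toH_surjective n x
  rfl

end MixedHom

namespace MixedComplex

variable {K : Type u} {C : Type v} [Field K] [AddCommGroup C] [Module K C]
variable (X : MixedComplex K C)

/-- The inverse of `1 + tu` on bounded below series: `z = (1 + tu)⁻¹ y` solves
`zᵢ + u zᵢ₋₁ = yᵢ`. -/
theorem exists_geometric (u : C →ₗ[K] C) {n : ℤ} (hu : ∀ {m : ℤ} {c : C}, c ∈ X.gr m →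
    u c ∈ X.gr (m - 2)) {y : ℤ → C} (hy : y ∈ X.laurent n) :
    ∃ z ∈ X.laurent n, ∀ i, z i + u (z (i - 1)) = y i := by
  obtain ⟨⟨i₀, h0⟩, hg⟩ := hy
  -- `w k` is the coefficient of `t ^ (i₀ + k)`
  let w : ℕ → C := fun k => Nat.rec (y i₀) (fun k c => y (i₀ + (k + 1 : ℕ)) - u c) k
  have hw : ∀ k : ℕ, w k ∈ X.gr (n - 2 * (i₀ + k)) := by
    intro k
    induction k with
    | zero => simpa [w] using hg i₀
    | succ k ih =>
      refine sub_mem (hg _) ?_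
      have := hu ih
      rwa [show n - 2 * (i₀ + k) - 2 = n - 2 * (i₀ + (k + 1 : ℕ)) by push_cast; ring] at this
  refine ⟨fun i => if i < i₀ then 0 else w (i - i₀).toNat, ⟨⟨i₀, fun i hi => if_pos hi⟩,
    fun i => ?_⟩, fun i => ?_⟩
  · by_cases hi : i < i₀
    · simp [hi]
    · simp only [hi, if_false]
      have := hw (i - i₀).toNat
      rwa [show i₀ + ((i - i₀).toNat : ℤ) = i by omega] at this
  · rcases lt_trichotomy i i₀ with hi | rfl | hi
    · simp [hi, h0 i hi, show i - 1 < i₀ by omega]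
    · simp [w]
    · obtain ⟨k, rfl⟩ : ∃ k : ℕ, i = i₀ + (k + 1 : ℕ) := ⟨(i - i₀ - 1).toNat, by omega⟩
      have e1 : (i₀ + ((k + 1 : ℕ) : ℤ) - i₀).toNat = k + 1 := by omega
      have e2 : (i₀ + ((k + 1 : ℕ) : ℤ) - 1 - i₀).toNat = k := by omega
      simp only [e1, e2, show ¬ i₀ + ((k + 1 : ℕ) : ℤ) < i₀ by omega,
        show ¬ i₀ + ((k + 1 : ℕ) : ℤ) - 1 < i₀ by omega, if_false]
      exact sub_add_cancel _ _

/-- A bounded below series killed by `1 + tu` vanishes. -/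
theorem eq_zero_of_geometric (u : C →ₗ[K] C) {z : ℤ → C} (hz : ∃ i₀ : ℤ, ∀ i < i₀, z i = 0)
    (h : ∀ i, z i + u (z (i - 1)) = 0) : z = 0 := by
  obtain ⟨i₀, h0⟩ := hz
  have key : ∀ k : ℕ, ∀ i < i₀ + k, z i = 0 := by
    intro k
    induction k with
    | zero => simpa using h0
    | succ k ih =>
      intro i hi
      have := h i
      rwa [ih (i - 1) (by push_cast at hi; omega), map_zero, add_zero] at this
  exact funext fun i => key ((i - i₀).toNat + 1) i (by push_cast; omega)

variable {X}

/-- If an idempotent endomorphism `p` of a mixed complex is `b`-homotopic to the identity, then it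
acts as the identity on periodic cohomology. The homotopy `h` need not be compatible with `B`: after
replacing it by `(1 - p) h (1 - p)`, its graded commutator with `b + tB` is `1 - p + tu` where
`u = [B, h]`, and `1 + tu` is invertible on Laurent series. -/
theorem onH_eq_self_of_homotopy (p : MixedHom X X) (hp : ∀ c, p.f (p.f c) = p.f c)
    (h : C →ₗ[K] C) (h_mem : ∀ {n : ℤ} {c : C}, c ∈ X.gr n → h c ∈ X.gr (n - 1))
    (hb : ∀ c, X.b (h c) + h (X.b c) = c - p.f c) (n : ℤ) (x : X.H n) : p.onH n x = x := by
  obtain ⟨⟨x, hx⟩, rfl⟩ := X.toH_surjective n x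
  -- the compression of the homotopy to the complement of the image of `p`
  let q : C →ₗ[K] C := LinearMap.id - p.f
  have qdef : ∀ c, q c = c - p.f c := fun c => rfl
  have q_mem : ∀ {m : ℤ} {c : C}, c ∈ X.gr m → q c ∈ X.gr m := fun hc =>
    sub_mem hc (p.gr_mem hc)
  have qq : ∀ c, q (q c) = q c := fun c => by simp [qdef, hp]
  have qb : ∀ c, X.b (q c) = q (X.b c) := fun c => by simp [qdef, p.comm_b]
  have qB : ∀ c, X.B (q c) = q (X.B c) := fun c => by simp [qdef, p.comm_B]
  let h' : C →ₗ[K] C := q ∘ₗ h ∘ₗ q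
  have h'def : ∀ c, h' c = q (h (q c)) := fun c => rfl
  have h'_mem : ∀ {m : ℤ} {c : C}, c ∈ X.gr m → h' c ∈ X.gr (m - 1) := fun hc =>
    q_mem (h_mem (q_mem hc))
  have hb' : ∀ c, X.b (h' c) + h' (X.b c) = q c := fun c => by
    rw [h'def, h'def, qb, ← qb c, ← map_add, hb, ← qdef, qq, qq]
  let u : C →ₗ[K] C := X.B ∘ₗ h' + h' ∘ₗ X.B
  have udef : ∀ c, u c = X.B (h' c) + h' (X.B c) := fun c => rfl
  have u_mem : ∀ {m : ℤ} {c : C}, c ∈ X.gr m → u c ∈ X.gr (m - 2) := fun {m c} hc => by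
    refine add_mem ?_ ?_
    · have := X.B_mem (h'_mem hc)
      rwa [show m - 1 - 1 = m - 2 by ring] at this
    · have := h'_mem (X.B_mem hc)
      rwa [show m - 1 - 1 = m - 2 by ring] at this
  have uB : ∀ c, X.B (u c) = u (X.B c) := fun c => by simp [udef, X.B_B]
  have ub : ∀ c, X.b (u c) = u (X.b c) := fun c => by
    have e1 := X.b_B (h' c)
    have e2 := hb' (X.B c)
    have e3 := congrArg X.B (hb' c)
    have e4 := X.b_B c
    rw [map_add, qB] at e3
    rw [udef, udef, map_add, eq_neg_of_add_eq_zero_left e1, eq_sub_of_add_eq e2,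
      eq_neg_of_add_eq_zero_left e4, map_neg, ← e3]
    abel
  -- `y = x - p x` is a cocycle in the image of `q`
  have hxd : ∀ i, X.b (x i) + X.B (x (i - 1)) = 0 := fun i => congrFun hx.2 i
  have hy : (fun i => q (x i)) ∈ X.laurent n := ⟨bnd_map q hx.1.1, fun i => q_mem (hx.1.2 i)⟩
  obtain ⟨z, hz, hzy⟩ := X.exists_geometric u (fun hc => u_mem hc) hy
  have hqz : (fun i => p.f (z i)) = 0 := by
    refine eq_zero_of_geometric u (bnd_map p.f hz.1) fun i => ?_
    have e := congrArg p.f (hzy i)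
    have pq : ∀ c, p.f (q c) = 0 := fun c => by simp [qdef, hp]
    have qp : ∀ c, q (p.f c) = 0 := fun c => by simp [qdef, hp]
    have pu : ∀ c, p.f (u c) = 0 := fun c => by
      rw [udef, map_add, h'def, h'def, qB, pq, pq, add_zero]
    have up : ∀ c, u (p.f c) = 0 := fun c => by
      rw [udef, h'def, h'def, p.comm_B, qp, qp]; simp
    rw [map_add, pu, pq, add_zero] at e
    rw [e, up, add_zero]
  have hdz : X.perDiff z = 0 := by
    refine eq_zero_of_geometric u (X.perDiff_mem hz).1 fun i => ?_
    have e1 := congrArg X.b (hzy i)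
    have e2 := congrArg X.B (hzy (i - 1))
    rw [map_add, ub] at e1
    rw [map_add, uB] at e2
    have e3 := congrArg q (hxd i)
    rw [map_add, ← qb, ← qB, map_zero, ← e1, ← e2] at e3
    rw [perDiff_apply, perDiff_apply, map_add, ← e3]
    abel
  refine Eq.symm (sub_eq_zero.1 ?_)
  obtain ⟨hpx, e⟩ := p.onH_toH n ⟨x, hx⟩
  rw [e, ← map_sub, X.toH_eq_zero]
  refine ⟨fun i => h' (z i), ⟨bnd_map h' hz.1, fun i => ?_⟩, funext fun i => ?_⟩
  · have := h'_mem (hz.2 i)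
    rwa [show n - 2 * i - 1 = n - 1 - 2 * i by ring] at this
  · have e1 := hb' (z i)
    have e2 := udef (z (i - 1))
    have e3 := hzy i
    have e4 := congrArg h' (congrFun hdz i)
    have e5 : q (z i) = z i := by rw [qdef, show p.f (z i) = 0 from congrFun hqz i, sub_zero]
    rw [perDiff_apply, map_add, Pi.zero_apply, map_zero] at e4
    rw [e5] at e1
    change X.b (h' (z i)) + X.B (h' (z (i - 1))) = q (x i)
    rw [← e3, e2, eq_sub_of_add_eq e1, eq_neg_of_add_eq_zero_left e4]
    abel

end MixedComplex

/-! ### Averaging over a finite group -/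

section Average

variable {K : Type u} {C : Type v} {C' : Type w} [Field K] [AddCommGroup C] [Module K C]
  [AddCommGroup C'] [Module K C'] {X : MixedComplex K C} {Y : MixedComplex K C'}
  {G : Type v₁} [Group G] [Fintype G]

/-- Morphisms `f : X → Y` and `e : Y → X` of mixed complexes which identify the periodic cohomology
of `X` with the invariants, and with the coinvariants, of a finite group `G` acting on that of `Y`:
`f ∘ e` is the averaging operator of `G`, and `e ∘ f` is idempotent and `b`-homotopic to the
identity. -/
structure AveragingPair (X : MixedComplex K C) {Y : MixedComplex K C'} (α : Y.Action G) where
  f : MixedHom X Y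
  e : MixedHom Y X
  f_e : ∀ c, f.f (e.f c) = (Fintype.card G : K)⁻¹ • ∑ g : G, α.ρ g c
  e_f_idem : ∀ c, e.f (f.f (e.f (f.f c))) = e.f (f.f c)
  h : C →ₗ[K] C
  h_mem : ∀ {n : ℤ} {c : C}, c ∈ X.gr n → h c ∈ X.gr (n - 1)
  homotopy : ∀ c, X.b (h c) + h (X.b c) = c - e.f (f.f c)

namespace AveragingPair

variable {α : Y.Action G} (P : AveragingPair X α)

theorem f_e_onH (n : ℤ) (y : Y.H n) :
    P.f.onH n (P.e.onH n y) = (Fintype.card G : K)⁻¹ • ∑ g : G, α.onH n g y := by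
  obtain ⟨z, rfl⟩ := Y.toH_surjective n y
  have hs : ∀ g : G, ∃ w : Y.cocycles n, α.onH n g (Y.toH n z) = Y.toH n w ∧
      ∀ i, w.1 i = α.ρ g (z.1 i) := fun g => by
    obtain ⟨h, e⟩ := α.onH_toH n g z
    exact ⟨_, e, fun i => rfl⟩
  choose w hw hw' using hs
  simp only [hw]
  rw [← map_sum, ← map_smul]
  refine congrArg (Y.toH n) (Subtype.ext (funext fun i => ?_))
  change P.f.f (P.e.f (z.1 i)) = _
  rw [P.f_e]
  simp [← hw', Finset.sum_apply]

theorem card_ne_zero [CharZero K] (G : Type v₁) [Group G] [Fintype G] : (Fintype.card G : K) ≠ 0 :=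
  Nat.cast_ne_zero.2 Fintype.card_ne_zero

theorem e_f_onH (n : ℤ) (x : X.H n) : P.e.onH n (P.f.onH n x) = x := by
  let p : MixedHom X X :=
    { f := P.e.f ∘ₗ P.f.f
      gr_mem := fun hc => P.e.gr_mem (P.f.gr_mem hc)
      comm_b := fun c => by simp [P.e.comm_b, P.f.comm_b]
      comm_B := fun c => by simp [P.e.comm_B, P.f.comm_B] }
  have h := MixedComplex.onH_eq_self_of_homotopy p P.e_f_idem P.h P.h_mem P.homotopy n x
  obtain ⟨z, rfl⟩ := X.toH_surjective n x
  exact h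

theorem e_onH_ρ (n : ℤ) (g : G) (y : Y.H n) : P.e.onH n (α.onH n g y) = P.e.onH n y := by
  rw [← P.e_f_onH n (P.e.onH n y), ← P.e_f_onH n (P.e.onH n (α.onH n g y)), P.f_e_onH, P.f_e_onH]
  congr 2
  refine Fintype.sum_equiv (Equiv.mulRight g) _ _ fun k => ?_
  rw [Equiv.coe_mulRight, map_mul]
  rfl

theorem onH_f_invariant (n : ℤ) (x : X.H n) : P.f.onH n x ∈ (α.onH n).invariants := fun g => by
  have h := P.f_e_onH n (P.f.onH n x)
  rw [P.e_f_onH] at h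
  rw [h, map_smul, map_sum]
  congr 1
  refine Fintype.sum_equiv (Equiv.mulLeft g) _ _ fun k => ?_
  rw [Equiv.coe_mulLeft, map_mul]
  rfl

variable [CharZero K]

/-- The isomorphism of the periodic cohomology of `X` with the invariants of that of `Y`. -/
def equivInvariants (n : ℤ) : X.H n ≃ₗ[K] (α.onH n).invariants where
  __ := (P.f.onH n).codRestrict _ (P.onH_f_invariant n)
  invFun y := P.e.onH n y
  left_inv x := P.e_f_onH n x
  right_inv y := Subtype.ext <| by
    refine (P.f_e_onH n y).trans ?_
    rw [Finset.sum_congr rfl fun g _ => y.2 g, Finset.sum_const, Finset.card_univ,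
      ← Nat.cast_smul_eq_nsmul K, smul_smul, inv_mul_cancel₀ (card_ne_zero G), one_smul]

/-- The isomorphism of the periodic cohomology of `X` with the coinvariants of that of `Y`. -/
def equivCoinvariants (n : ℤ) : X.H n ≃ₗ[K] (α.onH n).Coinvariants where
  __ := Representation.Coinvariants.mk (α.onH n) ∘ₗ P.f.onH n
  invFun := Representation.Coinvariants.lift (α.onH n) (P.e.onH n) fun g =>
    LinearMap.ext fun y => P.e_onH_ρ n g y
  left_inv x := P.e_f_onH n x
  right_inv y := by
    obtain ⟨y, rfl⟩ := Representation.Coinvariants.mk_surjective _ y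
    change Representation.Coinvariants.mk (α.onH n) (P.f.onH n (P.e.onH n y)) = _
    rw [P.f_e_onH, map_smul, map_sum, Finset.sum_congr rfl fun g _ =>
      Representation.Coinvariants.mk_self_apply (α.onH n) g y, Finset.sum_const, Finset.card_univ,
      ← Nat.cast_smul_eq_nsmul K, smul_smul, inv_mul_cancel₀ (card_ne_zero G), one_smul]

end AveragingPair

end Average

/-! ### Linear maps out of tensor powers, by recursion on the first factor -/

section LiftCons

variable {K : Type u} {A : Type v} [Field K] [Ring A] [Algebra K A]
  {N : Type w} [AddCommGroup N] [Module K N]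

/-- The linear map `b ⊗ t ↦ β b t` on `A ⊗ A^{⊗ m}`. -/
def liftCons {m : ℕ} (β : A →ₗ[K] T K A m →ₗ[K] N) : T K A (m + 1) →ₗ[K] N :=
  PiTensorProduct.lift (LinearMap.uncurryLeft (M := fun _ : Fin (m + 1) => A)
    (PiTensorProduct.lift.symm.toLinearMap ∘ₗ β))

theorem consT_tprod (b : A) (m : ℕ) (x : Fin m → A) :
    consT (K := K) b m (PiTensorProduct.tprod K x) = PiTensorProduct.tprod K (Fin.cons b x) :=
  PiTensorProduct.lift.tprod _

theorem liftCons_consT {m : ℕ} (β : A →ₗ[K] T K A m →ₗ[K] N) (b : A) (t : T K A m) :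
    liftCons β (consT b m t) = β b t := by
  refine LinearMap.congr_fun (f := liftCons β ∘ₗ consT b m) (g := β b)
    (PiTensorProduct.ext (MultilinearMap.ext fun x => ?_)) t
  change liftCons β (consT b m (PiTensorProduct.tprod K x)) = β b (PiTensorProduct.tprod K x)
  rw [consT_tprod]
  exact PiTensorProduct.lift.tprod _

variable (K A) in
/-- `consT` as a bilinear map. -/
def consHom (m : ℕ) : A →ₗ[K] T K A m →ₗ[K] T K A (m + 1) :=
  PiTensorProduct.lift.toLinearMap ∘ₗ
    (PiTensorProduct.tprod K (s := fun _ : Fin (m + 1) => A)).curryLeft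

theorem consHom_apply (m : ℕ) (b : A) (t : T K A m) : consHom K A m b t = consT b m t := rfl

theorem consT_add (b c : A) (m : ℕ) (t : T K A m) :
    consT (b + c) m t = consT b m t + consT c m t := by
  simp only [← consHom_apply, map_add, LinearMap.add_apply]

theorem consT_smul (k : K) (b : A) (m : ℕ) (t : T K A m) :
    consT (k • b) m t = k • consT b m t := by
  simp only [← consHom_apply, map_smul, LinearMap.smul_apply]

theorem consT_zero (m : ℕ) (t : T K A m) : consT (0 : A) m t = 0 := by
  simp only [← consHom_apply, map_zero, LinearMap.zero_apply]

theorem consT_sum {J : Type*} (s : Finset J) (b : J → A) (m : ℕ) (t : T K A m) :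
    consT (∑ j ∈ s, b j) m t = ∑ j ∈ s, consT (b j) m t := by
  simp only [← consHom_apply, map_sum, LinearMap.sum_apply]

variable (K A) in
/-- `lmul` as a bilinear map. -/
def lmulHom (m : ℕ) : A →ₗ[K] T K A (m + 1) →ₗ[K] T K A (m + 1) where
  toFun b := lmul K m b
  map_add' b c := T_ext_cons fun d t => by
    simp only [LinearMap.add_apply, lmul_consT, add_mul, consT_add]
  map_smul' k b := T_ext_cons fun d t => by
    simp only [LinearMap.smul_apply, lmul_consT, smul_mul_assoc, consT_smul, RingHom.id_apply]

theorem lmulHom_apply (m : ℕ) (b : A) (t : T K A (m + 1)) : lmulHom K A m b t = lmul K m b t := rfl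

theorem lmul_sum {J : Type*} (s : Finset J) (b : J → A) (m : ℕ) (t : T K A (m + 1)) :
    lmul K m (∑ j ∈ s, b j) t = ∑ j ∈ s, lmul K m (b j) t := by
  simp only [← lmulHom_apply, map_sum, LinearMap.sum_apply]

theorem lmul_one (m : ℕ) (t : T K A (m + 1)) : lmul K m (1 : A) t = t := by
  refine LinearMap.congr_fun (f := lmul K m (1 : A)) (g := LinearMap.id)
    (T_ext_cons fun c t => ?_) t
  rw [lmul_consT, one_mul, LinearMap.id_apply]

theorem rmul_zero_consT (b c : A) (t : T K A 0) :
    rmul K 0 b (consT c 0 t) = consT (c * b) 0 t := by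
  refine lin_ext (f := rmul K 0 b ∘ₗ consT c 0) (g := consT (c * b) 0) (fun a => ?_) t
  rw [LinearMap.comp_apply, consT_tp, consT_tp, rmul_tp]
  refine tp_congr fun i hi => ?_
  obtain rfl : i = 0 := by omega
  simp [rmulSeq, consSeq]

theorem rmul_rmul (b c : A) (m : ℕ) (t : T K A (m + 1)) :
    rmul K m b (rmul K m c t) = rmul K m (c * b) t := by
  refine lin_ext (f := rmul K m b ∘ₗ rmul K m c) (g := rmul K m (c * b)) (fun a => ?_) t
  rw [LinearMap.comp_apply, rmul_tp, rmul_tp, rmul_tp]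
  refine tp_congr fun i _ => ?_
  simp only [rmulSeq]; split_ifs <;> simp [mul_assoc]

variable (K A) in
/-- `rmul` as a bilinear map. -/
def rmulHom (m : ℕ) : A →ₗ[K] T K A (m + 1) →ₗ[K] T K A (m + 1) where
  toFun b := rmul K m b
  map_add' b c := by
    induction m with
    | zero =>
      refine T_ext_cons fun d t => ?_
      simp only [LinearMap.add_apply, rmul_zero_consT, mul_add, consT_add]
    | succ m ih =>
      refine T_ext_cons fun d t => ?_
      simp only [LinearMap.add_apply, rmul_consT, ih, map_add]
  map_smul' k b := by
    induction m with
    | zero =>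
      refine T_ext_cons fun d t => ?_
      simp only [LinearMap.smul_apply, rmul_zero_consT, mul_smul_comm, consT_smul,
        RingHom.id_apply]
    | succ m ih =>
      refine T_ext_cons fun d t => ?_
      simp only [LinearMap.smul_apply, rmul_consT, ih, map_smul]

theorem rmulHom_apply (m : ℕ) (b : A) (t : T K A (m + 1)) : rmulHom K A m b t = rmul K m b t := rfl

theorem rmul_sum {J : Type*} (s : Finset J) (b : J → A) (m : ℕ) (t : T K A (m + 1)) :
    rmul K m (∑ j ∈ s, b j) t = ∑ j ∈ s, rmul K m (b j) t := by
  simp only [← rmulHom_apply, map_sum, LinearMap.sum_apply]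

theorem δbar_consT_one (m : ℕ) (t : T K A (m + 2)) :
    δbar K (m + 1) (consT 1 (m + 2) t) = t - consT 1 (m + 1) (δbar K m t) := by
  rw [δbar_consT, lmul_one]

end LiftCons

/-! ### Chain endomorphisms of the bar resolution over the identity -/

section Homotopy

variable {K : Type u} {A : Type v} [Field K] [Ring A] [Algebra K A]

/-- A bimodule endomorphism of the augmented bar resolution
`⋯ → A ⊗ A ⊗ A → A ⊗ A → A` which is the identity on `A`. -/
structure BarEndo (K : Type u) (A : Type v) [Field K] [Ring A] [Algebra K A] where
  P : ∀ m : ℕ, T K A (m + 1) →ₗ[K] T K A (m + 1)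
  P_zero : P 0 = LinearMap.id
  P_lmul : ∀ (m : ℕ) (a : A) (t : T K A (m + 1)), P m (lmul K m a t) = lmul K m a (P m t)
  P_rmul : ∀ (m : ℕ) (a : A) (t : T K A (m + 1)), P m (rmul K m a t) = rmul K m a (P m t)
  P_δbar : ∀ (m : ℕ) (t : T K A (m + 2)), P m (δbar K m t) = δbar K m (P (m + 1) t)

namespace BarEndo

variable (E : BarEndo K A)

/-- A homotopy from `P` to the identity, built degree by degree from the contraction
`t ↦ 1 ⊗ t` of the augmented bar resolution:
`h (b ⊗ t) = b • (1 ⊗ (1 ⊗ t - P (1 ⊗ t) - h δ (1 ⊗ t)))`. -/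
def h : ∀ m : ℕ, T K A (m + 1) →ₗ[K] T K A (m + 2)
  | 0 => 0
  | m + 1 => liftCons ((LinearMap.lcomp K _ (consT 1 (m + 2) ∘ₗ
      (LinearMap.id - E.P (m + 1) - h m ∘ₗ δbar K m) ∘ₗ consT 1 (m + 1))) ∘ₗ lmulHom K A (m + 2))

theorem h_succ_consT (m : ℕ) (b : A) (t : T K A (m + 1)) : E.h (m + 1) (consT b (m + 1) t) =
    lmul K (m + 2) b (consT 1 (m + 2) (consT 1 (m + 1) t - E.P (m + 1) (consT 1 (m + 1) t) -
      E.h m (δbar K m (consT 1 (m + 1) t)))) := by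
  rw [h, liftCons_consT]
  rfl

theorem h_lmul (m : ℕ) (a : A) (t : T K A (m + 1)) :
    E.h m (lmul K m a t) = lmul K (m + 1) a (E.h m t) := by
  cases m with
  | zero => simp [h]
  | succ m =>
    refine LinearMap.congr_fun (f := E.h (m + 1) ∘ₗ lmul K (m + 1) a)
      (g := lmul K (m + 2) a ∘ₗ E.h (m + 1)) (T_ext_cons fun c t => ?_) t
    rw [LinearMap.comp_apply, LinearMap.comp_apply, lmul_consT, h_succ_consT, h_succ_consT,
      lmul_lmul]

theorem h_rmul (m : ℕ) (a : A) (t : T K A (m + 1)) :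
    E.h m (rmul K m a t) = rmul K (m + 1) a (E.h m t) := by
  induction m with
  | zero => simp [h]
  | succ m ih =>
    refine LinearMap.congr_fun (f := E.h (m + 1) ∘ₗ rmul K (m + 1) a)
      (g := rmul K (m + 2) a ∘ₗ E.h (m + 1)) (T_ext_cons fun c t => ?_) t
    have e : consT (1 : A) (m + 1) (rmul K m a t) = rmul K (m + 1) a (consT 1 (m + 1) t) :=
      (rmul_consT _ _ _ _).symm
    rw [LinearMap.comp_apply, LinearMap.comp_apply, rmul_consT, h_succ_consT, h_succ_consT,
      ← lmul_rmul, e, E.P_rmul, δbar_rmul, ih, ← map_sub, ← map_sub,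
      rmul_consT]

theorem homotopy (m : ℕ) (t : T K A (m + 2)) :
    δbar K (m + 1) (E.h (m + 1) t) + E.h m (δbar K m t) = t - E.P (m + 1) t := by
  -- it suffices to treat `1 ⊗ t`, on which the recursion and `δ (1 ⊗ x) = x - 1 ⊗ δ x` apply
  have step : ∀ m : ℕ, (∀ t : T K A (m + 1), δbar K m (consT 1 (m + 1) t -
      E.P (m + 1) (consT 1 (m + 1) t) - E.h m (δbar K m (consT 1 (m + 1) t))) = 0) →
      ∀ t : T K A (m + 2),
        δbar K (m + 1) (E.h (m + 1) t) + E.h m (δbar K m t) = t - E.P (m + 1) t := by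
    intro m hm t
    refine LinearMap.congr_fun (f := δbar K (m + 1) ∘ₗ E.h (m + 1) + E.h m ∘ₗ δbar K m)
      (g := LinearMap.id - E.P (m + 1)) (T_ext_cons fun b t => ?_) t
    have hb : consT b (m + 1) t = lmul K (m + 1) b (consT 1 (m + 1) t) := by
      rw [lmul_consT, mul_one]
    simp only [LinearMap.add_apply, LinearMap.comp_apply, LinearMap.sub_apply, LinearMap.id_apply]
    rw [h_succ_consT, δbar_lmul, δbar_consT_one, hm, map_zero, sub_zero, hb, δbar_lmul, h_lmul,
      E.P_lmul, ← map_add, ← map_sub, sub_add_cancel]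
  induction m with
  | zero =>
    refine step 0 (fun t => ?_) t
    rw [map_sub, map_sub, ← E.P_δbar, E.P_zero, LinearMap.id_apply, sub_self, zero_sub]
    simp [h]
  | succ m ih =>
    refine step (m + 1) (fun t => ?_) t
    have := ih (δbar K (m + 1) (consT 1 (m + 2) t))
    rw [δbar_δbar, map_zero, add_zero] at this
    rw [map_sub, map_sub, ← E.P_δbar, this, sub_self]

end BarEndo

end Homotopy

/-! ### The generalised trace -/

section Trace

variable {K : Type u} {A : Type v} {R : Type w} {I : Type v₁} [Field K] [Ring A] [Algebra K A]
  [Ring R] [Algebra K R] [Fintype I] [DecidableEq I] (φ : R →ₐ[K] Matrix I I A)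

variable (K) in
/-- The coefficient `φ(x)ᵢⱼ` of a matrix representation of `R` over `A`, as a linear map. -/
def entry (i j : I) : R →ₗ[K] A where
  toFun x := φ x i j
  map_add' x y := by simp
  map_smul' k x := by simp

/-- The generalised trace attached to a matrix representation `φ` of `R` over `A`:
`x₁ ⊗ ⋯ ⊗ xₘ ↦ ∑ φ(x₁)ᵢₖ ⊗ φ(x₂)ₖₗ ⊗ ⋯ ⊗ φ(xₘ)ₛⱼ`, the sum over all paths from `i` to `j`. -/
def tr : ∀ (m : ℕ), I → I → T K R m →ₗ[K] T K A m
  | 0, i, j => if i = j then PiTensorProduct.map fun _ => entry K φ i j else 0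
  | m + 1, i, j => liftCons (∑ k : I,
      LinearMap.compl₂ (consHom K A m ∘ₗ entry K φ i k) (tr m k j))

theorem tr_consT (m : ℕ) (i j : I) (x : R) (t : T K R m) :
    tr φ (m + 1) i j (consT x m t) = ∑ k : I, consT (φ x i k) m (tr φ m k j t) := by
  rw [tr, liftCons_consT]
  simp only [LinearMap.sum_apply]
  rfl

theorem tr_zero_of_ne {i j : I} (h : i ≠ j) (t : T K R 0) : tr φ 0 i j t = 0 := by
  rw [tr, if_neg h]; rfl

theorem tr_zero_self (i j : I) (t : T K R 0) : tr φ 0 i i t = tr φ 0 j j t := by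
  rw [tr, tr, if_pos rfl, if_pos rfl]
  congr 2
  exact Subsingleton.elim _ _

theorem tr_zero_comp (i j k : I) (a : A) (t : T K R 0) :
    consT a 0 (tr φ 0 k j t) = if k = j then consT a 0 (tr φ 0 i i t) else 0 := by
  split_ifs with h
  · rw [h, tr_zero_self φ j i]
  · rw [tr_zero_of_ne φ h, map_zero]

theorem tr_one_consT (i j : I) (x : R) (t : T K R 0) :
    tr φ 1 i j (consT x 0 t) = consT (φ x i j) 0 (tr φ 0 i i t) := by
  rw [tr_consT]
  simp [tr_zero_comp φ i j]

theorem tr_lmul (m : ℕ) (i j : I) (y : R) (t : T K R (m + 1)) :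
    tr φ (m + 1) i j (lmul K m y t) = ∑ l : I, lmul K m (φ y i l) (tr φ (m + 1) l j t) := by
  refine LinearMap.congr_fun (f := tr φ (m + 1) i j ∘ₗ lmul K m y)
    (g := ∑ l : I, lmul K m (φ y i l) ∘ₗ tr φ (m + 1) l j) (T_ext_cons fun x t => ?_) t |>.trans
    (by simp [LinearMap.sum_apply])
  simp only [LinearMap.comp_apply, LinearMap.sum_apply, lmul_consT, tr_consT, map_sum, map_mul,
    Matrix.mul_apply, consT_sum]
  exact Finset.sum_comm

theorem tr_rmul (m : ℕ) (i j : I) (y : R) (t : T K R (m + 1)) :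
    tr φ (m + 1) i j (rmul K m y t) = ∑ l : I, rmul K m (φ y l j) (tr φ (m + 1) i l t) := by
  induction m generalizing i with
  | zero =>
    refine LinearMap.congr_fun (f := tr φ 1 i j ∘ₗ rmul K 0 y)
      (g := ∑ l : I, rmul K 0 (φ y l j) ∘ₗ tr φ 1 i l) (T_ext_cons fun x t => ?_) t |>.trans
      (by simp [LinearMap.sum_apply])
    have h : ∀ (l : I) (x : R), tr φ (0 + 1) i l (consT x 0 t) =
      consT (φ x i l) 0 (tr φ 0 i i t) := fun l x => tr_one_consT φ i l x t
    simp only [LinearMap.comp_apply, LinearMap.sum_apply, rmul_zero_consT, h, map_mul,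
      Matrix.mul_apply, consT_sum]
  | succ m ih =>
    refine LinearMap.congr_fun (f := tr φ (m + 2) i j ∘ₗ rmul K (m + 1) y)
      (g := ∑ l : I, rmul K (m + 1) (φ y l j) ∘ₗ tr φ (m + 2) i l)
      (T_ext_cons fun x t => ?_) t |>.trans (by simp [LinearMap.sum_apply])
    simp only [LinearMap.comp_apply, LinearMap.sum_apply, rmul_consT, tr_consT, map_sum, ih]
    exact Finset.sum_comm

theorem tr_δbar (m : ℕ) (i j : I) (t : T K R (m + 2)) :
    tr φ (m + 1) i j (δbar K m t) = δbar K m (tr φ (m + 2) i j t) := by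
  induction m generalizing i with
  | zero =>
    refine LinearMap.congr_fun (f := tr φ 1 i j ∘ₗ δbar K 0)
      (g := δbar K 0 ∘ₗ tr φ 2 i j) (T_ext_cons fun x t => ?_) t
    rw [LinearMap.comp_apply, LinearMap.comp_apply, δbar_zero_consT, tr_lmul, tr_consT, map_sum]
    exact Finset.sum_congr rfl fun k _ => (δbar_zero_consT _ _).symm
  | succ m ih =>
    refine LinearMap.congr_fun (f := tr φ (m + 2) i j ∘ₗ δbar K (m + 1))
      (g := δbar K (m + 1) ∘ₗ tr φ (m + 3) i j) (T_ext_cons fun x t => ?_) t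
    rw [LinearMap.comp_apply, LinearMap.comp_apply, δbar_consT, map_sub, tr_lmul, tr_consT,
      tr_consT, map_sum, ← Finset.sum_sub_distrib]
    exact Finset.sum_congr rfl fun k _ => by rw [δbar_consT, ih]

theorem tr_δcurv {V : R} {W : A} (hV : φ V = Matrix.diagonal fun _ => W) (m : ℕ) (i j : I)
    (t : T K R (m + 1)) :
    tr φ (m + 2) i j (δcurv K V m t) = δcurv K W m (tr φ (m + 1) i j t) := by
  induction m generalizing i with
  | zero => simp [δcurv_zero]
  | succ m ih =>
    refine LinearMap.congr_fun (f := tr φ (m + 3) i j ∘ₗ δcurv K V (m + 1))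
      (g := δcurv K W (m + 1) ∘ₗ tr φ (m + 2) i j) (T_ext_cons fun x t => ?_) t
    have hW : ∀ k : I, tr φ (m + 2) k j (consT V (m + 1) t) =
        consT W (m + 1) (tr φ (m + 1) k j t) := fun k => by
      rw [tr_consT, Finset.sum_eq_single k (fun l _ hl => by
        rw [hV, Matrix.diagonal_apply_ne _ hl.symm, consT_zero]) (by simp), hV,
        Matrix.diagonal_apply_eq]
    rw [LinearMap.comp_apply, LinearMap.comp_apply, δcurv_consT, map_sub, tr_consT, tr_consT,
      tr_consT, map_sum, ← Finset.sum_sub_distrib]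
    exact Finset.sum_congr rfl fun k _ => by rw [δcurv_consT, ih, hW]

end Trace

/-! ### Functoriality of the bar resolution -/

section Incl

variable {K : Type u} {A : Type v} {R : Type w} [Field K] [Ring A] [Algebra K A]
  [Ring R] [Algebra K R] (ι : A →ₐ[K] R)

/-- The map of tensor powers induced by an algebra map. -/
def incl (m : ℕ) : T K A m →ₗ[K] T K R m := PiTensorProduct.map fun _ => ι.toLinearMap

theorem incl_tp (m : ℕ) (a : ℕ → A) : incl ι m (tp K m a) = tp K m fun i => ι (a i) := by
  unfold incl tp
  rw [PiTensorProduct.map_tprod]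
  rfl

theorem incl_consT (m : ℕ) (b : A) (t : T K A m) :
    incl ι (m + 1) (consT b m t) = consT (ι b) m (incl ι m t) := by
  refine lin_ext (f := incl ι (m + 1) ∘ₗ consT b m) (g := consT (ι b) m ∘ₗ incl ι m)
    (fun a => ?_) t
  rw [LinearMap.comp_apply, LinearMap.comp_apply, consT_tp, incl_tp, incl_tp, consT_tp]
  exact tp_congr fun i _ => by simp only [consSeq]; split_ifs <;> rfl

theorem incl_lmul (m : ℕ) (b : A) (t : T K A (m + 1)) :
    incl ι (m + 1) (lmul K m b t) = lmul K m (ι b) (incl ι (m + 1) t) := by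
  refine lin_ext (f := incl ι (m + 1) ∘ₗ lmul K m b) (g := lmul K m (ι b) ∘ₗ incl ι (m + 1))
    (fun a => ?_) t
  rw [LinearMap.comp_apply, LinearMap.comp_apply, lmul_tp, incl_tp, incl_tp, lmul_tp]
  exact tp_congr fun i _ => by simp only [lmulSeq]; split_ifs <;> simp only [map_mul]

theorem incl_rmul (m : ℕ) (b : A) (t : T K A (m + 1)) :
    incl ι (m + 1) (rmul K m b t) = rmul K m (ι b) (incl ι (m + 1) t) := by
  refine lin_ext (f := incl ι (m + 1) ∘ₗ rmul K m b) (g := rmul K m (ι b) ∘ₗ incl ι (m + 1))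
    (fun a => ?_) t
  rw [LinearMap.comp_apply, LinearMap.comp_apply, rmul_tp, incl_tp, incl_tp, rmul_tp]
  exact tp_congr fun i _ => by simp only [rmulSeq]; split_ifs <;> simp only [map_mul]

theorem incl_δbar (m : ℕ) (t : T K A (m + 2)) :
    incl ι (m + 1) (δbar K m t) = δbar K m (incl ι (m + 2) t) := by
  refine lin_ext (f := incl ι (m + 1) ∘ₗ δbar K m) (g := δbar K m ∘ₗ incl ι (m + 2))
    (fun a => ?_) t
  rw [LinearMap.comp_apply, LinearMap.comp_apply, incl_tp, δbar_tp, δbar_tp, map_sum]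
  refine Finset.sum_congr rfl fun i _ => ?_
  rw [map_smul, incl_tp]
  congr 1
  exact tp_congr fun i _ => by simp only [faceSeq]; split_ifs <;> simp only [map_mul]

theorem incl_δcurv (W : A) (m : ℕ) (t : T K A (m + 1)) :
    incl ι (m + 2) (δcurv K W m t) = δcurv K (ι W) m (incl ι (m + 1) t) := by
  refine lin_ext (f := incl ι (m + 2) ∘ₗ δcurv K W m) (g := δcurv K (ι W) m ∘ₗ incl ι (m + 1))
    (fun a => ?_) t
  rw [LinearMap.comp_apply, LinearMap.comp_apply, incl_tp, δcurv_tp, δcurv_tp, map_sum]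
  refine Finset.sum_congr rfl fun i _ => ?_
  rw [map_smul, incl_tp]
  congr 1
  exact tp_congr fun i _ => by simp only [insSeq]; split_ifs <;> rfl

end Incl

/-! ### Constructing maps of Hochschild mixed complexes degree by degree -/

section CochainMaps

variable {K : Type u} {A : Type v} {R : Type w} {A' : Type v₁} {R' : Type v₂} [Field K]
  [Ring A] [Algebra K A] [Ring R] [Algebra K R] [Ring A'] [Algebra K A'] [Ring R'] [Algebra K R']
  {ι : A →ₐ[K] R} {ι' : A' →ₐ[K] R'}

/-- A morphism of Hochschild cochain mixed complexes from its components. -/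
def cochainHom {W : A} (hW : ∀ a : A, a * W = W * a) (hM : ∀ r : R, r * ι W = ι W * r)
    {W' : A'} (hW' : ∀ a : A', a * W' = W' * a) (hM' : ∀ r : R', r * ι' W' = ι' W' * r)
    (F : ∀ n, Cochain ι n →ₗ[K] Cochain ι' n)
    (hb : ∀ n D, cobar ι' n (F n D) = F (n + 1) (cobar ι n D))
    (hB : ∀ n D, cocurv ι' W' n (F (n + 1) D) = F n (cocurv ι W n D)) :
    MixedHom (cochainComplex ι W hW hM) (cochainComplex ι' W' hW' hM') where
  f := DirectSum.lmap F
  gr_mem {n c} hc m hm := by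
    change F m (c m) = 0
    rw [hc m hm, map_zero]
  comm_b c := by
    refine LinearMap.congr_fun (f := dHoch ι' ∘ₗ DirectSum.lmap F)
      (g := DirectSum.lmap F ∘ₗ dHoch ι)
      (DirectSum.linearMap_ext K fun n => LinearMap.ext fun D => ?_) c
    simp only [LinearMap.comp_apply]
    rw [DirectSum.lmap_lof, dHoch_in, dHoch_in, DirectSum.lmap_lof, hb]
  comm_B c := by
    refine LinearMap.congr_fun (f := dCurv ι' W' ∘ₗ DirectSum.lmap F)
      (g := DirectSum.lmap F ∘ₗ dCurv ι W)
      (DirectSum.linearMap_ext K fun n => LinearMap.ext fun D => ?_) c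
    simp only [LinearMap.comp_apply]
    rw [DirectSum.lmap_lof]
    cases n with
    | zero => rw [dCurv_in_zero, dCurv_in_zero, map_zero]
    | succ n => rw [dCurv_in_succ, dCurv_in_succ, DirectSum.lmap_lof, hB]

/-- A linear map on chains from a linear map on `M ⊗ B₋ₙ(A)` respecting the relations. -/
def Chain.lift {N : Type*} [AddCommGroup N] [Module K N] {n : ℕ}
    (f : R ⊗[K] T K A (n + 2) →ₗ[K] N) (hf : ∀ (a₀ a₁ : A) (r : R) (x : T K A (n + 2)),
      f ((ι a₀ * r * ι a₁) ⊗ₜ[K] x) = f (r ⊗ₜ[K] lmul K (n + 1) a₁ (rmul K (n + 1) a₀ x))) :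
    Chain ι n →ₗ[K] N :=
  Submodule.liftQ _ f (by
    refine Submodule.span_le.2 ?_
    rintro _ ⟨a₀, a₁, r, x, rfl⟩
    exact (map_sub f _ _).trans (sub_eq_zero.2 (hf a₀ a₁ r x)))

theorem Chain.mk_lmul (n : ℕ) (a : A) (r : R) (x : T K A (n + 2)) :
    Chain.mk ι n (r ⊗ₜ[K] lmul K (n + 1) a x) = Chain.mk ι n ((r * ι a) ⊗ₜ[K] x) := by
  have h := Chain.mk_rel (ι := ι) n 1 a r x
  have e : rmul K (n + 1) (1 : A) x = x := by
    refine lin_ext (f := rmul K (n + 1) (1 : A)) (g := LinearMap.id) (fun b => ?_) x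
    rw [rmul_tp]
    exact tp_congr fun i _ => by simp [rmulSeq]
  rw [map_one, one_mul, e] at h
  exact h.symm

theorem Chain.mk_rmul (n : ℕ) (a : A) (r : R) (x : T K A (n + 2)) :
    Chain.mk ι n (r ⊗ₜ[K] rmul K (n + 1) a x) = Chain.mk ι n ((ι a * r) ⊗ₜ[K] x) := by
  have h := Chain.mk_rel (ι := ι) n a 1 r x
  rw [map_one, mul_one, lmul_one] at h
  exact h.symm

theorem Chain.hom_ext {n : ℕ} {N : Type*} [AddCommGroup N] [Module K N] {f g : Chain ι n →ₗ[K] N}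
    (h : ∀ (r : R) (x : T K A (n + 2)), f (Chain.mk ι n (r ⊗ₜ[K] x)) =
      g (Chain.mk ι n (r ⊗ₜ[K] x))) : f = g :=
  Chain.linearMap_ext fun r _ => h r _

theorem chainBar_mk (n : ℕ) (r : R) (x : T K A (n + 3)) :
    chainBar ι n (Chain.mk ι (n + 1) (r ⊗ₜ[K] x)) = Chain.mk ι n (r ⊗ₜ[K] δbar K (n + 1) x) := rfl

theorem chainCurv_mk (W : A) (n : ℕ) (r : R) (x : T K A (n + 2)) :
    chainCurv ι W n (Chain.mk ι n (r ⊗ₜ[K] x)) =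
      Chain.mk ι (n + 1) (r ⊗ₜ[K] δcurv K W (n + 1) x) := rfl

/-- A morphism of Hochschild chain mixed complexes from its components. -/
def chainHom {W : A} (hW : ∀ a : A, a * W = W * a) (hM : ∀ r : R, r * ι W = ι W * r)
    {W' : A'} (hW' : ∀ a : A', a * W' = W' * a) (hM' : ∀ r : R', r * ι' W' = ι' W' * r)
    (F : ∀ n, Chain ι n →ₗ[K] Chain ι' n)
    (hb : ∀ n x, chainBar ι' n (F (n + 1) x) = F n (chainBar ι n x))
    (hB : ∀ n x, chainCurv ι' W' n (F n x) = F (n + 1) (chainCurv ι W n x)) :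
    MixedHom (chainComplex ι W hW hM) (chainComplex ι' W' hW' hM') where
  f := DirectSum.lmap F
  gr_mem {n c} hc m hm := by
    change F m (c m) = 0
    rw [hc m hm, map_zero]
  comm_b c := by
    refine LinearMap.congr_fun (f := bHoch ι' ∘ₗ DirectSum.lmap F)
      (g := DirectSum.lmap F ∘ₗ bHoch ι)
      (DirectSum.linearMap_ext K fun n => LinearMap.ext fun x => ?_) c
    simp only [LinearMap.comp_apply]
    rw [DirectSum.lmap_lof]
    cases n with
    | zero => rw [bHoch_in_zero, bHoch_in_zero, map_zero]
    | succ n => rw [bHoch_in_succ, bHoch_in_succ, DirectSum.lmap_lof, hb]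
  comm_B c := by
    refine LinearMap.congr_fun (f := bCurv ι' W' ∘ₗ DirectSum.lmap F)
      (g := DirectSum.lmap F ∘ₗ bCurv ι W)
      (DirectSum.linearMap_ext K fun n => LinearMap.ext fun x => ?_) c
    simp only [LinearMap.comp_apply]
    rw [DirectSum.lmap_lof, bCurv_in, bCurv_in, DirectSum.lmap_lof, hB]

end CochainMaps

/-! ### The homotopies on Hochschild cochains and chains -/

namespace BarEndo

variable {K : Type u} {A : Type v} {R : Type w} [Field K] [Ring A] [Algebra K A] [Ring R]
  [Algebra K R] (ι : A →ₐ[K] R) (E : BarEndo K A)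

/-- The map `D ↦ (-1)ⁿ D ∘ h` from `(n + 1)`-cochains to `n`-cochains. -/
def cochainH (n : ℕ) : Cochain ι (n + 1) →ₗ[K] Cochain ι n where
  toFun D := ⟨(-1 : K) ^ n • D.1 ∘ₗ E.h (n + 1), fun a x => by
    simp only [LinearMap.smul_apply, LinearMap.comp_apply, h_lmul, h_rmul, (D.2 a _).1,
      (D.2 a _).2, mul_smul_comm, smul_mul_assoc, and_self]⟩
  map_add' D E := Subtype.ext (LinearMap.ext fun x => smul_add (_ : K) (D.1 _) (E.1 _))
  map_smul' c D := Subtype.ext (LinearMap.ext fun x => smul_comm (_ : K) c (D.1 _))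

/-- The homotopy dual to `h` on all cochains. -/
def cochainsH : Cochains ι →ₗ[K] Cochains ι :=
  DirectSum.toModule K ℕ _ fun
    | 0 => 0
    | n + 1 => inC ι n ∘ₗ E.cochainH ι n

theorem cochainsH_in_zero (D : Cochain ι 0) : E.cochainsH ι (inC ι 0 D) = 0 :=
  DirectSum.toModule_lof _ _ _

theorem cochainsH_in_succ (n : ℕ) (D : Cochain ι (n + 1)) :
    E.cochainsH ι (inC ι (n + 1) D) = inC ι n (E.cochainH ι n D) :=
  DirectSum.toModule_lof _ _ _

theorem cochainsH_mem {k : ℤ} {c : Cochains ι}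
    (hc : c ∈ grBy K (fun n => Cochain ι n) (fun n => (n : ℤ)) k) :
    E.cochainsH ι c ∈ grBy K (fun n => Cochain ι n) (fun n => (n : ℤ)) (k - 1) := by
  obtain rfl | ⟨n, D, rfl, rfl⟩ := grBy_cases Nat.cast_injective hc
  · rw [map_zero]; exact zero_mem _
  · cases n with
    | zero => rw [cochainsH_in_zero]; exact zero_mem _
    | succ n => rw [cochainsH_in_succ]; exact lof_mem_grBy' _ _ _ (by push_cast; ring)

theorem cochains_homotopy (p : Cochains ι →ₗ[K] Cochains ι) (p' : ∀ n, Cochain ι n → Cochain ι n)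
    (hp : ∀ n D, p (inC ι n D) = inC ι n (p' n D))
    (hp' : ∀ n D x, (p' n D).1 x = D.1 (E.P (n + 1) x)) (c : Cochains ι) :
    dHoch ι (E.cochainsH ι c) + E.cochainsH ι (dHoch ι c) = c - p c := by
  refine LinearMap.congr_fun (f := dHoch ι ∘ₗ E.cochainsH ι + E.cochainsH ι ∘ₗ dHoch ι)
    (g := LinearMap.id - p) (DirectSum.linearMap_ext K fun n => LinearMap.ext fun D => ?_) c
  simp only [LinearMap.comp_apply, LinearMap.add_apply, LinearMap.sub_apply, LinearMap.id_apply]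
  rw [dHoch_in, cochainsH_in_succ, hp, ← map_sub]
  cases n with
  | zero =>
    rw [cochainsH_in_zero, map_zero, zero_add]
    refine congrArg (inC ι 0) (Subtype.ext (LinearMap.ext fun x => ?_))
    change (-1 : K) ^ 0 • (-1 : K) ^ 0 • D.1 (δbar K 1 (E.h 1 x)) = D.1 x - (p' 0 D).1 x
    have e := E.homotopy 0 x
    rw [show E.h 0 = 0 from rfl, LinearMap.zero_apply, add_zero] at e
    rw [hp', ← map_sub, e, pow_zero, one_smul, one_smul]
  | succ n =>
    rw [cochainsH_in_succ, dHoch_in, ← map_add]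
    refine congrArg (inC ι (n + 1)) (Subtype.ext (LinearMap.ext fun x => ?_))
    change (-1 : K) ^ n • (-1 : K) ^ n • D.1 (E.h (n + 1) (δbar K (n + 1) x)) +
      (-1 : K) ^ (n + 1) • (-1 : K) ^ (n + 1) • D.1 (δbar K (n + 2) (E.h (n + 2) x)) =
        D.1 x - (p' (n + 1) D).1 x
    rw [hp', ← map_sub, ← E.homotopy (n + 1) x, smul_smul, smul_smul, sgn_sq, sgn_sq, one_smul,
      one_smul, map_add, add_comm]

/-- The map `m ⊗ x ↦ m ⊗ h x` from `n`-chains to `(n + 1)`-chains. -/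
def chainH (n : ℕ) : Chain ι n →ₗ[K] Chain ι (n + 1) :=
  Chain.map ι (LinearMap.lTensor R (E.h (n + 1))) fun a₀ a₁ r x => by
    rw [LinearMap.lTensor_tmul, LinearMap.lTensor_tmul, h_lmul, h_rmul]
    exact mem_chainRel _ _ _ _ _

theorem chainH_mk (n : ℕ) (r : R) (x : T K A (n + 2)) :
    E.chainH ι n (Chain.mk ι n (r ⊗ₜ[K] x)) = Chain.mk ι (n + 1) (r ⊗ₜ[K] E.h (n + 1) x) := rfl

/-- The homotopy `1 ⊗ h` on all chains. -/
def chainsH : Chains ι →ₗ[K] Chains ι :=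
  DirectSum.toModule K ℕ _ fun n => inD ι (n + 1) ∘ₗ E.chainH ι n

theorem chainsH_in (n : ℕ) (x : Chain ι n) :
    E.chainsH ι (inD ι n x) = inD ι (n + 1) (E.chainH ι n x) :=
  DirectSum.toModule_lof _ _ _

theorem chainsH_mem {k : ℤ} {c : Chains ι}
    (hc : c ∈ grBy K (fun n => Chain ι n) (fun n => -(n : ℤ)) k) :
    E.chainsH ι c ∈ grBy K (fun n => Chain ι n) (fun n => -(n : ℤ)) (k - 1) := by
  obtain rfl | ⟨n, D, rfl, rfl⟩ := grBy_cases neg_cast_injective hc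
  · rw [map_zero]; exact zero_mem _
  · rw [chainsH_in]; exact lof_mem_grBy' _ _ _ (by push_cast; ring)

theorem chains_homotopy (p : Chains ι →ₗ[K] Chains ι)
    (hp : ∀ n r x, p (inD ι n (Chain.mk ι n (r ⊗ₜ[K] x))) =
      inD ι n (Chain.mk ι n (r ⊗ₜ[K] E.P (n + 1) x))) (c : Chains ι) :
    bHoch ι (E.chainsH ι c) + E.chainsH ι (bHoch ι c) = c - p c := by
  refine LinearMap.congr_fun (f := bHoch ι ∘ₗ E.chainsH ι + E.chainsH ι ∘ₗ bHoch ι)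
    (g := LinearMap.id - p) (DirectSum.linearMap_ext K fun n => Chain.hom_ext fun r x => ?_) c
  simp only [LinearMap.comp_apply, LinearMap.add_apply, LinearMap.sub_apply, LinearMap.id_apply]
  rw [chainsH_in, bHoch_in_succ, hp, ← map_sub, ← map_sub, ← TensorProduct.tmul_sub,
    ← E.homotopy n x, chainH_mk, chainBar_mk]
  cases n with
  | zero =>
    rw [bHoch_in_zero, map_zero, add_zero, show E.h 0 = 0 from rfl, LinearMap.zero_apply, add_zero]
  | succ n =>
    rw [bHoch_in_succ, chainsH_in, chainBar_mk, chainH_mk, ← map_add, ← map_add,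
      TensorProduct.tmul_add]

end BarEndo

/-! ### The matrix representation of the crossed product -/

section Crossed

variable (K : Type u) {A : Type v} {G : Type w} [Field K] [Ring A] [Algebra K A] [Group G]
  [MulSemiringAction G A] [SMulCommClass G K A]

theorem diag_consT (m : ℕ) (g : G) (b : A) (t : T K A m) :
    diag K A (m + 1) g (consT b m t) = consT (g • b) m (diag K A m g t) := by
  refine lin_ext (f := diag K A (m + 1) g ∘ₗ consT b m) (g := consT (g • b) m ∘ₗ diag K A m g)
    (fun a => ?_) t
  rw [LinearMap.comp_apply, LinearMap.comp_apply, consT_tp, diag_tp, diag_tp, consT_tp]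
  exact tp_congr fun i _ => by simp only [consSeq]; split_ifs <;> rfl

variable [Fintype G] [DecidableEq G]

variable (A G) in
/-- The matrix representation of the crossed product over `A`: the entry at `(g, h)` of `x` is the
coefficient at `1` of `g x h⁻¹`, so that `a ⊗ k` has the entry `g(a)` at `(g, g k)`. -/
def toMatrix : SkewMonoidAlgebra A G →ₐ[K] Matrix G G A :=
  AlgHom.ofLinearMap
    { toFun := fun x => Matrix.of fun g h => g • x.coeff (g⁻¹ * h)
      map_add' := fun x y => by ext g h; simp
      map_smul' := fun k x => by ext g h; simp [smul_comm] }
    (by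
      ext g h
      change g • (1 : SkewMonoidAlgebra A G).coeff (g⁻¹ * h) = (1 : Matrix G G A) g h
      by_cases e : g = h
      · subst e; simp
      · have e' : ¬ g⁻¹ * h = 1 := fun e' => e (inv_mul_eq_one.1 e')
        rw [Matrix.one_apply_ne e, SkewMonoidAlgebra.coeff_one, Finsupp.single_apply,
          if_neg (Ne.symm e'), smul_zero])
    (fun x y => by
      ext g h
      change g • (x * y).coeff (g⁻¹ * h) =
        ∑ k : G, (g • x.coeff (g⁻¹ * k)) * (k • y.coeff (k⁻¹ * h))
      induction x using SkewMonoidAlgebra.induction_on with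
      | zero => simp
      | add x x' hx hx' => simp [add_mul, hx, hx', Finset.sum_add_distrib]
      | single k a =>
        induction y using SkewMonoidAlgebra.induction_on with
        | zero => simp
        | add y y' hy hy' =>
          simp only [mul_add, SkewMonoidAlgebra.coeff_add, Finsupp.add_apply, smul_add,
            Finset.sum_add_distrib, hy, hy']
        | single l b =>
          rw [SkewMonoidAlgebra.single_mul_single, Finset.sum_eq_single (g * k)]
          · simp only [SkewMonoidAlgebra.coeff_single, Finsupp.single_apply,
              inv_mul_cancel_left, if_true]
            by_cases e : k * l = g⁻¹ * h
            · rw [if_pos e, if_pos (by rw [mul_inv_rev, mul_assoc, ← e, inv_mul_cancel_left]),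
                smul_mul', mul_smul]
            · rw [if_neg e, if_neg (fun e' => e (by rw [e']; group)), smul_zero, smul_zero,
                mul_zero]
          · intro m _ hm
            rw [SkewMonoidAlgebra.coeff_single, Finsupp.single_apply,
              if_neg (fun e => hm (by rw [e, mul_inv_cancel_left])), smul_zero, zero_mul]
          · simp)

theorem toMatrix_apply (x : SkewMonoidAlgebra A G) (g h : G) :
    toMatrix K A G x g h = g • x.coeff (g⁻¹ * h) := rfl

theorem toMatrix_single (k : G) (a : A) (g h : G) :
    toMatrix K A G (SkewMonoidAlgebra.single k a) g h = if g * k = h then g • a else 0 := by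
  rw [toMatrix_apply, SkewMonoidAlgebra.coeff_single, Finsupp.single_apply]
  by_cases e : g * k = h
  · rw [if_pos e, if_pos (by rw [← e, inv_mul_cancel_left])]
  · rw [if_neg e, if_neg (fun e' => e (by rw [e', mul_inv_cancel_left])), smul_zero]

theorem toMatrix_inl (a : A) : toMatrix K A G (inl K A G a) = Matrix.diagonal fun g => g • a := by
  ext g h
  rw [inl_apply, toMatrix_single, mul_one, Matrix.diagonal_apply]

theorem smul_toMatrix (k : G) (x : SkewMonoidAlgebra A G) (g h : G) :
    k • toMatrix K A G x g h = toMatrix K A G x (k * g) (k * h) := by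
  rw [toMatrix_apply, toMatrix_apply, mul_smul, mul_inv_rev, mul_assoc, inv_mul_cancel_left]

/-- An element of the crossed product is recovered from a column of its matrix. -/
theorem sum_grp_mul_toMatrix (x : SkewMonoidAlgebra A G) (h : G) :
    ∑ g : G, grp A G g⁻¹ * inl K A G (toMatrix K A G x g h) = x * grp A G h⁻¹ := by
  induction x using SkewMonoidAlgebra.induction_on with
  | zero => simp
  | add x y hx hy => simp [mul_add, add_mul, Finset.sum_add_distrib, hx, hy]
  | single k a =>
    rw [Finset.sum_eq_single (h * k⁻¹)]
    · rw [toMatrix_single, if_pos (by group)]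
      change SkewMonoidAlgebra.single _ 1 * SkewMonoidAlgebra.single 1 _ =
        SkewMonoidAlgebra.single k a * SkewMonoidAlgebra.single h⁻¹ 1
      rw [SkewMonoidAlgebra.single_mul_single, SkewMonoidAlgebra.single_mul_single, one_mul,
        inv_smul_smul, smul_one, mul_one, mul_one, mul_inv_rev, inv_inv]
    · intro g _ hg
      rw [toMatrix_single, if_neg (fun e => hg (by rw [← e]; group)), map_zero, mul_zero]
    · simp

/-- An element of the crossed product is recovered from a row of its matrix. -/
theorem sum_toMatrix_mul_grp (x : SkewMonoidAlgebra A G) (g : G) :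
    ∑ h : G, inl K A G (toMatrix K A G x g h) * grp A G h = grp A G g * x := by
  induction x using SkewMonoidAlgebra.induction_on with
  | zero => simp
  | add x y hx hy => simp [mul_add, add_mul, Finset.sum_add_distrib, hx, hy]
  | single k a =>
    rw [Finset.sum_eq_single (g * k)]
    · rw [toMatrix_single, if_pos rfl]
      change SkewMonoidAlgebra.single 1 _ * SkewMonoidAlgebra.single _ 1 =
        SkewMonoidAlgebra.single g 1 * SkewMonoidAlgebra.single k a
      rw [SkewMonoidAlgebra.single_mul_single, SkewMonoidAlgebra.single_mul_single, one_mul,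
        one_mul, smul_one, mul_one]
    · intro h _ hg
      rw [toMatrix_single, if_neg (fun e => hg e.symm), map_zero, zero_mul]
    · simp

variable (A G) in
/-- The generalised trace of the matrix representation of the crossed product. -/
abbrev trG (m : ℕ) (g h : G) : T K (SkewMonoidAlgebra A G) m →ₗ[K] T K A m :=
  tr (toMatrix K A G) m g h

/-- On tensors with factors in `A`, the generalised trace is the diagonal action. -/
theorem trG_incl (m : ℕ) (g h : G) (t : T K A m) :
    trG K A G m g h (incl (inl K A G) m t) = if g = h then diag K A m g t else 0 := by
  induction m generalizing g with
  | zero =>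
    split_ifs with e
    · subst e
      refine lin_ext (f := trG K A G 0 g g ∘ₗ incl (inl K A G) 0) (g := diag K A 0 g)
        (fun a => ?_) t
      rw [LinearMap.comp_apply, incl_tp, diag_tp, trG, tr, if_pos rfl]
      refine (PiTensorProduct.map_tprod _ _).trans (congrArg _ (funext fun i => i.elim0))
    · exact tr_zero_of_ne _ e _
  | succ m ih =>
    have key : ∀ (b : A) (t : T K A m),
        trG K A G (m + 1) g h (incl (inl K A G) (m + 1) (consT b m t)) =
          if g = h then diag K A (m + 1) g (consT b m t) else 0 := by
      intro b t
      rw [incl_consT, trG, tr_consT, toMatrix_inl, Finset.sum_eq_single g (fun k _ hk => by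
        rw [Matrix.diagonal_apply_ne _ hk.symm, consT_zero]) (by simp), Matrix.diagonal_apply_eq]
      have := ih g t
      rw [trG] at this
      rw [this]
      split_ifs
      · rw [diag_consT]
      · rw [map_zero]
    split_ifs with e
    · refine LinearMap.congr_fun (f := trG K A G (m + 1) g h ∘ₗ incl (inl K A G) (m + 1))
        (g := diag K A (m + 1) g) (T_ext_cons fun b t => ?_) t
      exact (key b t).trans (if_pos e)
    · refine LinearMap.congr_fun (f := trG K A G (m + 1) g h ∘ₗ incl (inl K A G) (m + 1))
        (g := 0) (T_ext_cons fun b t => ?_) t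
      exact (key b t).trans (if_neg e)

theorem diag_trG (m : ℕ) (k g h : G) (t : T K (SkewMonoidAlgebra A G) m) :
    diag K A m k (trG K A G m g h t) = trG K A G m (k * g) (k * h) t := by
  induction m generalizing g with
  | zero =>
    by_cases e : g = h
    · subst e
      refine lin_ext (f := diag K A 0 k ∘ₗ trG K A G 0 g g) (g := trG K A G 0 (k * g) (k * g))
        (fun a => ?_) t
      have e' : ∀ g, trG K A G 0 g g (tp K 0 a) = tp K 0 fun _ => 0 := fun g => by
        rw [trG, tr, if_pos rfl]
        exact (PiTensorProduct.map_tprod _ _).trans (congrArg _ (funext fun i => i.elim0))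
      rw [LinearMap.comp_apply, e', e', diag_tp]
      exact tp_congr fun i hi => absurd hi (by omega)
    · rw [trG, trG, tr_zero_of_ne _ e, tr_zero_of_ne _ (fun e' => e (mul_left_cancel e')), map_zero]
  | succ m ih =>
    refine LinearMap.congr_fun (f := diag K A (m + 1) k ∘ₗ trG K A G (m + 1) g h)
      (g := trG K A G (m + 1) (k * g) (k * h)) (T_ext_cons fun x t => ?_) t
    rw [LinearMap.comp_apply, trG, trG, tr_consT, tr_consT, map_sum]
    refine Fintype.sum_equiv (Equiv.mulLeft k) _ _ fun l => ?_
    rw [diag_consT, smul_toMatrix, ih, Equiv.coe_mulLeft]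

end Crossed

/-! ### Comparison of the crossed product with its coefficient algebra -/

section Comparison

variable (K : Type u) {A : Type v} {G : Type w} [Field K] [Ring A] [Algebra K A] [Group G]
  [MulSemiringAction G A] [SMulCommClass G K A]

section Restriction

variable {R : Type v₁} [Ring R] [Algebra K R]

variable {K} in
/-- Restriction of `n`-cochains of `R` along an algebra map `A → R`. -/
def resC (ι : A →ₐ[K] R) (n : ℕ) : Cochain (AlgHom.id K R) n →ₗ[K] Cochain ι n where
  toFun D := ⟨D.1 ∘ₗ incl ι (n + 2), fun a x => by
    rw [LinearMap.comp_apply, LinearMap.comp_apply, LinearMap.comp_apply, incl_lmul, incl_rmul]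
    exact D.2 (ι a) _⟩
  map_add' _ _ := rfl
  map_smul' _ _ := rfl

variable {K} in
theorem Cochain.ext {ι : A →ₐ[K] R} {n : ℕ} {D E : Cochain ι n} (h : ∀ x, D.1 x = E.1 x) : D = E :=
  Subtype.ext (LinearMap.ext h)

variable {K} in
theorem Cochain.smul_apply {ι : A →ₐ[K] R} {n : ℕ} (k : K) (D : Cochain ι n) (x : T K A (n + 2)) :
    (k • D).1 x = k • D.1 x := rfl

variable {K} in
theorem resC_apply (ι : A →ₐ[K] R) (n : ℕ) (D : Cochain (AlgHom.id K R) n) (x : T K A (n + 2)) :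
    (resC ι n D).1 x = D.1 (incl ι (n + 2) x) := rfl

variable {K} in
theorem Cochain.sum_apply {ι : A →ₐ[K] R} {n : ℕ} {J : Type*} (s : Finset J) (D : J → Cochain ι n)
    (x : T K A (n + 2)) : (∑ j ∈ s, D j).1 x = ∑ j ∈ s, (D j).1 x :=
  map_sum (LinearMap.applyₗ x ∘ₗ (cochainSubmodule ι n).subtype) _ _

variable {K} in
/-- The map of `n`-chains induced by an algebra map `A → R`. -/
def inclD (ι : A →ₐ[K] R) (n : ℕ) : Chain ι n →ₗ[K] Chain (AlgHom.id K R) n :=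
  Chain.lift (Chain.mk (AlgHom.id K R) n ∘ₗ LinearMap.lTensor R (incl ι (n + 2)))
    fun a₀ a₁ r x => by
      simp only [LinearMap.comp_apply, LinearMap.lTensor_tmul]
      rw [incl_lmul, incl_rmul]
      exact Chain.mk_rel n (ι a₀) (ι a₁) r _

end Restriction

theorem cochainAction_apply (n : ℕ) (g : G) (D : Cochain (inl K A G) n) (x : T K A (n + 2)) :
    (cochainAction (ι := inl K A G) (u := grp A G) (grp_mul_inl K) n g D).1 x =
      grp A G g * (D.1 (diag K A (n + 2) g⁻¹ x) * grp A G g⁻¹) := rfl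

theorem chainRep_in (n : ℕ) (g : G) (x : Chain (inl K A G) n) :
    chainRep (inl K A G) (grp_mul_inl K) g (inD (inl K A G) n x) =
      inD (inl K A G) n
        (chainAction (ι := inl K A G) (u := grp A G) (grp_mul_inl K) n g x) :=
  DirectSum.lmap_lof _ _ _

theorem chainAction_mk (n : ℕ) (g : G) (r : SkewMonoidAlgebra A G) (x : T K A (n + 2)) :
    chainAction (ι := inl K A G) (u := grp A G) (grp_mul_inl K) n g
        (Chain.mk (inl K A G) n (r ⊗ₜ[K] x)) =
      Chain.mk (inl K A G) n ((grp A G g * (r * grp A G g⁻¹)) ⊗ₜ[K] diag K A (n + 2) g x) := rfl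

variable [Fintype G] [DecidableEq G]

/-- The extension of a linear map `A^{⊗ m} → A ⋊ G` to `(A ⋊ G)^{⊗ m}`: the average over `g` of
`∑ₕ u(g)⁻¹ D(tr_{g,h} x) u(h)`. -/
def extend (m : ℕ) (D : T K A m →ₗ[K] SkewMonoidAlgebra A G) :
    T K (SkewMonoidAlgebra A G) m →ₗ[K] SkewMonoidAlgebra A G :=
  (Fintype.card G : K)⁻¹ • ∑ h : G, ∑ g : G, LinearMap.mulRight K (grp A G h) ∘ₗ
    LinearMap.mulLeft K (grp A G g⁻¹) ∘ₗ D ∘ₗ trG K A G m g h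

theorem extend_apply (m : ℕ) (D : T K A m →ₗ[K] SkewMonoidAlgebra A G)
    (x : T K (SkewMonoidAlgebra A G) m) : extend K m D x = (Fintype.card G : K)⁻¹ •
      ∑ h : G, ∑ g : G, grp A G g⁻¹ * D (trG K A G m g h x) * grp A G h := by
  simp only [extend, LinearMap.smul_apply, LinearMap.sum_apply, LinearMap.comp_apply,
    LinearMap.mulRight_apply, LinearMap.mulLeft_apply]

theorem extend_lmul (m : ℕ) (D : T K A (m + 1) →ₗ[K] SkewMonoidAlgebra A G)
    (hD : ∀ (a : A) x, D (lmul K m a x) = inl K A G a * D x) (y : SkewMonoidAlgebra A G)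
    (x : T K (SkewMonoidAlgebra A G) (m + 1)) :
    extend K (m + 1) D (lmul K m y x) = y * extend K (m + 1) D x := by
  rw [extend_apply, extend_apply, mul_smul_comm, Finset.mul_sum]
  congr 1
  refine Finset.sum_congr rfl fun h _ => ?_
  rw [← Finset.sum_mul, ← Finset.sum_mul, ← mul_assoc]
  congr 1
  simp only [trG, tr_lmul, map_sum, hD, Finset.mul_sum]
  rw [Finset.sum_comm]
  refine Finset.sum_congr rfl fun l _ => ?_
  simp only [← mul_assoc]
  rw [← Finset.sum_mul, sum_grp_mul_toMatrix]

theorem extend_rmul (m : ℕ) (D : T K A (m + 1) →ₗ[K] SkewMonoidAlgebra A G)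
    (hD : ∀ (a : A) x, D (rmul K m a x) = D x * inl K A G a) (y : SkewMonoidAlgebra A G)
    (x : T K (SkewMonoidAlgebra A G) (m + 1)) :
    extend K (m + 1) D (rmul K m y x) = extend K (m + 1) D x * y := by
  rw [extend_apply, extend_apply, smul_mul_assoc, Finset.sum_comm]
  conv_rhs => rw [Finset.sum_comm]
  rw [Finset.sum_mul]
  congr 1
  refine Finset.sum_congr rfl fun g _ => ?_
  simp only [trG, tr_rmul, map_sum, hD, Finset.mul_sum, Finset.sum_mul]
  rw [Finset.sum_comm]
  refine Finset.sum_congr rfl fun l _ => ?_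
  simp only [mul_assoc]
  rw [← Finset.mul_sum, ← Finset.mul_sum, sum_toMatrix_mul_grp]

variable (A G) in
/-- Extension of `n`-cochains of `A` with values in `A ⋊ G` to `A ⋊ G`. -/
def extC (n : ℕ) :
    Cochain (inl K A G) n →ₗ[K] Cochain (AlgHom.id K (SkewMonoidAlgebra A G)) n where
  toFun D := ⟨extend K (n + 2) D.1, fun y x =>
    ⟨extend_lmul K (n + 1) D.1 (fun a x => (D.2 a x).1) y x,
      extend_rmul K (n + 1) D.1 (fun a x => (D.2 a x).2) y x⟩⟩
  map_add' D E := Subtype.ext (LinearMap.ext fun x => by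
    change extend K (n + 2) (D.1 + E.1) x = extend K (n + 2) D.1 x + extend K (n + 2) E.1 x
    simp only [extend_apply, LinearMap.add_apply, mul_add, add_mul, Finset.sum_add_distrib,
      smul_add])
  map_smul' c D := Subtype.ext (LinearMap.ext fun x => by
    change extend K (n + 2) (c • D.1) x = c • extend K (n + 2) D.1 x
    simp only [extend_apply, LinearMap.smul_apply, mul_smul_comm, smul_mul_assoc,
      ← Finset.smul_sum, smul_comm c])

theorem extC_apply (n : ℕ) (D : Cochain (inl K A G) n) (x) :
    (extC K A G n D).1 x = extend K (n + 2) D.1 x := rfl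

theorem resC_extC (n : ℕ) (D : Cochain (inl K A G) n) :
    resC (inl K A G) n (extC K A G n D) = (Fintype.card G : K)⁻¹ •
      ∑ g : G, cochainAction (ι := inl K A G) (u := grp A G) (grp_mul_inl K) n g D := by
  refine Cochain.ext fun x => ?_
  rw [resC_apply, extC_apply, Cochain.smul_apply, Cochain.sum_apply, extend_apply]
  refine congrArg (fun z => (Fintype.card G : K)⁻¹ • z)
    (Fintype.sum_equiv (Equiv.inv G) _ _ fun h => ?_)
  rw [Finset.sum_eq_single h (fun g _ hg => by
    rw [trG_incl, if_neg hg, map_zero, mul_zero, zero_mul]) (by simp), trG_incl, if_pos rfl,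
    cochainAction_apply, Equiv.inv_apply, inv_inv, mul_assoc]

theorem extC_cochainAction (n : ℕ) (k : G) (D : Cochain (inl K A G) n) :
    extC K A G n (cochainAction (ι := inl K A G) (u := grp A G) (grp_mul_inl K) n k D) =
      extC K A G n D := by
  refine Subtype.ext (LinearMap.ext fun x => ?_)
  rw [extC_apply, extC_apply, extend_apply, extend_apply]
  congr 1
  refine Fintype.sum_equiv (Equiv.mulLeft k⁻¹) _ _ fun h =>
    Fintype.sum_equiv (Equiv.mulLeft k⁻¹) _ _ fun g => ?_
  rw [cochainAction_apply, diag_trG, Equiv.coe_mulLeft, mul_inv_rev, inv_inv,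
    map_mul (grp A G) g⁻¹ k, map_mul (grp A G) k⁻¹ h]
  simp only [mul_assoc]

/-- The pushforward of `n`-chains of `A ⋊ G` to `n`-chains of `A`: the average over `g` of
`∑ₕ u(h) r u(g)⁻¹ ⊗ tr_{g,h} x`. -/
def pushAux (n : ℕ) : SkewMonoidAlgebra A G ⊗[K] T K (SkewMonoidAlgebra A G) (n + 2) →ₗ[K]
    Chain (inl K A G) n :=
  (Fintype.card G : K)⁻¹ • ∑ h : G, ∑ g : G, Chain.mk (inl K A G) n ∘ₗ
    TensorProduct.map (LinearMap.mulLeft K (grp A G h) ∘ₗ LinearMap.mulRight K (grp A G g⁻¹))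
      (trG K A G (n + 2) g h)

theorem pushAux_tmul (n : ℕ) (r : SkewMonoidAlgebra A G)
    (x : T K (SkewMonoidAlgebra A G) (n + 2)) :
    pushAux K n (r ⊗ₜ[K] x) = (Fintype.card G : K)⁻¹ • ∑ h : G, ∑ g : G,
      Chain.mk (inl K A G) n ((grp A G h * (r * grp A G g⁻¹)) ⊗ₜ[K] trG K A G (n + 2) g h x) := by
  simp only [pushAux, LinearMap.smul_apply, LinearMap.sum_apply, LinearMap.comp_apply,
    TensorProduct.map_tmul, LinearMap.mulRight_apply, LinearMap.mulLeft_apply]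

theorem pushAux_lmul (n : ℕ) (r y : SkewMonoidAlgebra A G)
    (x : T K (SkewMonoidAlgebra A G) (n + 2)) :
    pushAux K n (r ⊗ₜ[K] lmul K (n + 1) y x) = pushAux K n ((r * y) ⊗ₜ[K] x) := by
  rw [pushAux_tmul, pushAux_tmul]
  congr 1
  refine Finset.sum_congr rfl fun h _ => ?_
  simp only [trG, tr_lmul, TensorProduct.tmul_sum, map_sum, Chain.mk_lmul]
  rw [Finset.sum_comm]
  refine Finset.sum_congr rfl fun l _ => ?_
  rw [← map_sum, ← TensorProduct.sum_tmul]
  simp only [mul_assoc]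
  rw [← Finset.mul_sum, ← Finset.mul_sum, sum_grp_mul_toMatrix]

theorem pushAux_rmul (n : ℕ) (r y : SkewMonoidAlgebra A G)
    (x : T K (SkewMonoidAlgebra A G) (n + 2)) :
    pushAux K n (r ⊗ₜ[K] rmul K (n + 1) y x) = pushAux K n ((y * r) ⊗ₜ[K] x) := by
  rw [pushAux_tmul, pushAux_tmul, Finset.sum_comm]
  conv_rhs => rw [Finset.sum_comm]
  congr 1
  refine Finset.sum_congr rfl fun g _ => ?_
  simp only [trG, tr_rmul, TensorProduct.tmul_sum, map_sum, Chain.mk_rmul]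
  rw [Finset.sum_comm]
  refine Finset.sum_congr rfl fun l _ => ?_
  rw [← map_sum, ← TensorProduct.sum_tmul]
  simp only [← mul_assoc]
  rw [← Finset.sum_mul, ← Finset.sum_mul, sum_toMatrix_mul_grp]

variable (A G) in
/-- The pushforward of `n`-chains of `A ⋊ G` to `n`-chains of `A` with values in `A ⋊ G`. -/
def pushD (n : ℕ) : Chain (AlgHom.id K (SkewMonoidAlgebra A G)) n →ₗ[K] Chain (inl K A G) n :=
  Chain.lift (pushAux K n) fun y₀ y₁ r x => by
    rw [pushAux_lmul, pushAux_rmul, ← mul_assoc]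
    rfl

theorem pushD_mk (n : ℕ) (r : SkewMonoidAlgebra A G) (x : T K (SkewMonoidAlgebra A G) (n + 2)) :
    pushD K A G n (Chain.mk _ n (r ⊗ₜ[K] x)) = (Fintype.card G : K)⁻¹ • ∑ h : G, ∑ g : G,
      Chain.mk (inl K A G) n ((grp A G h * (r * grp A G g⁻¹)) ⊗ₜ[K] trG K A G (n + 2) g h x) :=
  pushAux_tmul K n r x

theorem pushD_inclD (n : ℕ) (c : Chain (inl K A G) n) :
    pushD K A G n (inclD (inl K A G) n c) = (Fintype.card G : K)⁻¹ •
      ∑ g : G, chainAction (ι := inl K A G) (u := grp A G) (grp_mul_inl K) n g c := by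
  refine LinearMap.congr_fun (f := pushD K A G n ∘ₗ inclD (inl K A G) n)
    (g := (Fintype.card G : K)⁻¹ • ∑ g : G,
      chainAction (ι := inl K A G) (u := grp A G) (grp_mul_inl K) n g)
    (Chain.hom_ext fun r x => ?_) c |>.trans (by simp [LinearMap.sum_apply])
  rw [LinearMap.comp_apply, LinearMap.smul_apply, LinearMap.sum_apply]
  refine (pushD_mk K n r _).trans ?_
  congr 1
  refine Finset.sum_congr rfl fun h _ => ?_
  rw [Finset.sum_eq_single h (fun g _ hg => by
    rw [trG_incl, if_neg hg, TensorProduct.tmul_zero, map_zero]) (by simp), trG_incl, if_pos rfl,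
    chainAction_mk]

theorem chainAction_pushD (n : ℕ) (k : G) (c : Chain (AlgHom.id K (SkewMonoidAlgebra A G)) n) :
    chainAction (ι := inl K A G) (u := grp A G) (grp_mul_inl K) n k (pushD K A G n c) =
      pushD K A G n c := by
  refine LinearMap.congr_fun
    (f := chainAction (ι := inl K A G) (u := grp A G) (grp_mul_inl K) n k ∘ₗ
      pushD K A G n)
    (g := pushD K A G n) (Chain.hom_ext fun r x => ?_) c
  rw [LinearMap.comp_apply, pushD_mk, map_smul, map_sum]
  congr 1
  refine Fintype.sum_equiv (Equiv.mulLeft k) _ _ fun h => ?_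
  rw [map_sum]
  refine Fintype.sum_equiv (Equiv.mulLeft k) _ _ fun g => ?_
  rw [chainAction_mk, diag_trG, Equiv.coe_mulLeft, mul_inv_rev, map_mul (grp A G) k h,
    map_mul (grp A G) g⁻¹ k⁻¹]
  simp only [mul_assoc]

theorem toMatrix_curvature (W : A) (hG : ∀ g : G, g • W = W) :
    toMatrix K A G (inl K A G W) = Matrix.diagonal fun _ => W := by
  rw [toMatrix_inl]
  simp only [hG]

variable [CharZero K]

variable (A G) in
/-- The endomorphism of the bar resolution of `A ⋊ G` which is the average over `g` of
`x ↦ ∑ₕ u(g)⁻¹ (tr_{g,h} x) u(h)`. -/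
def averageEndo : BarEndo K (SkewMonoidAlgebra A G) where
  P m := (Fintype.card G : K)⁻¹ • ∑ h : G, ∑ g : G, rmul K m (grp A G h) ∘ₗ
    lmul K m (grp A G g⁻¹) ∘ₗ incl (inl K A G) (m + 1) ∘ₗ trG K A G (m + 1) g h
  P_zero := T_ext_cons fun x t => by
    have hid : ∀ g : G, incl (inl K A G) 0 (trG K A G 0 g g t) = t := fun g => by
      refine lin_ext (f := incl (inl K A G) 0 ∘ₗ trG K A G 0 g g) (g := LinearMap.id)
        (fun a => ?_) t
      rw [LinearMap.comp_apply, trG, tr, if_pos rfl]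
      refine (congrArg (incl (inl K A G) 0) (PiTensorProduct.map_tprod _ _)).trans ?_
      exact (PiTensorProduct.map_tprod _ _).trans (congrArg _ (funext fun i => i.elim0))
    have hg : ∀ g h : G, rmul K 0 (grp A G h) (lmul K 0 (grp A G g⁻¹)
        (incl (inl K A G) 1 (trG K A G 1 g h (consT x 0 t)))) =
        consT (grp A G g⁻¹ * (inl K A G (toMatrix K A G x g h) * grp A G h)) 0 t := fun g h => by
      have h0 := hid g
      rw [trG] at h0
      rw [trG, tr_one_consT, incl_consT, lmul_consT, rmul_zero_consT, h0, mul_assoc]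
    simp only [LinearMap.smul_apply, LinearMap.sum_apply, LinearMap.comp_apply, LinearMap.id_apply]
    simp only [hg]
    rw [Finset.sum_comm]
    simp only [← consT_sum, ← Finset.mul_sum, sum_toMatrix_mul_grp]
    simp only [← mul_assoc, ← map_mul, inv_mul_cancel, map_one, one_mul, Finset.sum_const]
    rw [Finset.card_univ, ← Nat.cast_smul_eq_nsmul K, consT_smul, smul_smul,
      inv_mul_cancel₀ (AveragingPair.card_ne_zero G), one_smul]
  P_lmul m y x := by
    simp only [LinearMap.smul_apply, LinearMap.sum_apply, LinearMap.comp_apply, map_smul, map_sum]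
    congr 1
    refine Finset.sum_congr rfl fun h _ => ?_
    simp only [trG, tr_lmul, map_sum, incl_lmul, lmul_lmul, lmul_rmul]
    rw [Finset.sum_comm]
    refine Finset.sum_congr rfl fun l _ => ?_
    simp only [← map_sum]
    rw [← lmul_sum, sum_grp_mul_toMatrix]
  P_rmul m y x := by
    simp only [LinearMap.smul_apply, LinearMap.sum_apply, LinearMap.comp_apply, map_smul, map_sum]
    congr 1
    rw [Finset.sum_comm]
    conv_rhs => rw [Finset.sum_comm]
    refine Finset.sum_congr rfl fun g _ => ?_
    simp only [trG, tr_rmul, map_sum, incl_rmul, ← lmul_rmul, rmul_rmul]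
    rw [Finset.sum_comm]
    refine Finset.sum_congr rfl fun l _ => ?_
    rw [← map_sum, ← rmul_sum, sum_toMatrix_mul_grp]
  P_δbar m x := by
    simp only [LinearMap.smul_apply, LinearMap.sum_apply, LinearMap.comp_apply, map_smul, map_sum]
    congr 1
    refine Finset.sum_congr rfl fun h _ => Finset.sum_congr rfl fun g _ => ?_
    rw [trG, tr_δbar, incl_δbar, δbar_rmul, δbar_lmul]

theorem averageEndo_P (m : ℕ) (x : T K (SkewMonoidAlgebra A G) (m + 1)) :
    (averageEndo K A G).P m x = (Fintype.card G : K)⁻¹ • ∑ h : G, ∑ g : G,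
      rmul K m (grp A G h) (lmul K m (grp A G g⁻¹)
        (incl (inl K A G) (m + 1) (trG K A G (m + 1) g h x))) := by
  simp only [averageEndo, LinearMap.smul_apply, LinearMap.sum_apply, LinearMap.comp_apply]

theorem extC_resC_extC (n : ℕ) (D : Cochain (inl K A G) n) :
    extC K A G n (resC (inl K A G) n (extC K A G n D)) = extC K A G n D := by
  rw [resC_extC, map_smul, map_sum, Finset.sum_congr rfl fun g _ => extC_cochainAction K n g D,
    Finset.sum_const, Finset.card_univ, ← Nat.cast_smul_eq_nsmul K, smul_smul,
    inv_mul_cancel₀ (AveragingPair.card_ne_zero G), one_smul]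

theorem pushD_inclD_pushD (n : ℕ) (c : Chain (AlgHom.id K (SkewMonoidAlgebra A G)) n) :
    pushD K A G n (inclD (inl K A G) n (pushD K A G n c)) = pushD K A G n c := by
  rw [pushD_inclD, Finset.sum_congr rfl fun g _ => chainAction_pushD K n g c,
    Finset.sum_const, Finset.card_univ, ← Nat.cast_smul_eq_nsmul K, smul_smul,
    inv_mul_cancel₀ (AveragingPair.card_ne_zero G), one_smul]

theorem extC_resC_apply (n : ℕ) (D : Cochain (AlgHom.id K (SkewMonoidAlgebra A G)) n) (x) :
    (extC K A G n (resC (inl K A G) n D)).1 x = D.1 ((averageEndo K A G).P (n + 1) x) := by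
  rw [extC_apply, extend_apply, averageEndo_P, map_smul, map_sum]
  congr 1
  refine Finset.sum_congr rfl fun h _ => ?_
  rw [map_sum]
  refine Finset.sum_congr rfl fun g _ => ?_
  rw [(D.2 _ _).2, (D.2 _ _).1]
  rfl

theorem inclD_pushD (n : ℕ) (r : SkewMonoidAlgebra A G)
    (x : T K (SkewMonoidAlgebra A G) (n + 2)) :
    inclD (inl K A G) n (pushD K A G n (Chain.mk _ n (r ⊗ₜ[K] x))) =
      Chain.mk _ n (r ⊗ₜ[K] (averageEndo K A G).P (n + 1) x) := by
  rw [pushD_mk, averageEndo_P, TensorProduct.tmul_smul, map_smul, map_smul, map_sum,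
    TensorProduct.tmul_sum, map_sum]
  congr 1
  refine Finset.sum_congr rfl fun h _ => ?_
  rw [map_sum, TensorProduct.tmul_sum, map_sum]
  refine Finset.sum_congr rfl fun g _ => ?_
  rw [Chain.mk_rmul, Chain.mk_lmul, mul_assoc]
  rfl

variable (W : A) (hW : ∀ a : A, a * W = W * a) (hG : ∀ g : G, g • W = W)

/-- Restriction and extension of cochains between `A ⋊ G` and `A`. -/
def cochainPair : AveragingPair (crossedCochains K W hW hG) (twistedCochainsAction K W hW hG) where
  f := cochainHom _ _ _ _ (fun n => resC (inl K A G) n)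
    (fun n D => Subtype.ext (LinearMap.ext fun x => by
      change (-1 : K) ^ n • D.1 (incl (inl K A G) (n + 2) (δbar K (n + 1) x)) =
        (-1 : K) ^ n • D.1 (δbar K (n + 1) (incl (inl K A G) (n + 3) x))
      rw [incl_δbar]))
    (fun n D => Subtype.ext (LinearMap.ext fun x => by
      change (-1 : K) ^ (n + 1) • D.1 (incl (inl K A G) (n + 3) (δcurv K W (n + 1) x)) =
        (-1 : K) ^ (n + 1) • D.1 (δcurv K (inl K A G W) (n + 1) (incl (inl K A G) (n + 2) x))
      rw [incl_δcurv]))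
  e := cochainHom _ _ _ _ (fun n => extC K A G n)
    (fun n D => Subtype.ext (LinearMap.ext fun x => by
      change (-1 : K) ^ n • extend K (n + 2) D.1 (δbar K (n + 1) x) =
        extend K (n + 3) ((-1 : K) ^ n • D.1 ∘ₗ δbar K (n + 1)) x
      simp only [extend_apply, LinearMap.smul_apply, LinearMap.comp_apply, mul_smul_comm,
        smul_mul_assoc, ← Finset.smul_sum, trG, tr_δbar]
      rw [smul_comm]))
    (fun n D => Subtype.ext (LinearMap.ext fun x => by
      change (-1 : K) ^ (n + 1) • extend K (n + 3) D.1 (δcurv K (inl K A G W) (n + 1) x) =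
        extend K (n + 2) ((-1 : K) ^ (n + 1) • D.1 ∘ₗ δcurv K W (n + 1)) x
      simp only [extend_apply, LinearMap.smul_apply, LinearMap.comp_apply, mul_smul_comm,
        smul_mul_assoc, ← Finset.smul_sum, trG, tr_δcurv _ (toMatrix_curvature K W hG)]
      rw [smul_comm]))
  f_e c := by
    refine LinearMap.congr_fun
      (f := DirectSum.lmap (fun n => resC (inl K A G) n) ∘ₗ DirectSum.lmap fun n => extC K A G n)
      (g := (Fintype.card G : K)⁻¹ • ∑ g : G, cochainRep (inl K A G) (grp_mul_inl K) g)
      (DirectSum.linearMap_ext K fun n => LinearMap.ext fun D => ?_) c |>.trans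
      (by simp only [LinearMap.smul_apply, LinearMap.sum_apply]; rfl)
    simp only [LinearMap.comp_apply, LinearMap.smul_apply, LinearMap.sum_apply]
    rw [DirectSum.lmap_lof, DirectSum.lmap_lof, resC_extC, map_smul, map_sum]
    simp only [cochainRep_in]
  e_f_idem c := by
    refine LinearMap.congr_fun
      (f := (DirectSum.lmap (fun n => extC K A G n) ∘ₗ
          DirectSum.lmap fun n => resC (inl K A G) n) ∘ₗ
        DirectSum.lmap (fun n => extC K A G n) ∘ₗ DirectSum.lmap fun n => resC (inl K A G) n)
      (g := DirectSum.lmap (fun n => extC K A G n) ∘ₗ DirectSum.lmap fun n => resC (inl K A G) n)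
      (DirectSum.linearMap_ext K fun n => LinearMap.ext fun D => ?_) c
    simp only [LinearMap.comp_apply]
    rw [DirectSum.lmap_lof, DirectSum.lmap_lof, DirectSum.lmap_lof, DirectSum.lmap_lof,
      extC_resC_extC]
  h := (averageEndo K A G).cochainsH _
  h_mem hc := (averageEndo K A G).cochainsH_mem _ hc
  homotopy c := (averageEndo K A G).cochains_homotopy _
    (DirectSum.lmap (fun n => extC K A G n) ∘ₗ DirectSum.lmap fun n => resC (inl K A G) n)
    (fun n D => extC K A G n (resC (inl K A G) n D))
    (fun n D => by rw [LinearMap.comp_apply, DirectSum.lmap_lof, DirectSum.lmap_lof])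
    (fun n D x => extC_resC_apply K n D x) c

/-- Pushforward and inclusion of chains between `A ⋊ G` and `A`. -/
def chainPair : AveragingPair (crossedChains K W hW hG) (twistedChainsAction K W hW hG) where
  f := chainHom _ _ _ _ (fun n => pushD K A G n)
    (fun n x => by
      refine LinearMap.congr_fun (f := chainBar (inl K A G) n ∘ₗ pushD K A G (n + 1))
        (g := pushD K A G n ∘ₗ chainBar _ n) (Chain.hom_ext fun r x => ?_) x
      rw [LinearMap.comp_apply, LinearMap.comp_apply, chainBar_mk, pushD_mk, pushD_mk]
      simp only [map_smul, map_sum, chainBar_mk, trG, tr_δbar])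
    (fun n x => by
      refine LinearMap.congr_fun (f := chainCurv (inl K A G) W n ∘ₗ pushD K A G n)
        (g := pushD K A G (n + 1) ∘ₗ chainCurv _ (inl K A G W) n) (Chain.hom_ext fun r x => ?_) x
      rw [LinearMap.comp_apply, LinearMap.comp_apply, chainCurv_mk, pushD_mk, pushD_mk]
      simp only [map_smul, map_sum, chainCurv_mk, trG, tr_δcurv _ (toMatrix_curvature K W hG)])
  e := chainHom _ _ _ _ (fun n => inclD (inl K A G) n)
    (fun n x => by
      refine LinearMap.congr_fun (f := chainBar _ n ∘ₗ inclD (inl K A G) (n + 1))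
        (g := inclD (inl K A G) n ∘ₗ chainBar _ n) (Chain.hom_ext fun r x => ?_) x
      change Chain.mk _ n (r ⊗ₜ[K] δbar K (n + 1) (incl (inl K A G) (n + 3) x)) =
        Chain.mk _ n (r ⊗ₜ[K] incl (inl K A G) (n + 2) (δbar K (n + 1) x))
      rw [incl_δbar])
    (fun n x => by
      refine LinearMap.congr_fun (f := chainCurv _ (inl K A G W) n ∘ₗ inclD (inl K A G) n)
        (g := inclD (inl K A G) (n + 1) ∘ₗ chainCurv _ W n) (Chain.hom_ext fun r x => ?_) x
      change Chain.mk _ (n + 1) (r ⊗ₜ[K] δcurv K (inl K A G W) (n + 1)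
          (incl (inl K A G) (n + 2) x)) =
        Chain.mk _ (n + 1) (r ⊗ₜ[K] incl (inl K A G) (n + 3) (δcurv K W (n + 1) x))
      rw [incl_δcurv])
  f_e c := by
    refine LinearMap.congr_fun
      (f := DirectSum.lmap (fun n => pushD K A G n) ∘ₗ DirectSum.lmap fun n => inclD (inl K A G) n)
      (g := (Fintype.card G : K)⁻¹ • ∑ g : G, chainRep (inl K A G) (grp_mul_inl K) g)
      (DirectSum.linearMap_ext K fun n => LinearMap.ext fun x => ?_) c |>.trans
      (by simp only [LinearMap.smul_apply, LinearMap.sum_apply]; rfl)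
    simp only [LinearMap.comp_apply, LinearMap.smul_apply, LinearMap.sum_apply]
    rw [DirectSum.lmap_lof, DirectSum.lmap_lof, pushD_inclD, map_smul, map_sum]
    simp only [chainRep_in]
  e_f_idem c := by
    refine LinearMap.congr_fun
      (f := (DirectSum.lmap (fun n => inclD (inl K A G) n) ∘ₗ
          DirectSum.lmap fun n => pushD K A G n) ∘ₗ
        DirectSum.lmap (fun n => inclD (inl K A G) n) ∘ₗ DirectSum.lmap fun n => pushD K A G n)
      (g := DirectSum.lmap (fun n => inclD (inl K A G) n) ∘ₗ DirectSum.lmap fun n => pushD K A G n)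
      (DirectSum.linearMap_ext K fun n => LinearMap.ext fun x => ?_) c
    simp only [LinearMap.comp_apply]
    rw [DirectSum.lmap_lof, DirectSum.lmap_lof, DirectSum.lmap_lof, DirectSum.lmap_lof,
      pushD_inclD_pushD]
  h := (averageEndo K A G).chainsH _
  h_mem hc := (averageEndo K A G).chainsH_mem _ hc
  homotopy c := (averageEndo K A G).chains_homotopy _
    (DirectSum.lmap (fun n => inclD (inl K A G) n) ∘ₗ DirectSum.lmap fun n => pushD K A G n)
    (fun n r x => by
      rw [LinearMap.comp_apply, DirectSum.lmap_lof, DirectSum.lmap_lof, inclD_pushD]) c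

end Comparison

/-! ### Compatibility with products -/

section PairingMaps

variable {K : Type*} [Field K]
  {C₁ C₂ C₃ C₁' C₂' C₃' : Type*} [AddCommGroup C₁] [Module K C₁] [AddCommGroup C₂] [Module K C₂]
  [AddCommGroup C₃] [Module K C₃] [AddCommGroup C₁'] [Module K C₁'] [AddCommGroup C₂']
  [Module K C₂'] [AddCommGroup C₃'] [Module K C₃']
  {X : MixedComplex K C₁} {Y : MixedComplex K C₂} {Z : MixedComplex K C₃}
  {X' : MixedComplex K C₁'} {Y' : MixedComplex K C₂'} {Z' : MixedComplex K C₃'}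

theorem MixedHom.onH_pairing (P : MixedPairing X Y Z) (P' : MixedPairing X' Y' Z')
    (f : MixedHom X X') (g : MixedHom Y Y') (k : MixedHom Z Z')
    (h : ∀ c d, k.f (P.μ c d) = P'.μ (f.f c) (g.f d)) (p q : ℤ) (x : X.H p) (y : Y.H q) :
    k.onH (p + q) (P.onH p q x y) = P'.onH p q (f.onH p x) (g.onH q y) := by
  obtain ⟨c, rfl⟩ := X.toH_surjective p x
  obtain ⟨d, rfl⟩ := Y.toH_surjective q y
  refine congrArg (Z'.toH (p + q)) (Subtype.ext (funext fun i => ?_))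
  change k.f (conv P.μ c.1 d.1 i) = conv P'.μ (fun j => f.f (c.1 j)) (fun j => g.f (d.1 j)) i
  rw [conv_map P.μ k.f c.2.1.1 d.2.1.1]
  exact finsum_congr fun j => h _ _

/-- The projection formula on periodic cohomology. -/
theorem MixedHom.onH_projection (P : MixedPairing X Y Z) (P' : MixedPairing X' Y' Z')
    (f : MixedHom X X') (g : MixedHom Y' Y) (k : MixedHom Z Z')
    (h : ∀ c d, k.f (P.μ c (g.f d)) = P'.μ (f.f c) d) (p q : ℤ) (x : X.H p) (y : Y'.H q) :
    k.onH (p + q) (P.onH p q x (g.onH q y)) = P'.onH p q (f.onH p x) y := by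
  obtain ⟨c, rfl⟩ := X.toH_surjective p x
  obtain ⟨d, rfl⟩ := Y'.toH_surjective q y
  refine congrArg (Z'.toH (p + q)) (Subtype.ext (funext fun i => ?_))
  change k.f (conv P.μ c.1 (fun j => g.f (d.1 j)) i) = conv P'.μ (fun j => f.f (c.1 j)) d.1 i
  rw [conv_map P.μ k.f c.2.1.1 (bnd_map g.f d.2.1.1)]
  exact finsum_congr fun j => h _ _

variable {G : Type*} [Group G] [Fintype G] [CharZero K] {α₁ : X'.Action G} {α₂ : Y'.Action G}
  {α₃ : Z'.Action G}

theorem AveragingPair.equivInvariants_tPow (P : AveragingPair X α₁) (k n : ℤ) (x : X.H n) :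
    P.equivInvariants (n + 2 * k) (X.tPow k n x) = α₁.tPowInv k n (P.equivInvariants n x) :=
  Subtype.ext (P.f.onH_tPow k n x)

theorem AveragingPair.equivCoinvariants_tPow (P : AveragingPair X α₁) (k n : ℤ) (x : X.H n) :
    P.equivCoinvariants (n + 2 * k) (X.tPow k n x) = α₁.tPowCoinv k n (P.equivCoinvariants n x) :=
  congrArg (Representation.Coinvariants.mk _) (P.f.onH_tPow k n x)

/-- The identification with invariants is multiplicative when the morphisms `X → X'` are. -/
theorem AveragingPair.equivInvariants_onInvariants (P₁ : AveragingPair X α₁)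
    (P₂ : AveragingPair Y α₂) (P₃ : AveragingPair Z α₃) (M : MixedPairing X Y Z)
    (M' : MixedPairing X' Y' Z')
    (hM' : ∀ (g : G) c d, M'.μ (α₁.ρ g c) (α₂.ρ g d) = α₃.ρ g (M'.μ c d))
    (h : ∀ c d, P₃.f.f (M.μ c d) = M'.μ (P₁.f.f c) (P₂.f.f d)) (p q : ℤ) (x : X.H p) (y : Y.H q) :
    P₃.equivInvariants (p + q) (M.onH p q x y) =
      M'.onInvariants hM' p q (P₁.equivInvariants p x) (P₂.equivInvariants q y) :=
  Subtype.ext (MixedHom.onH_pairing M M' P₁.f P₂.f P₃.f h p q x y)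

/-- The identifications with coinvariants and invariants are compatible with module structures
satisfying a projection formula. -/
theorem AveragingPair.equivCoinvariants_onCoinvariants (P₁ : AveragingPair X α₁)
    (P₂ : AveragingPair Y α₂) (P₃ : AveragingPair Z α₃) (M : MixedPairing X Y Z)
    (M' : MixedPairing X' Y' Z')
    (hM' : ∀ (g : G) c d, M'.μ (α₁.ρ g c) (α₂.ρ g d) = α₃.ρ g (M'.μ c d))
    (h : ∀ c d, P₃.e.f (M'.μ c (P₂.f.f d)) = M.μ (P₁.e.f c) d) (p q : ℤ) (x : X.H p)
    (y : Y.H q) :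
    P₃.equivCoinvariants (p + q) (M.onH p q x y) =
      M'.onCoinvariants hM' p q (P₁.equivCoinvariants p x) (P₂.equivInvariants q y) := by
  -- write `x` as the image of a class of `X'`, to which the projection formula applies
  obtain ⟨ξ, rfl⟩ := (P₁.equivCoinvariants p).symm.surjective x
  obtain ⟨ξ, rfl⟩ := Representation.Coinvariants.mk_surjective _ ξ
  rw [LinearEquiv.apply_symm_apply, ← LinearEquiv.eq_symm_apply]
  exact (MixedHom.onH_projection M' M P₁.e P₂.f P₃.e h p q ξ y).symm

end PairingMaps

section HochschildProducts

variable {K : Type u} {A : Type v} {R : Type w} [Field K] [Ring A] [Algebra K A] [Ring R]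
  [Algebra K R] (ι : A →ₐ[K] R)

theorem resC_tp (n : ℕ) (D : Cochain (AlgHom.id K R) n) (a : ℕ → A) :
    (resC ι n D).1 (tp K (n + 2) a) = D.1 (tp K (n + 2) fun i => ι (a i)) := by
  rw [resC_apply, incl_tp]

theorem inclD_sym (n : ℕ) (r : R) (a : ℕ → A) :
    DirectSum.lmap (fun n => inclD ι n) (sym ι n r a) =
      sym (AlgHom.id K R) n r fun i => ι (a i) := by
  refine (DirectSum.lmap_lof _ _ _).trans ?_
  change inD _ n (Chain.mk _ n (r ⊗ₜ[K] incl ι (n + 2) (tp K (n + 2) a))) = _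
  rw [incl_tp]
  rfl

theorem leftSeq_map (p : ℕ) (a : ℕ → A) :
    leftSeq p (fun i => ι (a i)) = fun i => ι (leftSeq p a i) := by
  funext j
  simp only [leftSeq]; split_ifs <;> simp

theorem rightSeq_map (p : ℕ) (a : ℕ → A) :
    rightSeq p (fun i => ι (a i)) = fun i => ι (rightSeq p a i) := by
  funext j
  simp only [rightSeq]; split_ifs <;> simp

/-- Restriction of cochains is multiplicative. -/
theorem resC_cupProd (c d : Cochains (AlgHom.id K R)) :
    DirectSum.lmap (fun n => resC ι n) (cupProd (AlgHom.id K R) c d) =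
      cupProd ι (DirectSum.lmap (fun n => resC ι n) c) (DirectSum.lmap (fun n => resC ι n) d) := by
  let r : Cochains (AlgHom.id K R) →ₗ[K] Cochains ι := DirectSum.lmap fun n => resC ι n
  have hr : ∀ n D, r (inC _ n D) = inC ι n (resC ι n D) := fun n D => DirectSum.lmap_lof _ _ _
  refine LinearMap.congr_fun₂ (f := (cupProd (AlgHom.id K R)).compr₂ r)
    (g := (cupProd ι).compl₁₂ r r)
    (DirectSum.linearMap_ext K fun p => LinearMap.ext fun D =>
      DirectSum.linearMap_ext K fun q => LinearMap.ext fun E => ?_) c d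
  change r (cupProd _ (inC _ p D) (inC _ q E)) = cupProd ι (r (inC _ p D)) (r (inC _ q E))
  rw [hr, hr, cupProd_in, cupProd_in, hr]
  refine congrArg (inC ι (p + q)) (Subtype.ext (T_ext fun a => ?_))
  rw [resC_tp, cup_tp, cup_tp, resC_tp, resC_tp, leftSeq_map, rightSeq_map]

/-- The projection formula for the inclusion of chains and the restriction of cochains. -/
theorem inclD_capProd (c : Chains ι) (d : Cochains (AlgHom.id K R)) :
    DirectSum.lmap (fun n => inclD ι n) (capProd ι c (DirectSum.lmap (fun n => resC ι n) d)) =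
      capProd (AlgHom.id K R) (DirectSum.lmap (fun n => inclD ι n) c) d := by
  let r : Cochains (AlgHom.id K R) →ₗ[K] Cochains ι := DirectSum.lmap fun n => resC ι n
  have hr : ∀ n D, r (inC _ n D) = inC ι n (resC ι n D) := fun n D => DirectSum.lmap_lof _ _ _
  let s : Chains ι →ₗ[K] Chains (AlgHom.id K R) := DirectSum.lmap fun n => inclD ι n
  have hs : ∀ n x a, s (sym ι n x a) = sym _ n x fun i => ι (a i) := inclD_sym ι
  refine LinearMap.congr_fun₂ (f := ((capProd ι).compl₂ r).compr₂ s)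
    (g := (capProd (AlgHom.id K R)) ∘ₗ s)
    (chains_ext fun n x a => DirectSum.linearMap_ext K fun p => LinearMap.ext fun D => ?_) c d
  change s (capProd ι (sym ι n x a) (r (inC _ p D))) = capProd _ (s (sym ι n x a)) (inC _ p D)
  rw [hr, hs]
  rcases lt_or_ge n p with h | h
  · rw [capProd_sym_of_lt h, capProd_sym_of_lt h, map_zero]
  · obtain ⟨q, rfl⟩ := Nat.exists_eq_add_of_le h
    rw [capProd_sym (q := q) rfl, capProd_sym (q := q) rfl, map_smul, hs, resC_tp, leftSeq_map,
      rightSeq_map]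

end HochschildProducts

end

end CurvedHochschild

theorem proposition2p3 {K A G : Type*} [Field K] [CharZero K] [Ring A] [Algebra K A]
    [Group G] [Finite G] [MulSemiringAction G A] [SMulCommClass G K A]
    (W : A) (hW : ∀ a : A, a * W = W * a) (hG : ∀ g : G, g • W = W) :
    ∃ (Φ : ∀ n : ℤ, (CurvedHochschild.crossedCochains K W hW hG).H n ≃ₗ[K]
          CurvedHochschild.TwistedInv K W hW hG n)
      (Ψ : ∀ n : ℤ, (CurvedHochschild.crossedChains K W hW hG).H n ≃ₗ[K]
          CurvedHochschild.TwistedCoinv K W hW hG n),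
      (∀ (k n : ℤ) (x : (CurvedHochschild.crossedCochains K W hW hG).H n),
        Φ (n + 2 * k) ((CurvedHochschild.crossedCochains K W hW hG).tPow k n x) =
          (CurvedHochschild.twistedCochainsAction K W hW hG).tPowInv k n (Φ n x)) ∧
      (∀ (k n : ℤ) (ω : (CurvedHochschild.crossedChains K W hW hG).H n),
        Ψ (n + 2 * k) ((CurvedHochschild.crossedChains K W hW hG).tPow k n ω) =
          (CurvedHochschild.twistedChainsAction K W hW hG).tPowCoinv k n (Ψ n ω)) ∧
      (∀ (p q : ℤ) (x : (CurvedHochschild.crossedCochains K W hW hG).H p)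
          (y : (CurvedHochschild.crossedCochains K W hW hG).H q),
        Φ (p + q) ((CurvedHochschild.crossedCup K W hW hG).onH p q x y) =
          CurvedHochschild.twistedCup K W hW hG p q (Φ p x) (Φ q y)) ∧
      (∀ (p q : ℤ) (ω : (CurvedHochschild.crossedChains K W hW hG).H p)
          (x : (CurvedHochschild.crossedCochains K W hW hG).H q),
        Ψ (p + q) ((CurvedHochschild.crossedCap K W hW hG).onH p q ω x) =
          CurvedHochschild.twistedCap K W hW hG p q (Ψ p ω) (Φ q x)) := by
  classical
  have := Fintype.ofFinite G
  exact ⟨(CurvedHochschild.cochainPair K W hW hG).equivInvariants,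
    (CurvedHochschild.chainPair K W hW hG).equivCoinvariants,
    CurvedHochschild.AveragingPair.equivInvariants_tPow _,
    CurvedHochschild.AveragingPair.equivCoinvariants_tPow _,
    CurvedHochschild.AveragingPair.equivInvariants_onInvariants _ _ _ _ _ _
      (CurvedHochschild.resC_cupProd _),
    CurvedHochschild.AveragingPair.equivCoinvariants_onCoinvariants _ _ _ _ _ _
      (CurvedHochschild.inclD_capProd _)⟩
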